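/- **Setting.** Let $q_0=(\tfrac1{\sqrt3},1)$, $q_1=(0,0)$, $q_2=(\tfrac2{\sqrt3},0)$, let $F_i(z)=\tfrac12(z+q_i)$ for $i=0,1,2$, and let $\mathcal{SG}\subset\mathbb R^2$ be the Sierpinski gasket, the unique nonempty compact set with $\mathcal{SG}=\bigcup_{i}F_i\mathcal{SG}$. Put $V_0=\{q_0,q_1,q_2\}$, $V_{m+1}=\bigcup_iF_iV_m$, and $F_w=F_{w_1}\circ\cdots\circ F_{w_m}$ for $w\in\{0,1,2\}^m$; the sets $F_w\mathcal{SG}$ with $|w|=m$ are the $m$-cells. For $x\ne y$ in $V_m$ write $x\sim_my$ if $x,y$ lie in a common $m$-cell. Let $0\le\lambda<1$ and $$\Omega=\Omega_\lambda^-=\{(x,y)\in\mathcal{SG}\setminus V_0: y<1-\lambda\},\qquad \partial\Omega=X\cup\{q_1,q_2\},\qquad \bar\Omega=\Omega\cup\partial\Omega .$$ Here $X=X_\lambda^-=\{(x,y)\in\mathcal{SG}:y=1-\lambda\}$ if $\lambda$ is not a dyadic rational, while if $\lambda$ is a dyadic rational, $X=V_{d}\cap\{(x,y)\in\mathcal{SG}:y=1-\lambda\}$,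 where $d\ge 0$ is the smallest integer such that $\lambda$ is a multiple of $2^{-d}$. A function $u$ is *harmonic in $\Omega$* ($\Delta u=0$) if $\sum_{y\sim_mx}(u(x)-u(y))=0$ for every $m$ and every $x\in V_m\cap\Omega$ such that all $m$-cells containing $x$ lie in $\Omega\cup\{q_1,q_2\}$. For $f\in C(\partial\Omega)$, a *solution of the Dirichlet problem with data $f$* is a function $u\in C(\bar\Omega)$ that is harmonic in $\Omega$ with $u|_{\partial\Omega}=f$. The normal derivative at $q_i$ is (indices mod $3$) $$\partial_nu(q_i)=\lim_{m\to\infty}\left(\tfrac53\right)^m\bigl(2u(q_i)-u(F_i^mq_{i+1})-u(F_i^mq_{i-1})\bigr),$$ if the limit exists. The energy on $\Omega$ is $\mathcal E_\Omega(u,v)=\lim_{m\to\infty}\left(\tfrac53\right)^m\sum(u(x)-u(y))(v(x)-v(y))$, if the limit exists, the sum being over the edges $\{x,y\}$, $x\sim_my$, of the $m$-cells contained in $\Omega\cup\{q_1,q_2\}$; $u$ has *finite energy* if $\mathcal E_\Omega(u)=\mathcal E_\Omega(u,u)<\infty$. Let $h_1=h_1^\lambda$ and $h_2=h_2^\lambda$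 be the solutions of the Dirichlet problem that vanish on $X$ and satisfy $h_1(q_1)=1$, $h_1(q_2)=0$ and $h_2(q_1)=0$, $h_2(q_2)=1$. Put $$\eta_1(\lambda)=\partial_nh_1^\lambda(q_1),\qquad \eta_2(\lambda)=-\partial_nh_1^\lambda(q_2).$$ Let $\lambda=\sum_{k\ge1}e_k(\lambda)2^{-k}$ be the binary expansion without a tail of $1$'s, and $S\lambda=\sum_{k\ge1}e_{k+1}(\lambda)2^{-k}$. With $a=\eta_1(S\lambda)$, $b=\eta_2(S\lambda)$ put $$M_0^\lambda=\frac1{6+4a+4b}\begin{pmatrix}3+3a+3b&3+a+b\\3+a+b&3+3a+3b\end{pmatrix},\quad M_1^\lambda=\begin{pmatrix}1&0\\-\frac b{2a}&\frac b{2a}\end{pmatrix},\quad M_2^\lambda=\begin{pmatrix}\frac b{2a}&-\frac b{2a}\\0&1\end{pmatrix},$$ and $M_w^\lambda=M_{w_m}^{S^{m-1}\lambda}\cdots M_{w_2}^{S\lambda}M_{w_1}^\lambda$ for a word $w$ of length $m$. Let $\tilde W_m^\lambda$ be the set of words $w$ of length $m$ with $w_k=0$ if $e_k(\lambda)=0$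 and $w_k\in\{1,2\}$ if $e_k(\lambda)=1$, and let $X_w=F_w\mathcal{SG}\cap X$. Let $\mu_1^\lambda,\mu_2^\lambda$ be the Borel probability measures on $X$ such that, for all $m\ge 0$ and $w\in\tilde W_m^\lambda$, $$\mu_1^\lambda(X_w)=\frac{(1,1)\,M_w^\lambda\begin{pmatrix}\eta_1(\lambda)\\-\eta_2(\lambda)\end{pmatrix}}{\eta_1(\lambda)-\eta_2(\lambda)},\qquad \mu_2^\lambda(X_w)=\frac{(1,1)\,M_w^\lambda\begin{pmatrix}-\eta_2(\lambda)\\\eta_1(\lambda)\end{pmatrix}}{\eta_1(\lambda)-\eta_2(\lambda)}.$$ **Theorem 4.5.** Let $0\le\lambda<1$. The functions $h_1,h_2$ exist and are unique on $\bar\Omega$, the limits defining $\eta_1(\lambda),\eta_2(\lambda)$ exist, and the measures $\mu_1^\lambda,\mu_2^\lambda$ exist and are unique. Let $f\in C(\partial\Omega)$ and let $u$ be a solution of the Dirichlet problem with data $f$. Then the normal derivatives of $u$ at $q_1,q_2$ exist and $$\partial_nu(q_1)=\eta_1(\lambda)f(q_1)-\eta_2(\lambda)f(q_2)-\bigl(\eta_1(\lambda)-\eta_2(\lambda)\bigr)\int_Xf\,d\mu_1^\lambda,$$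 $$\partial_nu(q_2)=\eta_1(\lambda)f(q_2)-\eta_2(\lambda)f(q_1)-\bigl(\eta_1(\lambda)-\eta_2(\lambda)\bigr)\int_Xf\,d\mu_2^\lambda.$$ In addition, if $\mathcal E_\Omega(u)<\infty$, then the following energies exist and $$\mathcal E_\Omega(h_1,u)=\partial_nu(q_1),\qquad \mathcal E_\Omega(h_2,u)=\partial_nu(q_2).$$ -/

import Mathlib

open Set Filter Topology MeasureTheory

noncomputable section

namespace LowerSG

/-! ## The Sierpinski gasket -/

/-- The three boundary vertices `q₀` (top), `q₁` (bottom left), `q₂` (bottom right). -/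
def q : Fin 3 → ℝ × ℝ := ![(1 / √3, 1), (0, 0), (2 / √3, 0)]

/-- The contraction `F_i` of ratio `1/2` with fixed point `q_i`. -/
def F (i : Fin 3) (p : ℝ × ℝ) : ℝ × ℝ := (1 / 2 : ℝ) • (p + q i)

/-- `F_w = F_{w₁} ∘ ⋯ ∘ F_{w_m}` for a word `w = w₁ ⋯ w_m`. -/
def cellMap : List (Fin 3) → ℝ × ℝ → ℝ × ℝ
  | [] => id
  | i :: w => F i ∘ cellMap w

/-- The point with address `s`, that is `lim F_{s₀} ∘ ⋯ ∘ F_{s_n} (x)`. -/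
def addr (s : ℕ → Fin 3) : ℝ × ℝ := ∑' k, (1 / 2 : ℝ) ^ (k + 1) • q (s k)

/-- The Sierpinski gasket. It is the unique nonempty compact set that is the union of its images
under the three contractions: see `SG_isAttractor` and `SG_unique` below. -/
def SG : Set (ℝ × ℝ) := range addr

/-- Nonempty compact sets that are the union of their three contracted copies. -/
def IsAttractor (K : Set (ℝ × ℝ)) : Prop :=
  IsCompact K ∧ K.Nonempty ∧ K = ⋃ i, F i '' K

theorem norm_q_le (i : Fin 3) : ‖q i‖ ≤ 2 := by
  have h3 : (1 : ℝ) ≤ √3 := by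
    rw [Real.one_le_sqrt]; norm_num
  have h3' : 0 < √3 := by linarith
  have hinv : (√3)⁻¹ ≤ 1 := inv_le_one_of_one_le₀ h3
  have hpos : 0 < (√3)⁻¹ := by positivity
  fin_cases i
  · simp only [q, Prod.norm_def, Real.norm_eq_abs]
    simp [abs_of_pos h3']
    linarith
  · simp [q]
  · simp only [q, Prod.norm_def, Real.norm_eq_abs]
    simp [abs_of_pos h3', div_eq_mul_inv]
    linarith

theorem norm_term_le (i : Fin 3) (k : ℕ) :
    ‖(1 / 2 : ℝ) ^ (k + 1) • q i‖ ≤ (1 / 2 : ℝ) ^ k := by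
  rw [norm_smul, Real.norm_of_nonneg (by positivity), pow_succ]
  have := norm_q_le i
  have h : (0 : ℝ) < (1 / 2 : ℝ) ^ k := by positivity
  nlinarith

theorem summable_addr (s : ℕ → Fin 3) : Summable fun k => (1 / 2 : ℝ) ^ (k + 1) • q (s k) :=
  Summable.of_norm_bounded summable_geometric_two fun k => norm_term_le (s k) k

theorem continuous_addr : Continuous addr := by
  refine continuous_tsum (fun k => ?_) summable_geometric_two fun k s => norm_term_le (s k) k
  have h : Continuous fun i : Fin 3 => (1 / 2 : ℝ) ^ (k + 1) • q i := continuous_of_discreteTopology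
  exact h.comp (continuous_apply k)

theorem addr_succ (s : ℕ → Fin 3) : addr s = F (s 0) (addr fun k => s (k + 1)) := by
  unfold addr F
  rw [(summable_addr s).tsum_eq_zero_add, smul_add, ← tsum_const_smul'' (1 / 2 : ℝ), add_comm]
  congr 1
  · refine tsum_congr fun k => ?_
    rw [smul_smul, ← pow_succ']
  · simp

theorem SG_isAttractor : IsAttractor SG := by
  refine ⟨isCompact_range continuous_addr, range_nonempty _, ?_⟩
  ext p
  simp only [mem_iUnion, mem_image]
  constructor
  · rintro ⟨s, rfl⟩
    exact ⟨s 0, _, ⟨_, rfl⟩, (addr_succ s).symm⟩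
  · rintro ⟨i, _, ⟨s, rfl⟩, rfl⟩
    exact ⟨fun k => Nat.casesOn k i s, addr_succ _⟩

theorem F_sub (i : Fin 3) (x y : ℝ × ℝ) : F i x - F i y = (1 / 2 : ℝ) • (x - y) := by
  simp only [F, ← smul_sub, add_sub_add_right_eq_sub]

theorem attractor_subset {K L : Set (ℝ × ℝ)} (hK : IsAttractor K) (hL : IsAttractor L) :
    K ⊆ L := by
  obtain ⟨C, hC⟩ := hK.1.isBounded.exists_norm_le
  obtain ⟨D, hD⟩ := hL.1.isBounded.exists_norm_le
  have key : ∀ n : ℕ, ∀ x ∈ K, ∃ y ∈ L, ‖x - y‖ ≤ (C + D) * (1 / 2 : ℝ) ^ n := by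
    intro n
    induction n with
    | zero =>
      intro x hx
      obtain ⟨y, hy⟩ := hL.2.1
      refine ⟨y, hy, ?_⟩
      have := norm_sub_le x y
      have := hC x hx
      have := hD y hy
      simp
      linarith
    | succ n ih =>
      intro x hx
      rw [hK.2.2] at hx
      simp only [mem_iUnion, mem_image] at hx
      obtain ⟨i, x', hx', rfl⟩ := hx
      obtain ⟨y, hy, hxy⟩ := ih x' hx'
      refine ⟨F i y, ?_, ?_⟩
      · rw [hL.2.2]
        exact mem_iUnion.2 ⟨i, y, hy, rfl⟩
      · rw [F_sub, norm_smul, Real.norm_of_nonneg (by norm_num), pow_succ]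
        linarith
  intro x hx
  rw [← hL.1.isClosed.closure_eq]
  refine Metric.mem_closure_iff.2 fun ε hε => ?_
  have hlim : Tendsto (fun n : ℕ => (C + D) * (1 / 2 : ℝ) ^ n) atTop (𝓝 ((C + D) * 0)) :=
    (tendsto_pow_atTop_nhds_zero_of_lt_one (by norm_num) (by norm_num)).const_mul _
  rw [mul_zero] at hlim
  obtain ⟨n, hn⟩ := (hlim.eventually (gt_mem_nhds hε)).exists
  obtain ⟨y, hy, hxy⟩ := key n x hx
  exact ⟨y, hy, by rw [dist_eq_norm]; linarith⟩

theorem SG_unique {K : Set (ℝ × ℝ)} (hK : IsAttractor K) : K = SG :=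
  (attractor_subset hK SG_isAttractor).antisymm (attractor_subset SG_isAttractor hK)

/-- The vertex sets: `V₀ = {q₀, q₁, q₂}` and `V_{m+1} = ⋃ F_i V_m`. -/
def V : ℕ → Set (ℝ × ℝ)
  | 0 => range q
  | m + 1 => ⋃ i, F i '' V m

/-! ## The lower domain and its boundary -/

/-- The lower domain `Ω_λ⁻`. -/
def lowerDomain (lam : ℝ) : Set (ℝ × ℝ) := {p | p ∈ SG \ V 0 ∧ p.2 < 1 - lam}

/-- `λ` is a multiple of `2^{-d}`. -/
def IsMultiple (lam : ℝ) (d : ℕ) : Prop := ∃ k : ℤ, lam = k / 2 ^ d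

/-- `d(λ)`, the smallest `d` such that `λ` is a multiple of `2^{-d}`
(used for dyadic rationals only). -/
def dyadicOrder (lam : ℝ) : ℕ := sInf {d | IsMultiple lam d}

open Classical in
/-- The boundary part `X = X_λ⁻` along the cut: the points of the gasket at height `1 - λ`,
restricted to `V_{d(λ)}` if `λ` is a dyadic rational. -/
def cutSet (lam : ℝ) : Set (ℝ × ℝ) :=
  if ∃ d, IsMultiple lam d then V (dyadicOrder lam) ∩ {p | p ∈ SG ∧ p.2 = 1 - lam}
  else {p | p ∈ SG ∧ p.2 = 1 - lam}

/-- `∂Ω_λ⁻ = X ∪ {q₁, q₂}`. -/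
def domainBoundary (lam : ℝ) : Set (ℝ × ℝ) := cutSet lam ∪ {q 1, q 2}

/-- `Ω̄_λ⁻`. -/
def closedDomain (lam : ℝ) : Set (ℝ × ℝ) := lowerDomain lam ∪ domainBoundary lam

/-- The cell `F_w SG` is contained in `Ω_λ⁻`, up to the vertices `q₁, q₂`. -/
def CellInside (lam : ℝ) (w : List (Fin 3)) : Prop :=
  cellMap w '' SG ⊆ lowerDomain lam ∪ {q 1, q 2}

/-! ## Harmonic functions and the Dirichlet problem -/

open Classical in
/-- The graph Laplacian `∑_{y ∼_m x} (u x - u y)`, written as a sum over the `m`-cells having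
`x = F_w q_i` as a vertex, and over the vertices `F_w q_j` of such a cell
(two distinct `m`-cells share at most one point, so that every neighbour is counted once). -/
def graphLaplacian (m : ℕ) (u : ℝ × ℝ → ℝ) (x : ℝ × ℝ) : ℝ :=
  ∑ w : Fin m → Fin 3, ∑ i : Fin 3,
    if cellMap (List.ofFn w) (q i) = x then ∑ j : Fin 3, (u x - u (cellMap (List.ofFn w) (q j)))
    else 0

/-- `Δu = 0` in `Ω_λ⁻`: the mean value property holds at each vertex of `Ω_λ⁻` and each level `m`
such that the `m`-cells around this vertex are contained in the domain. -/
def IsHarmonicIn (lam : ℝ) (u : ℝ × ℝ → ℝ) : Prop :=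
  ∀ (m : ℕ), ∀ x ∈ V m ∩ lowerDomain lam,
    (∀ w : Fin m → Fin 3, x ∈ cellMap (List.ofFn w) '' SG → CellInside lam (List.ofFn w)) →
      graphLaplacian m u x = 0

/-- `u` solves the Dirichlet problem on `Ω_λ⁻` with boundary values `f`. -/
def IsDirichletSolution (lam : ℝ) (f u : ℝ × ℝ → ℝ) : Prop :=
  ContinuousOn u (closedDomain lam) ∧ IsHarmonicIn lam u ∧ EqOn u f (domainBoundary lam)

/-! ## Normal derivatives and energy -/

/-- The difference quotients at `q_i` (with cyclic indices). -/
def normalQuotient (u : ℝ × ℝ → ℝ) (i : Fin 3) (m : ℕ) : ℝ :=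
  (5 / 3 : ℝ) ^ m * (2 * u (q i) - u ((F i)^[m] (q (i + 1))) - u ((F i)^[m] (q (i - 1))))

/-- `∂_n u(q_i)` exists and equals `d`. -/
def HasNormalDeriv (u : ℝ × ℝ → ℝ) (i : Fin 3) (d : ℝ) : Prop :=
  Tendsto (normalQuotient u i) atTop (𝓝 d)

/-- `∂_n u(q_i)`, the limit of the difference quotients. -/
def normalDeriv (u : ℝ × ℝ → ℝ) (i : Fin 3) : ℝ := limUnder atTop (normalQuotient u i)

open Classical in
/-- The level `m` energy form of `Ω_λ⁻`: the renormalized sum over the edges of the `m`-cells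
contained in the domain, each edge counted once. -/
def domainEnergy (lam : ℝ) (m : ℕ) (u v : ℝ × ℝ → ℝ) : ℝ :=
  (5 / 3 : ℝ) ^ m * ∑ w : Fin m → Fin 3,
    if CellInside lam (List.ofFn w) then
      ∑ i : Fin 3, ∑ j : Fin 3, if i < j then
        (u (cellMap (List.ofFn w) (q i)) - u (cellMap (List.ofFn w) (q j))) *
          (v (cellMap (List.ofFn w) (q i)) - v (cellMap (List.ofFn w) (q j)))
      else 0
    else 0

/-- `𝓔_Ω(u, v)` exists and equals `E`. -/
def HasEnergy (lam : ℝ) (u v : ℝ × ℝ → ℝ) (E : ℝ) : Prop :=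
  Tendsto (fun m => domainEnergy lam m u v) atTop (𝓝 E)

/-- `𝓔_Ω(u) < ∞`. The energies `domainEnergy lam m u u` increase with `m`. -/
def HasFiniteEnergy (lam : ℝ) (u : ℝ × ℝ → ℝ) : Prop := ∃ E, HasEnergy lam u u E

/-! ## The coefficients `η` and the matrices `M` -/

open Classical in
/-- Boundary data equal to `1` at `q_i` and `0` elsewhere. -/
def vertexData (i : Fin 3) (p : ℝ × ℝ) : ℝ := if p = q i then 1 else 0

/-- `h_i^λ`, the solution of the Dirichlet problem with value `1` at `q_i` (`i = 1, 2`), `0` at the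
other bottom vertex and `0` on `X`. -/
def basicHarmonic (lam : ℝ) (i : Fin 3) : ℝ × ℝ → ℝ :=
  Classical.epsilon fun h => IsDirichletSolution lam (vertexData i) h

/-- `η₁(λ) = ∂_n h₁(q₁)`. -/
def eta1 (lam : ℝ) : ℝ := normalDeriv (basicHarmonic lam 1) 1

/-- `η₂(λ) = -∂_n h₁(q₂)`. -/
def eta2 (lam : ℝ) : ℝ := -normalDeriv (basicHarmonic lam 1) 2

/-- The binary digit `e_{k+1}(λ)`, in the expansion without a tail of ones. -/
def binDigit (lam : ℝ) (k : ℕ) : Fin 2 := Real.digits lam 2 k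

/-- `Sλ`, obtained from `λ` by dropping the first binary digit. -/
def shift (lam : ℝ) : ℝ := Real.ofDigits fun k => binDigit lam (k + 1)

/-- The matrices `M_0^λ, M_1^λ, M_2^λ`, with `a = η₁(Sλ)` and `b = η₂(Sλ)`. -/
def letterMatrix (lam : ℝ) (i : Fin 3) : Matrix (Fin 2) (Fin 2) ℝ :=
  let a := eta1 (shift lam)
  let b := eta2 (shift lam)
  ![!![(3 + 3 * a + 3 * b) / (6 + 4 * a + 4 * b), (3 + a + b) / (6 + 4 * a + 4 * b);
       (3 + a + b) / (6 + 4 * a + 4 * b), (3 + 3 * a + 3 * b) / (6 + 4 * a + 4 * b)],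
    !![1, 0; -(b / (2 * a)), b / (2 * a)],
    !![b / (2 * a), -(b / (2 * a)); 0, 1]] i

/-- `M_w^λ = M_{w_m}^{S^{m-1}λ} ⋯ M_{w_2}^{Sλ} M_{w_1}^λ`. -/
def wordMatrix : ℝ → List (Fin 3) → Matrix (Fin 2) (Fin 2) ℝ
  | _, [] => 1
  | lam, i :: w => wordMatrix (shift lam) w * letterMatrix lam i

/-- Membership in `W̃_m^λ`: `w_k = 0` if `e_k(λ) = 0`, and `w_k ∈ {1, 2}` if `e_k(λ) = 1`. -/
def IsCutWord (lam : ℝ) {m : ℕ} (w : Fin m → Fin 3) : Prop :=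
  ∀ k : Fin m, (binDigit lam k = 0 → w k = 0) ∧ (binDigit lam k = 1 → w k = 1 ∨ w k = 2)

/-- `X_w = F_w SG ∩ X`. -/
def cutPiece (lam : ℝ) (w : List (Fin 3)) : Set (ℝ × ℝ) := cellMap w '' SG ∩ cutSet lam

open Matrix in
/-- `μ` is a Borel probability measure on `X` such that
`μ(X_w) = (η₁(λ) - η₂(λ))⁻¹ (1, 1) M_w^λ v` for all `w ∈ W̃_*^λ`. -/
def IsCutMeasure (lam : ℝ) (v : Fin 2 → ℝ) (μ : Measure (ℝ × ℝ)) : Prop :=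
  IsProbabilityMeasure μ ∧ μ (cutSet lam)ᶜ = 0 ∧
    ∀ (m : ℕ) (w : Fin m → Fin 3), IsCutWord lam w →
      μ.real (cutPiece lam (List.ofFn w)) =
        1 / (eta1 lam - eta2 lam) * (![1, 1] ⬝ᵥ (wordMatrix lam (List.ofFn w) *ᵥ v))

/-- The measure `μ₁^λ`. -/
def mu1 (lam : ℝ) : Measure (ℝ × ℝ) :=
  Classical.epsilon fun μ => IsCutMeasure lam ![eta1 lam, -eta2 lam] μ

/-- The measure `μ₂^λ`. -/
def mu2 (lam : ℝ) : Measure (ℝ × ℝ) :=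
  Classical.epsilon fun μ => IsCutMeasure lam ![-eta2 lam, eta1 lam] μ

end LowerSG

end

open LowerSG

/-! # Normal derivatives and energies on the lower domains of the Sierpinski gasket

*Self-similarity.* The cells of level one that meet the cut at `λ` carry a copy of the cut at `Sλ`, and
every other cell of level one is inside the domain or above the cut. Statements about `λ` are therefore
reduced to `Sλ`: a function on the gasket is harmonic in the domain if and only if its pieces are
harmonic and their normal derivatives cancel at the points where the cells meet. Near `q₁` and `q₂` a
function that is harmonic in the domain is harmonic on whole cells, where the difference quotients
that define the normal derivative are constant. So normal derivatives exist without any further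
assumption, and uniqueness follows from the maximum principle.

*Null solutions.* The solutions that vanish on the cut are constructed by this recursion for dyadic
`λ`, starting from `λ = 0`, together with the inequalities `0 ≤ η₂`, `1 ≤ η₁ - η₂` and
`η₁ + η₂ ≤ 3 (η₁ - η₂)` (`exists_hasSmallNullSolutions`). These solutions are of size `(3/5)^n` on the
cells of level `n` at the cut, so that for general `λ` the solutions for the truncated binary
expansions converge uniformly, by the maximum principle (`exists_hasNullSolutions`).

*The measures.* For a harmonic function the flux `∂ₙu(q₁) + ∂ₙu(q₂)` is the sum of the suitably
scaled fluxes of its pieces in the cells of level `m` that meet the cut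
(`IsHarmonicIn.cutSum_flux`). For a nonnegative null solution `h` the terms are nonnegative, hence
they are the masses of the pieces of the cut under a measure, which is unique because cells of high
level are small, and exists because probability measures on the compact cut have weak limits and the
pieces of the cut are clopen. The matrices `M_w` express the normal derivatives of the pieces of `h`,
and `μ₁`, `μ₂` are the measures for `h = h₁, h₂` (`isCutMeasure_iff`).

*Green's formula.* On the `m`-cells inside the domain, the energy of `v` and a harmonic `u` is
`v(q₁) ∂ₙu(q₁) + v(q₂) ∂ₙu(q₂)` minus boundary terms at the lower vertices of the cells meeting the
cut (`IsHarmonicIn.domainEnergy_eq`). For `v = h` the boundary terms vanish in the limit: `u` is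
almost constant on the part of the domain in such a cell, so its normal derivatives there are small,
and the inequalities for `η₁, η₂` bound the values of `h` at the lower vertices by the flux of its
piece (`IsNonnegNullSolution.tendsto_cutSum_bottomPairing`). With `h` and `u` interchanged, the
boundary terms are up to a small error the values of `u` times the fluxes of `h`, that is, Riemann
sums for the integral of `u` over the cut (`IsFluxMeasure.tendsto_cutSum_bottomPairing`). The first
limit gives the energies, also when the energy of `u` is infinite, and the comparison of both limits
gives the formula for the normal derivatives (`IsFluxMeasure.bottomPairing_eq`). -/

namespace LowerSG

/-! ### Barycentric coordinates and the cell structure -/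

/-- The barycentric coordinates of a point of the plane with respect to `q₀, q₁, q₂`. The coordinate
of index `0` is the height. -/
noncomputable def bary (i : Fin 3) (p : ℝ × ℝ) : ℝ :=
  ![p.2, 1 - p.2 - (√3 * p.1 - p.2) / 2, (√3 * p.1 - p.2) / 2] i

@[simp] theorem bary_zero (p : ℝ × ℝ) : bary 0 p = p.2 := rfl

theorem bary_q (i j : Fin 3) : bary i (q j) = if i = j then 1 else 0 := by
  have h : √3 ≠ 0 := by positivity
  have h2 : √3 * (2 / √3) = 2 := by field_simp
  fin_cases i <;> fin_cases j <;> simp [bary, q, h, h2]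

theorem bary_F (i j : Fin 3) (p : ℝ × ℝ) :
    bary i (F j p) = (bary i p + if i = j then 1 else 0) / 2 := by
  rw [← bary_q]
  fin_cases i <;> simp [bary, F] <;> ring

theorem bary_sum (p : ℝ × ℝ) : bary 0 p + bary 1 p + bary 2 p = 1 := by
  simp only [bary, Matrix.cons_val]
  ring

theorem bary_ext {p p' : ℝ × ℝ} (h : ∀ i, bary i p = bary i p') : p = p' := by
  have h0 := h 0
  have h2 := h 2
  have h3 : √3 ≠ 0 := by positivity
  simp only [bary_zero] at h0
  simp only [bary, Matrix.cons_val] at h2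
  refine Prod.ext (mul_left_cancel₀ h3 ?_) h0
  linarith

theorem continuous_bary (i : Fin 3) : Continuous (bary i) := by
  fin_cases i
  · exact continuous_snd
  · change Continuous fun p : ℝ × ℝ => 1 - p.2 - (√3 * p.1 - p.2) / 2
    fun_prop
  · change Continuous fun p : ℝ × ℝ => (√3 * p.1 - p.2) / 2
    fun_prop

theorem isCompact_SG : IsCompact SG := SG_isAttractor.1

theorem F_mem {p : ℝ × ℝ} (hp : p ∈ SG) (i : Fin 3) : F i p ∈ SG := by
  rw [SG_isAttractor.2.2]
  exact mem_iUnion.2 ⟨i, p, hp, rfl⟩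

theorem exists_F_eq {p : ℝ × ℝ} (hp : p ∈ SG) : ∃ i, ∃ p' ∈ SG, F i p' = p := by
  rw [SG_isAttractor.2.2] at hp
  simpa using hp

theorem bary_nonneg (i : Fin 3) {p : ℝ × ℝ} (hp : p ∈ SG) : 0 ≤ bary i p := by
  -- a minimum over the gasket is at least half of itself
  obtain ⟨p₀, hp₀, hmin⟩ :=
    isCompact_SG.exists_isMinOn SG_isAttractor.2.1 (continuous_bary i).continuousOn
  obtain ⟨j, p', hp', rfl⟩ := exists_F_eq hp₀
  have h1 : bary i (F j p') ≤ bary i p' := hmin hp'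
  have h2 : bary i (F j p') ≤ bary i p := hmin hp
  rw [bary_F] at h1 h2
  split_ifs at h1 h2 <;> linarith

theorem bary_le_one (i : Fin 3) {p : ℝ × ℝ} (hp : p ∈ SG) : bary i p ≤ 1 := by
  have h0 := bary_nonneg 0 hp
  have h1 := bary_nonneg 1 hp
  have h2 := bary_nonneg 2 hp
  have := bary_sum p
  fin_cases i <;> simp only [Fin.zero_eta, Fin.mk_one, Fin.reduceFinMk] <;> linarith

theorem eq_q_of_bary_eq_one {i : Fin 3} {p : ℝ × ℝ} (hp : p ∈ SG) (h : 1 ≤ bary i p) :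
    p = q i := by
  have h0 := bary_nonneg 0 hp
  have h1 := bary_nonneg 1 hp
  have h2 := bary_nonneg 2 hp
  have := bary_sum p
  refine bary_ext fun j => ?_
  rw [bary_q]
  fin_cases i <;> fin_cases j <;>
    simp only [Fin.zero_eta, Fin.mk_one, Fin.reduceFinMk, Fin.isValue, Fin.reduceEq, if_true,
      if_false] at * <;> linarith

theorem q_injective : Function.Injective q := by
  intro i j h
  have := bary_q i j
  rw [← h, bary_q] at this
  by_contra hne
  simp [hne] at this

theorem F_injective (i : Fin 3) : Function.Injective (F i) := by
  intro p p' h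
  have := F_sub i p p'
  rw [h, sub_self, eq_comm, smul_eq_zero] at this
  exact sub_eq_zero.1 (this.resolve_left (by norm_num))

theorem continuous_F (i : Fin 3) : Continuous (F i) := by
  unfold F
  fun_prop

theorem F_q_self (i : Fin 3) : F i (q i) = q i := by
  simp only [F, ← two_smul ℝ, smul_smul]
  norm_num

theorem F_q_comm (i j : Fin 3) : F i (q j) = F j (q i) := by
  simp only [F, add_comm]

theorem q_mem (i : Fin 3) : q i ∈ SG := by
  -- the vertex is the limit of the images of any point of the gasket
  obtain ⟨p, hp⟩ := SG_isAttractor.2.1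
  have hm : ∀ m, (F i)^[m] p ∈ SG := fun m => by
    induction m with
    | zero => exact hp
    | succ m ih => rw [Function.iterate_succ_apply']; exact F_mem ih i
  have hs : ∀ m, (F i)^[m] p - q i = (1 / 2 : ℝ) ^ m • (p - q i) := fun m => by
    induction m with
    | zero => simp
    | succ m ih =>
      rw [Function.iterate_succ_apply', pow_succ', mul_smul, ← ih, ← F_sub, F_q_self]
  refine isCompact_SG.isClosed.mem_of_tendsto (b := atTop) (f := fun m => (F i)^[m] p) ?_
    (Eventually.of_forall hm)
  rw [← tendsto_sub_nhds_zero_iff]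
  simp only [hs]
  have := (tendsto_pow_atTop_nhds_zero_of_lt_one (r := (1 / 2 : ℝ)) (by norm_num)
    (by norm_num)).smul_const (p - q i)
  simpa using this

/-- Two cells of level one meet in a single point only. -/
theorem eq_of_F_eq {i j : Fin 3} (hij : i ≠ j) {p p' : ℝ × ℝ} (hp : p ∈ SG) (hp' : p' ∈ SG)
    (h : F i p = F j p') : p = q j ∧ p' = q i := by
  have h1 := congrArg (bary i) h
  have h2 := congrArg (bary j) h
  rw [bary_F, bary_F] at h1 h2
  simp only [if_true, hij, hij.symm, if_false] at h1 h2
  have := bary_nonneg i hp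
  have := bary_nonneg j hp'
  exact ⟨eq_q_of_bary_eq_one hp (by linarith), eq_q_of_bary_eq_one hp' (by linarith)⟩

theorem F_eq_q {i j : Fin 3} {p : ℝ × ℝ} (hp : p ∈ SG) (h : F i p = q j) : i = j ∧ p = q j := by
  have h1 := congrArg (bary j) h
  rw [bary_F, bary_q] at h1
  have := bary_le_one j hp
  by_cases hij : j = i
  · subst hij
    simp only [if_true] at h1
    exact ⟨rfl, eq_q_of_bary_eq_one hp (by linarith)⟩
  · simp only [hij, if_false, if_true] at h1
    linarith

theorem mem_V_succ {m : ℕ} {p : ℝ × ℝ} : p ∈ V (m + 1) ↔ ∃ i, ∃ p' ∈ V m, F i p' = p := by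
  simp [V]

theorem V_subset_SG (m : ℕ) : V m ⊆ SG := by
  induction m with
  | zero => rintro _ ⟨i, rfl⟩; exact q_mem i
  | succ m ih =>
    intro p hp
    obtain ⟨i, p', hp', rfl⟩ := mem_V_succ.1 hp
    exact F_mem (ih hp') i

theorem V_subset_succ (m : ℕ) : V m ⊆ V (m + 1) := by
  induction m with
  | zero =>
    rintro _ ⟨i, rfl⟩
    exact mem_V_succ.2 ⟨i, q i, ⟨i, rfl⟩, F_q_self i⟩
  | succ m ih =>
    intro p hp
    obtain ⟨i, p', hp', rfl⟩ := mem_V_succ.1 hp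
    exact mem_V_succ.2 ⟨i, p', ih hp', rfl⟩

theorem F_mem_V_zero {i : Fin 3} {p : ℝ × ℝ} (hp : p ∈ SG) (h : F i p ∈ V 0) : p = q i := by
  obtain ⟨j, hj⟩ := h
  obtain ⟨rfl, rfl⟩ := F_eq_q hp hj.symm
  rfl

@[simp] theorem cellMap_nil (p : ℝ × ℝ) : cellMap [] p = p := rfl

@[simp] theorem cellMap_cons (i : Fin 3) (w : List (Fin 3)) (p : ℝ × ℝ) :
    cellMap (i :: w) p = F i (cellMap w p) := rfl

theorem cellMap_mem {p : ℝ × ℝ} (hp : p ∈ SG) (w : List (Fin 3)) : cellMap w p ∈ SG := by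
  induction w with
  | nil => exact hp
  | cons i w ih => exact F_mem ih i

theorem cellMap_image_cons (i : Fin 3) (w : List (Fin 3)) (s : Set (ℝ × ℝ)) :
    cellMap (i :: w) '' s = F i '' (cellMap w '' s) := by
  rw [image_image]; rfl

theorem continuous_cellMap (w : List (Fin 3)) : Continuous (cellMap w) := by
  induction w with
  | nil => exact continuous_id
  | cons i w ih => exact (continuous_F i).comp ih

theorem cellMap_sub (w : List (Fin 3)) (p p' : ℝ × ℝ) :
    cellMap w p - cellMap w p' = (1 / 2 : ℝ) ^ w.length • (p - p') := by
  induction w with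
  | nil => simp
  | cons i w ih => rw [cellMap_cons, cellMap_cons, F_sub, ih, smul_smul, List.length_cons, pow_succ']

/-- Cells of high level are small, uniformly. -/
theorem exists_dist_cellMap_lt {δ : ℝ} (hδ : 0 < δ) : ∃ M : ℕ, ∀ w : List (Fin 3), M ≤ w.length →
    ∀ p ∈ SG, ∀ p' ∈ SG, dist (cellMap w p) (cellMap w p') < δ := by
  obtain ⟨C, hC⟩ := isCompact_SG.isBounded.exists_norm_le
  have hlim : Tendsto (fun n : ℕ => (1 / 2 : ℝ) ^ n * (C + C)) atTop (𝓝 (0 * (C + C))) :=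
    (tendsto_pow_atTop_nhds_zero_of_lt_one (by norm_num) (by norm_num)).mul_const _
  rw [zero_mul] at hlim
  obtain ⟨M, hM⟩ := eventually_atTop.1 (hlim.eventually (gt_mem_nhds hδ))
  refine ⟨M, fun w hw p hp p' hp' => ?_⟩
  rw [dist_eq_norm, cellMap_sub, norm_smul, Real.norm_of_nonneg (by positivity)]
  refine lt_of_le_of_lt ?_ (hM _ hw)
  gcongr
  exact (norm_sub_le _ _).trans (add_le_add (hC p hp) (hC p' hp'))

theorem exists_cellMap_eq (m : ℕ) {p : ℝ × ℝ} (hp : p ∈ SG) :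
    ∃ w : List (Fin 3), w.length = m ∧ ∃ p' ∈ SG, cellMap w p' = p := by
  induction m generalizing p with
  | zero => exact ⟨[], rfl, p, hp, rfl⟩
  | succ m ih =>
    obtain ⟨i, p', hp', rfl⟩ := exists_F_eq hp
    obtain ⟨w, hw, p'', hp'', rfl⟩ := ih hp'
    exact ⟨i :: w, by simp [hw], p'', hp'', rfl⟩

theorem mem_V_iff {m : ℕ} {p : ℝ × ℝ} :
    p ∈ V m ↔ ∃ w : List (Fin 3), w.length = m ∧ ∃ i, cellMap w (q i) = p := by
  induction m generalizing p with
  | zero =>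
    constructor
    · rintro ⟨i, rfl⟩
      exact ⟨[], rfl, i, rfl⟩
    · rintro ⟨w, hw, i, rfl⟩
      rw [List.length_eq_zero_iff.1 hw]
      exact ⟨i, rfl⟩
  | succ m ih =>
    rw [mem_V_succ]
    constructor
    · rintro ⟨j, p', hp', rfl⟩
      obtain ⟨w, hw, i, rfl⟩ := ih.1 hp'
      exact ⟨j :: w, by simp [hw], i, rfl⟩
    · rintro ⟨w, hw, i, rfl⟩
      cases w with
      | nil => simp at hw
      | cons j w => exact ⟨j, _, ih.2 ⟨w, by simpa using hw, i, rfl⟩, rfl⟩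

theorem cellMap_snd (w : List (Fin 3)) (p : ℝ × ℝ) :
    (cellMap w p).2 = (cellMap w (q 0)).2 - (1 / 2) ^ w.length * (1 - p.2) := by
  have h := congrArg Prod.snd (cellMap_sub w (q 0) p)
  have h0 : (q 0).2 = 1 := by simp [q]
  simp only [Prod.snd_sub, Prod.smul_snd, smul_eq_mul, h0] at h
  linarith

theorem snd_nonneg {p : ℝ × ℝ} (hp : p ∈ SG) : 0 ≤ p.2 := bary_nonneg 0 hp

theorem snd_le_one {p : ℝ × ℝ} (hp : p ∈ SG) : p.2 ≤ 1 := bary_le_one 0 hp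

theorem F_snd (i : Fin 3) (p : ℝ × ℝ) : (F i p).2 = (p.2 + if i = 0 then 1 else 0) / 2 := by
  simpa [eq_comm] using bary_F 0 i p

theorem q_snd (i : Fin 3) : (q i).2 = if i = 0 then 1 else 0 := by
  simpa [eq_comm] using bary_q 0 i

/-- Every vertex of level `m` other than the top vertex `q₀` is a lower vertex of an `m`-cell. -/
theorem exists_lower_vertex {w : List (Fin 3)} {i : Fin 3} (h : cellMap w (q i) ≠ q 0) :
    ∃ w' : List (Fin 3), w'.length = w.length ∧ ∃ j ≠ 0, cellMap w' (q j) = cellMap w (q i) := by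
  induction w with
  | nil =>
    refine ⟨[], rfl, i, ?_, rfl⟩
    rintro rfl
    exact h rfl
  | cons k w ih =>
    by_cases hw : cellMap w (q i) = q 0
    · have hk : k ≠ 0 := by
        rintro rfl
        exact h (by rw [cellMap_cons, hw, F_q_self])
      have hrep : ∀ n, cellMap (List.replicate n k) (q k) = q k := fun n => by
        induction n with
        | zero => rfl
        | succ n ihn => rw [List.replicate_succ, cellMap_cons, ihn, F_q_self]
      refine ⟨0 :: List.replicate w.length k, by simp, k, hk, ?_⟩
      rw [cellMap_cons, cellMap_cons, hrep, hw, F_q_comm]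
    · obtain ⟨w', hw', j, hj, h'⟩ := ih hw
      exact ⟨k :: w', by simp [hw'], j, hj, by rw [cellMap_cons, cellMap_cons, h']⟩

/-! ### Self-similarity of the lower domains -/

theorem binDigit_zero_of_lt {lam : ℝ} (h : lam < 1 / 2) : binDigit lam 0 = 0 := by
  have : ⌊lam * 2⌋₊ = 0 := Nat.floor_eq_zero.2 (by linarith)
  simp [binDigit, Real.digits, this]

theorem binDigit_zero_of_ge {lam : ℝ} (h1 : lam < 1) (h : 1 / 2 ≤ lam) : binDigit lam 0 = 1 := by
  have : ⌊lam * 2⌋₊ = 1 := (Nat.floor_eq_iff (by linarith)).2 ⟨by norm_num; linarith, by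
    norm_num; linarith⟩
  simp [binDigit, Real.digits, this]

theorem shift_eq {lam : ℝ} (h0 : 0 ≤ lam) (h1 : lam < 1) :
    shift lam = 2 * lam - (binDigit lam 0 : ℕ) := by
  have h := Real.ofDigits_eq_sum_add_ofDigits (binDigit lam) 1
  have h' : Real.ofDigits (binDigit lam) = lam := Real.ofDigits_digits (by norm_num) ⟨h0, h1⟩
  rw [h'] at h
  simp only [Finset.sum_range_one, Real.ofDigitsTerm] at h
  change lam = _ + _ * shift lam at h
  norm_num at h
  linarith

theorem shift_of_lt {lam : ℝ} (h0 : 0 ≤ lam) (h : lam < 1 / 2) : shift lam = 2 * lam := by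
  rw [shift_eq h0 (by linarith), binDigit_zero_of_lt h]
  simp

theorem shift_of_ge {lam : ℝ} (h1 : lam < 1) (h : 1 / 2 ≤ lam) : shift lam = 2 * lam - 1 := by
  rw [shift_eq (by linarith) h1, binDigit_zero_of_ge h1 h]
  simp

theorem shift_nonneg {lam : ℝ} (h0 : 0 ≤ lam) (h1 : lam < 1) : 0 ≤ shift lam := by
  rcases lt_or_ge lam (1 / 2) with h | h
  · rw [shift_of_lt h0 h]; linarith
  · rw [shift_of_ge h1 h]; linarith

theorem shift_lt_one {lam : ℝ} (h0 : 0 ≤ lam) (h1 : lam < 1) : shift lam < 1 := by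
  rcases lt_or_ge lam (1 / 2) with h | h
  · rw [shift_of_lt h0 h]; linarith
  · rw [shift_of_ge h1 h]; linarith

theorem binDigit_shift {lam : ℝ} (h0 : 0 ≤ lam) (h1 : lam < 1) (k : ℕ) :
    binDigit (shift lam) k = binDigit lam (k + 1) := by
  rcases lt_or_ge lam (1 / 2) with h | h
  · rw [shift_of_lt h0 h]
    simp only [binDigit, Real.digits]
    congr 2
    push_cast
    ring
  · rw [shift_of_ge h1 h]
    simp only [binDigit, Real.digits]
    have h2 : (2 * lam - 1) * ((2 : ℕ) : ℝ) ^ (k + 1)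
        = lam * ((2 : ℕ) : ℝ) ^ (k + 1 + 1) - ((2 ^ (k + 1) : ℕ) : ℝ) := by
      push_cast
      ring
    have h3 : 2 ^ (k + 1) ≤ ⌊lam * ((2 : ℕ) : ℝ) ^ (k + 1 + 1)⌋₊ := by
      refine Nat.le_floor ?_
      push_cast
      rw [pow_succ _ (k + 1)]
      have : (0 : ℝ) < 2 ^ (k + 1) := by positivity
      nlinarith
    rw [h2, Nat.floor_sub_natCast]
    obtain ⟨c, hc⟩ := Nat.exists_eq_add_of_le h3
    ext
    simp only [hc, Fin.val_ofNat]
    rw [Nat.add_sub_cancel_left, pow_succ, Nat.mul_add_mod_self_right]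

/-- The letters allowed in the first place of a word describing the cut. The cells `F_j SG` of these
letters contain the cut; for `λ = 1/2` the top cell, which touches the cut from above at its two lower
corners, is not among them. -/
def IsLetter (lam : ℝ) (j : Fin 3) : Prop :=
  (binDigit lam 0 = 0 → j = 0) ∧ (binDigit lam 0 = 1 → j = 1 ∨ j = 2)

theorem isLetter_of_lt {lam : ℝ} (h : lam < 1 / 2) {j : Fin 3} :
    IsLetter lam j ↔ j = 0 := by
  simp [IsLetter, binDigit_zero_of_lt h]

theorem isLetter_of_ge {lam : ℝ} (h1 : lam < 1) (h : 1 / 2 ≤ lam) {j : Fin 3} :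
    IsLetter lam j ↔ j ≠ 0 := by
  simp only [IsLetter, binDigit_zero_of_ge h1 h]
  fin_cases j <;> simp

/-- The points of the gasket below the cut, including the bottom vertices. -/
def openPart (lam : ℝ) : Set (ℝ × ℝ) := {p | p ∈ SG ∧ p.2 < 1 - lam}

theorem lowerDomain_union {lam : ℝ} (h0 : 0 ≤ lam) (h1 : lam < 1) :
    lowerDomain lam ∪ {q 1, q 2} = openPart lam := by
  ext p
  constructor
  · rintro (⟨⟨hp, -⟩, h⟩ | rfl | rfl)
    · exact ⟨hp, h⟩
    · exact ⟨q_mem 1, by rw [q_snd]; simpa using h1⟩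
    · exact ⟨q_mem 2, by rw [q_snd]; simpa using h1⟩
  · rintro ⟨hp, h⟩
    by_cases hV : p ∈ V 0
    · obtain ⟨i, rfl⟩ := hV
      right
      fin_cases i
      · rw [q_snd] at h
        simp at h
        linarith
      · simp
      · simp
    · exact Or.inl ⟨⟨hp, hV⟩, h⟩

theorem cellInside_iff {lam : ℝ} (h0 : 0 ≤ lam) (h1 : lam < 1) {w : List (Fin 3)} :
    CellInside lam w ↔ (cellMap w (q 0)).2 < 1 - lam := by
  rw [CellInside, lowerDomain_union h0 h1]
  constructor
  · intro h
    exact (h ⟨q 0, q_mem 0, rfl⟩).2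
  · rintro h _ ⟨p, hp, rfl⟩
    refine ⟨cellMap_mem hp w, lt_of_le_of_lt ?_ h⟩
    rw [cellMap_snd w p]
    have := snd_le_one hp
    have : (0 : ℝ) ≤ (1 / 2) ^ w.length * (1 - p.2) := mul_nonneg (by positivity) (by linarith)
    linarith

theorem F_snd_lt_iff {lam : ℝ} (h0 : 0 ≤ lam) (h1 : lam < 1) {j : Fin 3} (hj : IsLetter lam j)
    (p : ℝ × ℝ) : (F j p).2 < 1 - lam ↔ p.2 < 1 - shift lam := by
  rw [F_snd]
  rcases lt_or_ge lam (1 / 2) with h | h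
  · rw [if_pos ((isLetter_of_lt h).1 hj), shift_of_lt h0 h]
    constructor <;> intro <;> linarith
  · rw [if_neg ((isLetter_of_ge h1 h).1 hj), shift_of_ge h1 h]
    constructor <;> intro <;> linarith

theorem F_snd_eq_iff {lam : ℝ} (h0 : 0 ≤ lam) (h1 : lam < 1) {j : Fin 3} (hj : IsLetter lam j)
    (p : ℝ × ℝ) : (F j p).2 = 1 - lam ↔ p.2 = 1 - shift lam := by
  rw [F_snd]
  rcases lt_or_ge lam (1 / 2) with h | h
  · rw [if_pos ((isLetter_of_lt h).1 hj), shift_of_lt h0 h]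
    constructor <;> intro <;> linarith
  · rw [if_neg ((isLetter_of_ge h1 h).1 hj), shift_of_ge h1 h]
    constructor <;> intro <;> linarith

theorem F_mem_openPart_iff {lam : ℝ} (h0 : 0 ≤ lam) (h1 : lam < 1) {j : Fin 3}
    (hj : IsLetter lam j) {p : ℝ × ℝ} (hp : p ∈ SG) :
    F j p ∈ openPart lam ↔ p ∈ openPart (shift lam) := by
  simp only [openPart, mem_ofPred_eq, F_mem hp, hp, true_and, F_snd_lt_iff h0 h1 hj]

theorem F_mem_openPart {lam : ℝ} (h : lam < 1 / 2) {j : Fin 3} (hj : j ≠ 0) {p : ℝ × ℝ}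
    (hp : p ∈ SG) : F j p ∈ openPart lam := by
  refine ⟨F_mem hp j, ?_⟩
  rw [F_snd, if_neg hj]
  have := snd_le_one hp
  linarith

theorem cellInside_cons {lam : ℝ} (h0 : 0 ≤ lam) (h1 : lam < 1) {j : Fin 3} (hj : IsLetter lam j)
    (w : List (Fin 3)) : CellInside lam (j :: w) ↔ CellInside (shift lam) w := by
  rw [cellInside_iff h0 h1, cellInside_iff (shift_nonneg h0 h1) (shift_lt_one h0 h1), cellMap_cons,
    F_snd_lt_iff h0 h1 hj]

theorem cellInside_cons_of_lt {lam : ℝ} (h0 : 0 ≤ lam) (h : lam < 1 / 2) {j : Fin 3} (hj : j ≠ 0)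
    (w : List (Fin 3)) : CellInside lam (j :: w) :=
  (cellInside_iff h0 (by linarith)).2 (F_mem_openPart h hj (cellMap_mem (q_mem 0) w)).2

theorem not_cellInside_cons {lam : ℝ} (h1 : lam < 1) (h : 1 / 2 ≤ lam) (w : List (Fin 3)) :
    ¬ CellInside lam (0 :: w) := by
  rw [cellInside_iff (by linarith) h1, cellMap_cons, F_snd, if_pos rfl]
  have := snd_nonneg (cellMap_mem (q_mem 0) w)
  linarith

theorem isMultiple_shift {lam : ℝ} (h0 : 0 ≤ lam) (h1 : lam < 1) (d : ℕ) :
    IsMultiple (shift lam) d ↔ IsMultiple lam (d + 1) := by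
  rw [shift_eq h0 h1]
  have h2 : (2 : ℝ) ^ d ≠ 0 := by positivity
  set e : ℕ := (binDigit lam 0 : ℕ)
  constructor
  · rintro ⟨k, hk⟩
    refine ⟨k + e * 2 ^ d, ?_⟩
    have : lam = (k / 2 ^ d + e) / 2 := by linarith
    rw [this]
    push_cast
    field_simp
    ring
  · rintro ⟨k, hk⟩
    refine ⟨k - e * 2 ^ d, ?_⟩
    rw [hk]
    push_cast
    field_simp
    ring

theorem mem_cutSet_iff {lam : ℝ} {p : ℝ × ℝ} :
    p ∈ cutSet lam ↔ p ∈ SG ∧ p.2 = 1 - lam ∧ ∀ d, IsMultiple lam d → p ∈ V d := by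
  have hmono : Monotone V := monotone_nat_of_le_succ V_subset_succ
  unfold cutSet
  split_ifs with h
  · constructor
    · rintro ⟨hV, hp, hy⟩
      exact ⟨hp, hy, fun d hd => hmono (Nat.sInf_le hd) hV⟩
    · rintro ⟨hp, hy, hV⟩
      exact ⟨hV _ (Nat.sInf_mem h), hp, hy⟩
  · push Not at h
    exact ⟨fun ⟨hp, hy⟩ => ⟨hp, hy, fun d hd => (h d hd).elim⟩, fun hp => ⟨hp.1, hp.2.1⟩⟩

theorem cutSet_subset_SG (lam : ℝ) : cutSet lam ⊆ SG := fun _ hp => (mem_cutSet_iff.1 hp).1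

theorem mem_V_of_F_mem {j : Fin 3} {p : ℝ × ℝ} (hp : p ∈ SG) {d : ℕ} (h : F j p ∈ V (d + 1)) :
    p ∈ V d := by
  obtain ⟨i, p', hp', he⟩ := mem_V_succ.1 h
  by_cases hij : i = j
  · subst hij
    rwa [← F_injective i he]
  · obtain ⟨-, rfl⟩ := eq_of_F_eq hij (V_subset_SG d hp') hp he
    exact monotone_nat_of_le_succ V_subset_succ (Nat.zero_le d) ⟨i, rfl⟩

theorem eq_zero_of_isMultiple_zero {lam : ℝ} (h0 : 0 ≤ lam) (h1 : lam < 1)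
    (h : IsMultiple lam 0) : lam = 0 := by
  obtain ⟨k, rfl⟩ := h
  simp only [pow_zero, div_one] at *
  have h2 : 0 ≤ k := by exact_mod_cast h0
  have h3 : k < 1 := by exact_mod_cast h1
  have : k = 0 := by omega
  simp [this]

theorem q_zero_mem_cutSet : q 0 ∈ cutSet 0 :=
  mem_cutSet_iff.2 ⟨q_mem 0, by rw [q_snd]; norm_num, fun d _ =>
    monotone_nat_of_le_succ V_subset_succ (Nat.zero_le d) ⟨0, rfl⟩⟩

theorem F_mem_cutSet_iff {lam : ℝ} (h0 : 0 ≤ lam) (h1 : lam < 1) {j : Fin 3} (hj : IsLetter lam j)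
    {p : ℝ × ℝ} (hp : p ∈ SG) : F j p ∈ cutSet lam ↔ p ∈ cutSet (shift lam) := by
  rw [mem_cutSet_iff, mem_cutSet_iff, F_snd_eq_iff h0 h1 hj]
  simp only [F_mem hp, hp, true_and, and_congr_right_iff]
  intro hy
  constructor
  · intro h d hd
    exact mem_V_of_F_mem hp (h _ ((isMultiple_shift h0 h1 d).1 hd))
  · intro h d hd
    cases d with
    | succ d => exact mem_V_succ.2 ⟨j, p, h d ((isMultiple_shift h0 h1 d).2 hd), rfl⟩
    | zero =>
      obtain rfl := eq_zero_of_isMultiple_zero h0 h1 hd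
      rw [isLetter_of_lt (by norm_num)] at hj
      rw [shift_of_lt le_rfl (by norm_num)] at hy
      subst hj
      rw [eq_q_of_bary_eq_one (i := 0) hp (by simp [hy]), F_q_self]
      exact ⟨0, rfl⟩

/-- The cut at `λ` consists of the copies of the cut at `Sλ` in the cells of the allowed letters. -/
theorem exists_of_mem_cutSet {lam : ℝ} (h0 : 0 ≤ lam) (h1 : lam < 1) {p : ℝ × ℝ}
    (hp : p ∈ cutSet lam) : ∃ j, IsLetter lam j ∧ ∃ p' ∈ cutSet (shift lam), F j p' = p := by
  have hp' := mem_cutSet_iff.1 hp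
  obtain ⟨j, p', hpS, rfl⟩ := exists_F_eq hp'.1
  by_cases hj : IsLetter lam j
  · exact ⟨j, hj, p', (F_mem_cutSet_iff h0 h1 hj hpS).1 hp, rfl⟩
  have hy := hp'.2.1
  rw [F_snd] at hy
  have hy0 := snd_nonneg hpS
  have hy1 := snd_le_one hpS
  rcases lt_or_ge lam (1 / 2) with h | h
  · rw [isLetter_of_lt h] at hj
    rw [if_neg hj] at hy
    linarith
  · -- only the bottom of the top cell can be reached, and there only the two corners count
    rw [isLetter_of_ge h1 h, not_not] at hj
    subst hj
    simp only [if_true] at hy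
    have hlam : lam = 1 / 2 := by linarith
    have hs : shift lam = 0 := by rw [shift_of_ge h1 h, hlam]; norm_num
    have hV : p' ∈ V 0 := mem_V_of_F_mem hpS (hp'.2.2 1 ⟨1, by rw [hlam]; norm_num⟩)
    obtain ⟨l, rfl⟩ := hV
    refine ⟨l, (isLetter_of_ge h1 h).2 ?_, q 0, by rw [hs]; exact q_zero_mem_cutSet, F_q_comm _ _⟩
    rintro rfl
    rw [q_snd] at hy
    norm_num at hy
    linarith

theorem exists_snd_eq {y : ℝ} (hy0 : 0 ≤ y) (hy1 : y ≤ 1) : ∃ p ∈ SG, p.2 = y := by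
  obtain ⟨d, -, hd⟩ := Real.ofDigits_SurjOn (b := 2) (by norm_num) ⟨hy0, hy1⟩
  refine ⟨addr fun k => if d k = 1 then 0 else 1, ⟨_, rfl⟩, ?_⟩
  rw [← hd, addr, Real.ofDigits]
  change ContinuousLinearMap.snd ℝ ℝ ℝ _ = _
  rw [ContinuousLinearMap.map_tsum _ (summable_addr _)]
  refine tsum_congr fun k => ?_
  have hk : (q (if d k = 1 then 0 else 1)).2 = (d k : ℕ) := by
    generalize d k = e
    fin_cases e <;> simp [q_snd]
  simp only [ContinuousLinearMap.coe_snd', Prod.smul_snd, smul_eq_mul, hk, Real.ofDigitsTerm]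
  rw [mul_comm, one_div, inv_pow]
  norm_num

theorem cutSet_nonempty {lam : ℝ} (h0 : 0 ≤ lam) (h1 : lam < 1) : (cutSet lam).Nonempty := by
  by_cases hd : ∃ d, IsMultiple lam d
  · obtain ⟨d, hd⟩ := hd
    induction d generalizing lam with
    | zero =>
      rw [eq_zero_of_isMultiple_zero h0 h1 hd]
      exact ⟨_, q_zero_mem_cutSet⟩
    | succ d ih =>
      obtain ⟨p, hp⟩ := ih (shift_nonneg h0 h1) (shift_lt_one h0 h1) ((isMultiple_shift h0 h1 d).2 hd)
      have hj : ∃ j, IsLetter lam j := by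
        rcases lt_or_ge lam (1 / 2) with h | h
        · exact ⟨0, (isLetter_of_lt h).2 rfl⟩
        · exact ⟨1, (isLetter_of_ge h1 h).2 one_ne_zero⟩
      obtain ⟨j, hj⟩ := hj
      exact ⟨F j p, (F_mem_cutSet_iff h0 h1 hj (cutSet_subset_SG _ hp)).2 hp⟩
  · obtain ⟨p, hp, hy⟩ := exists_snd_eq (y := 1 - lam) (by linarith) (by linarith)
    exact ⟨p, mem_cutSet_iff.2 ⟨hp, hy, fun d h => (hd ⟨d, h⟩).elim⟩⟩

/-- A cell that reaches below the cut without being contained in the domain meets the cut. -/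
theorem exists_mem_cutSet_of_not_inside {lam : ℝ} (h0 : 0 ≤ lam) (h1 : lam < 1)
    {w : List (Fin 3)} (hw : ¬ CellInside lam w) {p : ℝ × ℝ} (hp : p ∈ SG)
    (hpw : (cellMap w p).2 < 1 - lam) : ∃ p' ∈ SG, cellMap w p' ∈ cutSet lam := by
  induction w generalizing lam with
  | nil =>
    obtain ⟨p', hp'⟩ := cutSet_nonempty h0 h1
    exact ⟨p', cutSet_subset_SG _ hp', hp'⟩
  | cons j w ih =>
    have hj : IsLetter lam j := by
      rcases lt_or_ge lam (1 / 2) with h | h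
      · rw [isLetter_of_lt h]
        by_contra hj
        exact hw (cellInside_cons_of_lt h0 h hj w)
      · rw [isLetter_of_ge h1 h]
        rintro rfl
        rw [cellMap_cons, F_snd, if_pos rfl] at hpw
        have := snd_nonneg (cellMap_mem hp w)
        linarith
    rw [cellInside_cons h0 h1 hj] at hw
    rw [cellMap_cons, F_snd_lt_iff h0 h1 hj] at hpw
    obtain ⟨p', hp', h⟩ := ih (shift_nonneg h0 h1) (shift_lt_one h0 h1) hw hpw
    exact ⟨p', hp', (F_mem_cutSet_iff h0 h1 hj (cellMap_mem hp' w)).2 h⟩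

theorem closedDomain_eq {lam : ℝ} (h0 : 0 ≤ lam) (h1 : lam < 1) :
    closedDomain lam = openPart lam ∪ cutSet lam := by
  rw [closedDomain, domainBoundary, union_comm (cutSet lam), ← union_assoc, lowerDomain_union h0 h1]

theorem openPart_subset {lam : ℝ} (h0 : 0 ≤ lam) (h1 : lam < 1) :
    openPart lam ⊆ closedDomain lam := by
  rw [closedDomain_eq h0 h1]
  exact subset_union_left

theorem cutSet_subset_closedDomain {lam : ℝ} (h0 : 0 ≤ lam) (h1 : lam < 1) :
    cutSet lam ⊆ closedDomain lam := by
  rw [closedDomain_eq h0 h1]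
  exact subset_union_right

theorem closedDomain_subset_SG {lam : ℝ} (h0 : 0 ≤ lam) (h1 : lam < 1) : closedDomain lam ⊆ SG := by
  rw [closedDomain_eq h0 h1]
  exact union_subset (fun _ hp => hp.1) (cutSet_subset_SG lam)

theorem F_mem_closedDomain_iff {lam : ℝ} (h0 : 0 ≤ lam) (h1 : lam < 1) {j : Fin 3}
    (hj : IsLetter lam j) {p : ℝ × ℝ} (hp : p ∈ SG) :
    F j p ∈ closedDomain lam ↔ p ∈ closedDomain (shift lam) := by
  rw [closedDomain_eq h0 h1, closedDomain_eq (shift_nonneg h0 h1) (shift_lt_one h0 h1), mem_union,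
    mem_union, F_mem_openPart_iff h0 h1 hj hp, F_mem_cutSet_iff h0 h1 hj hp]

theorem F_mem_closedDomain {lam : ℝ} (h0 : 0 ≤ lam) (h1 : lam < 1) {j : Fin 3}
    (hj : IsLetter lam j) {p : ℝ × ℝ} (hp : p ∈ closedDomain (shift lam)) :
    F j p ∈ closedDomain lam :=
  (F_mem_closedDomain_iff h0 h1 hj
    (closedDomain_subset_SG (shift_nonneg h0 h1) (shift_lt_one h0 h1) hp)).2 hp

theorem isCompact_closedDomain {lam : ℝ} (h0 : 0 ≤ lam) (h1 : lam < 1) :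
    IsCompact (closedDomain lam) := by
  by_cases hd : ∃ d, IsMultiple lam d
  · obtain ⟨d, hd⟩ := hd
    induction d generalizing lam with
    | zero =>
      obtain rfl := eq_zero_of_isMultiple_zero h0 h1 hd
      convert isCompact_SG
      refine (closedDomain_subset_SG h0 h1).antisymm fun p hp => ?_
      rw [closedDomain_eq h0 h1]
      rcases (snd_le_one hp).lt_or_eq with h | h
      · exact Or.inl ⟨hp, by linarith⟩
      · rw [eq_q_of_bary_eq_one (i := 0) hp h.ge]
        exact Or.inr q_zero_mem_cutSet
    | succ d ih =>
      have hc := ih (shift_nonneg h0 h1) (shift_lt_one h0 h1) ((isMultiple_shift h0 h1 d).2 hd)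
      have hset : closedDomain lam = ⋃ j : Fin 3, F j '' {p | p ∈ SG ∧ F j p ∈ closedDomain lam} := by
        ext p
        simp only [mem_iUnion, mem_image, mem_ofPred_eq]
        constructor
        · intro hp
          obtain ⟨j, p', hp', rfl⟩ := exists_F_eq (closedDomain_subset_SG h0 h1 hp)
          exact ⟨j, p', ⟨hp', hp⟩, rfl⟩
        · rintro ⟨j, p', ⟨-, hp⟩, rfl⟩
          exact hp
      rw [hset]
      refine isCompact_iUnion fun j => IsCompact.image ?_ (continuous_F j)
      by_cases hj : IsLetter lam j
      · convert hc using 1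
        ext p
        constructor
        · rintro ⟨hp, h⟩
          exact (F_mem_closedDomain_iff h0 h1 hj hp).1 h
        · intro h
          have hp := closedDomain_subset_SG (shift_nonneg h0 h1) (shift_lt_one h0 h1) h
          exact ⟨hp, (F_mem_closedDomain_iff h0 h1 hj hp).2 h⟩
      · rcases lt_or_ge lam (1 / 2) with h | h
        · rw [isLetter_of_lt h] at hj
          convert isCompact_SG using 1
          ext p
          exact ⟨fun hp => hp.1, fun hp => ⟨hp, openPart_subset h0 h1 (F_mem_openPart h hj hp)⟩⟩
        · -- the top cell meets the closed domain in finitely many points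
          rw [isLetter_of_ge h1 h, not_not] at hj
          subst hj
          refine ((finite_range q).subset ?_).isCompact
          rintro p ⟨hp, hpc⟩
          rw [closedDomain_eq h0 h1] at hpc
          rcases hpc with hpc | hpc
          · have h2 := hpc.2
            rw [F_snd, if_pos rfl] at h2
            have := snd_nonneg hp
            linarith
          · obtain ⟨k, hk, p', hp', he⟩ := exists_of_mem_cutSet h0 h1 hpc
            rw [isLetter_of_ge h1 h] at hk
            exact ⟨k, ((eq_of_F_eq hk (cutSet_subset_SG _ hp') hp he).2).symm⟩
  · have : closedDomain lam = SG ∩ {p | p.2 ≤ 1 - lam} := by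
      rw [closedDomain_eq h0 h1]
      ext p
      rw [mem_union, mem_cutSet_iff]
      push Not at hd
      constructor
      · rintro (hp | hp)
        · exact ⟨hp.1, hp.2.le⟩
        · exact ⟨hp.1, hp.2.1.le⟩
      · rintro ⟨hp, hy⟩
        rcases (show p.2 ≤ 1 - lam from hy).lt_or_eq with h | h
        · exact Or.inl ⟨hp, h⟩
        · exact Or.inr ⟨hp, h, fun d h => (hd d h).elim⟩
    rw [this]
    exact isCompact_SG.inter_right (isClosed_le continuous_snd continuous_const)

theorem isCompact_cutSet {lam : ℝ} (h0 : 0 ≤ lam) (h1 : lam < 1) : IsCompact (cutSet lam) := by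
  have : cutSet lam = closedDomain lam ∩ {p | p.2 = 1 - lam} := by
    rw [closedDomain_eq h0 h1]
    ext p
    constructor
    · intro hp
      exact ⟨Or.inr hp, (mem_cutSet_iff.1 hp).2.1⟩
    · rintro ⟨hp | hp, hy⟩
      · exact absurd hy hp.2.ne
      · exact hp
  rw [this]
  exact (isCompact_closedDomain h0 h1).inter_right (isClosed_eq continuous_snd continuous_const)

/-! ### The graph Laplacian and normal derivatives under the contractions -/

theorem sum_cons {m : ℕ} (g : (Fin (m + 1) → Fin 3) → ℝ) :
    ∑ w, g w = ∑ j : Fin 3, ∑ w : Fin m → Fin 3, g (Fin.cons j w) := by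
  rw [← (Fin.consEquiv fun _ => Fin 3).sum_comp, Fintype.sum_prod_type]
  simp [Fin.consEquiv]

theorem sum_words_succ (m : ℕ) (g : List (Fin 3) → ℝ) :
    ∑ w : Fin (m + 1) → Fin 3, g (List.ofFn w) =
      ∑ j : Fin 3, ∑ w : Fin m → Fin 3, g (j :: List.ofFn w) := by
  simp [sum_cons]

open Classical in
/-- The part of the graph Laplacian of level `m + 1` that comes from the cells in `F_j SG`. -/
noncomputable def laplacianPart (j : Fin 3) (m : ℕ) (u : ℝ × ℝ → ℝ) (x : ℝ × ℝ) : ℝ :=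
  ∑ w : Fin m → Fin 3, ∑ i : Fin 3,
    if F j (cellMap (List.ofFn w) (q i)) = x then
      ∑ k : Fin 3, (u x - u (F j (cellMap (List.ofFn w) (q k)))) else 0

theorem graphLaplacian_succ (m : ℕ) (u : ℝ × ℝ → ℝ) (x : ℝ × ℝ) :
    graphLaplacian (m + 1) u x = ∑ j, laplacianPart j m u x := by
  classical
  exact sum_words_succ m fun w => ∑ i : Fin 3,
    if cellMap w (q i) = x then ∑ k : Fin 3, (u x - u (cellMap w (q k))) else 0

theorem laplacianPart_F (j : Fin 3) (m : ℕ) (u : ℝ × ℝ → ℝ) (y : ℝ × ℝ) :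
    laplacianPart j m u (F j y) = graphLaplacian m (u ∘ F j) y := by
  simp only [laplacianPart, graphLaplacian, (F_injective j).eq_iff, Function.comp]

theorem laplacianPart_eq_zero {j : Fin 3} {x : ℝ × ℝ} (h : ∀ p ∈ SG, F j p ≠ x) (m : ℕ)
    (u : ℝ × ℝ → ℝ) : laplacianPart j m u x = 0 :=
  Finset.sum_eq_zero fun _ _ => Finset.sum_eq_zero fun i _ =>
    if_neg (h _ (cellMap_mem (q_mem i) _))

theorem graphLaplacian_F {y : ℝ × ℝ} (hy : y ∈ SG) (j : Fin 3) (hV : ∀ k ≠ j, y ≠ q k)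
    (m : ℕ) (u : ℝ × ℝ → ℝ) :
    graphLaplacian (m + 1) u (F j y) = graphLaplacian m (u ∘ F j) y := by
  rw [graphLaplacian_succ, Fintype.sum_eq_single j, laplacianPart_F]
  intro k hk
  refine laplacianPart_eq_zero (fun p hp he => ?_) m u
  exact hV k hk (eq_of_F_eq hk hp hy he).2

theorem graphLaplacian_F_q {j k : Fin 3} (hjk : j ≠ k) (m : ℕ) (u : ℝ × ℝ → ℝ) :
    graphLaplacian (m + 1) u (F j (q k)) =
      graphLaplacian m (u ∘ F j) (q k) + graphLaplacian m (u ∘ F k) (q j) := by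
  rw [graphLaplacian_succ, Fintype.sum_eq_add j k hjk, laplacianPart_F, F_q_comm, laplacianPart_F]
  rintro l ⟨hlj, hlk⟩
  refine laplacianPart_eq_zero (fun p hp he => ?_) m u
  exact hlk (q_injective (eq_of_F_eq hlj hp (q_mem k) he).2.symm)

theorem normalQuotient_zero (u : ℝ × ℝ → ℝ) (i : Fin 3) :
    normalQuotient u i 0 = 3 * u (q i) - (u (q 0) + u (q 1) + u (q 2)) := by
  simp only [normalQuotient, pow_zero, one_mul, Function.iterate_zero, id]
  have h : (-1 : Fin 3) = 2 := rfl
  fin_cases i <;> simp [h] <;> ring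

theorem normalQuotient_succ (u : ℝ × ℝ → ℝ) (i : Fin 3) (m : ℕ) :
    normalQuotient u i (m + 1) = 5 / 3 * normalQuotient (u ∘ F i) i m := by
  simp only [normalQuotient, Function.comp, Function.iterate_succ_apply', F_q_self, pow_succ]
  ring

theorem graphLaplacian_q (u : ℝ × ℝ → ℝ) (i : Fin 3) (m : ℕ) :
    (5 / 3 : ℝ) ^ m * graphLaplacian m u (q i) = normalQuotient u i m := by
  induction m generalizing u with
  | zero =>
    rw [normalQuotient_zero]
    simp [graphLaplacian, q_injective.eq_iff, Fin.sum_univ_three]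
  | succ m ih =>
    rw [normalQuotient_succ, ← ih]
    have h := graphLaplacian_F (q_mem i) i (fun k hk he => hk (q_injective he).symm) m u
    rw [F_q_self] at h
    rw [h, pow_succ]
    ring

theorem graphLaplacian_F_q_eq_zero_iff {j k : Fin 3} (hjk : j ≠ k) (m : ℕ) (u : ℝ × ℝ → ℝ) :
    graphLaplacian (m + 1) u (F j (q k)) = 0 ↔
      normalQuotient (u ∘ F j) k m + normalQuotient (u ∘ F k) j m = 0 := by
  rw [graphLaplacian_F_q hjk, ← graphLaplacian_q, ← graphLaplacian_q, ← mul_add, mul_eq_zero]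
  have : (5 / 3 : ℝ) ^ m ≠ 0 := by positivity
  simp [this]

theorem HasNormalDeriv.of_comp {u : ℝ × ℝ → ℝ} {i : Fin 3} {d : ℝ}
    (h : HasNormalDeriv (u ∘ F i) i d) : HasNormalDeriv u i (5 / 3 * d) := by
  unfold HasNormalDeriv at *
  rw [← tendsto_add_atTop_iff_nat 1]
  simp only [normalQuotient_succ]
  exact h.const_mul _

theorem HasNormalDeriv.normalDeriv_eq {u : ℝ × ℝ → ℝ} {i : Fin 3} {d : ℝ}
    (h : HasNormalDeriv u i d) : normalDeriv u i = d := h.limUnder_eq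

theorem normalQuotient_add (u v : ℝ × ℝ → ℝ) (i : Fin 3) (m : ℕ) :
    normalQuotient (u + v) i m = normalQuotient u i m + normalQuotient v i m := by
  simp only [normalQuotient, Pi.add_apply]
  ring

theorem normalQuotient_smul (c : ℝ) (u : ℝ × ℝ → ℝ) (i : Fin 3) (m : ℕ) :
    normalQuotient (c • u) i m = c * normalQuotient u i m := by
  simp only [normalQuotient, Pi.smul_apply, smul_eq_mul]
  ring

theorem HasNormalDeriv.add {u v : ℝ × ℝ → ℝ} {i : Fin 3} {d e : ℝ}
    (hu : HasNormalDeriv u i d) (hv : HasNormalDeriv v i e) : HasNormalDeriv (u + v) i (d + e) := by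
  unfold HasNormalDeriv at *
  exact (Tendsto.add hu hv).congr fun m => (normalQuotient_add u v i m).symm

theorem HasNormalDeriv.const_smul {u : ℝ × ℝ → ℝ} {i : Fin 3} {d : ℝ}
    (hu : HasNormalDeriv u i d) (c : ℝ) : HasNormalDeriv (c • u) i (c * d) := by
  unfold HasNormalDeriv at *
  exact (Tendsto.const_mul c hu).congr fun m => (normalQuotient_smul c u i m).symm

theorem graphLaplacian_add (m : ℕ) (u v : ℝ × ℝ → ℝ) (x : ℝ × ℝ) :
    graphLaplacian m (u + v) x = graphLaplacian m u x + graphLaplacian m v x := by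
  simp only [graphLaplacian, ← Finset.sum_add_distrib]
  refine Finset.sum_congr rfl fun w _ => Finset.sum_congr rfl fun i _ => ?_
  split_ifs
  · rw [← Finset.sum_add_distrib]
    refine Finset.sum_congr rfl fun j _ => ?_
    simp only [Pi.add_apply]
    ring
  · simp

theorem graphLaplacian_smul (m : ℕ) (c : ℝ) (u : ℝ × ℝ → ℝ) (x : ℝ × ℝ) :
    graphLaplacian m (c • u) x = c * graphLaplacian m u x := by
  simp only [graphLaplacian, Finset.mul_sum]
  refine Finset.sum_congr rfl fun w _ => Finset.sum_congr rfl fun i _ => ?_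
  split_ifs
  · rw [Finset.mul_sum]
    refine Finset.sum_congr rfl fun j _ => ?_
    simp only [Pi.smul_apply, smul_eq_mul]
    ring
  · simp

theorem graphLaplacian_const (m : ℕ) (c : ℝ) (x : ℝ × ℝ) :
    graphLaplacian m (fun _ => c) x = 0 := by
  simp [graphLaplacian]

theorem IsHarmonicIn.add {lam : ℝ} {u v : ℝ × ℝ → ℝ} (hu : IsHarmonicIn lam u)
    (hv : IsHarmonicIn lam v) : IsHarmonicIn lam (u + v) := fun m x hx hc => by
  rw [graphLaplacian_add, hu m x hx hc, hv m x hx hc, add_zero]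

theorem IsHarmonicIn.const_smul {lam : ℝ} {u : ℝ × ℝ → ℝ} (hu : IsHarmonicIn lam u) (c : ℝ) :
    IsHarmonicIn lam (c • u) := fun m x hx hc => by
  rw [graphLaplacian_smul, hu m x hx hc, mul_zero]

theorem isHarmonicIn_const (lam c : ℝ) : IsHarmonicIn lam fun _ => c :=
  fun m x _ _ => graphLaplacian_const m c x

/-! ### Harmonic functions on the whole gasket -/

/-- Harmonicity on the whole gasket: the mean value property holds at all vertices other than
`q₀, q₁, q₂`. -/
def IsHarmonicOnGasket (v : ℝ × ℝ → ℝ) : Prop :=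
  ∀ m, ∀ x ∈ V m, x ∉ V 0 → graphLaplacian m v x = 0

theorem IsHarmonicOnGasket.isHarmonicIn {v : ℝ × ℝ → ℝ} (hv : IsHarmonicOnGasket v) (lam : ℝ) :
    IsHarmonicIn lam v := fun m x hx _ => hv m x hx.1 hx.2.1.2

theorem F_q_not_mem {j k : Fin 3} (hjk : j ≠ k) : F j (q k) ∉ V 0 := fun h =>
  hjk (q_injective (F_mem_V_zero (q_mem k) h)).symm

theorem IsHarmonicOnGasket.comp {v : ℝ × ℝ → ℝ} (hv : IsHarmonicOnGasket v) (j : Fin 3) :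
    IsHarmonicOnGasket (v ∘ F j) := by
  intro m x hx hx0
  rw [← graphLaplacian_F (V_subset_SG m hx) j (fun k _ hk => hx0 ⟨k, hk.symm⟩)]
  refine hv (m + 1) _ (mem_V_succ.2 ⟨j, x, hx, rfl⟩) fun h => hx0 ⟨j, ?_⟩
  exact (F_mem_V_zero (V_subset_SG m hx) h).symm

theorem IsHarmonicOnGasket.matching {v : ℝ × ℝ → ℝ} (hv : IsHarmonicOnGasket v) {j k : Fin 3}
    (hjk : j ≠ k) : normalQuotient (v ∘ F j) k 0 + normalQuotient (v ∘ F k) j 0 = 0 :=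
  (graphLaplacian_F_q_eq_zero_iff hjk 0 v).1
    (hv 1 _ (mem_V_succ.2 ⟨j, q k, ⟨k, rfl⟩, rfl⟩) (F_q_not_mem hjk))

/-- The `1/5`-`2/5` rule. -/
theorem IsHarmonicOnGasket.apply_F_q {v : ℝ × ℝ → ℝ} (hv : IsHarmonicOnGasket v) {j k : Fin 3}
    (hjk : j ≠ k) :
    v (F j (q k)) = (v (q j) + v (q k) + (v (q 0) + v (q 1) + v (q 2))) / 5 := by
  have h := fun j k (hjk : j ≠ k) => hv.matching hjk
  have h01 := h 0 1 (by decide)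
  have h02 := h 0 2 (by decide)
  have h12 := h 1 2 (by decide)
  simp only [normalQuotient_zero, Function.comp, F_q_self] at h01 h02 h12
  rw [F_q_comm 1 0, F_q_comm 2 0, F_q_comm 2 1] at *
  fin_cases j <;> fin_cases k <;>
    simp [F_q_comm 1 0, F_q_comm 2 0, F_q_comm 2 1] at hjk ⊢ <;> linarith

theorem IsHarmonicOnGasket.normalQuotient_eq {v : ℝ × ℝ → ℝ} (hv : IsHarmonicOnGasket v)
    (i : Fin 3) (m : ℕ) : normalQuotient v i m = normalQuotient v i 0 := by
  induction m generalizing v with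
  | zero => rfl
  | succ m ih =>
    rw [normalQuotient_succ, ih (hv.comp i), normalQuotient_zero, normalQuotient_zero]
    have h := fun k (hk : i ≠ k) => hv.apply_F_q hk
    fin_cases i
    · have h1 := h 1 (by decide)
      have h2 := h 2 (by decide)
      simp only [Function.comp, F_q_self, Fin.zero_eta] at *
      linarith
    · have h1 := h 0 (by decide)
      have h2 := h 2 (by decide)
      simp only [Function.comp, F_q_self, Fin.mk_one] at *
      linarith
    · have h1 := h 0 (by decide)
      have h2 := h 1 (by decide)
      simp only [Function.comp, F_q_self, Fin.reduceFinMk] at *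
      linarith

/-! ### Harmonic functions on the lower domains -/

theorem IsHarmonicIn.comp {lam : ℝ} (h0 : 0 ≤ lam) (h1 : lam < 1) {u : ℝ × ℝ → ℝ}
    (hu : IsHarmonicIn lam u) {j : Fin 3} (hj : IsLetter lam j) :
    IsHarmonicIn (shift lam) (u ∘ F j) := by
  rintro m x ⟨hxV, ⟨hx, hx0⟩, hy⟩ hc
  rw [← graphLaplacian_F hx j (fun k _ hk => hx0 ⟨k, hk.symm⟩)]
  refine hu (m + 1) _ ⟨mem_V_succ.2 ⟨j, x, hxV, rfl⟩, ⟨F_mem hx j, fun h => hx0 ⟨j, ?_⟩⟩,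
    (F_snd_lt_iff h0 h1 hj x).2 hy⟩ ?_
  · exact (F_mem_V_zero hx h).symm
  · intro w hw
    rw [List.ofFn_succ] at hw ⊢
    rw [cellMap_image_cons] at hw
    obtain ⟨_, ⟨p, hp, rfl⟩, he⟩ := hw
    by_cases hwj : w 0 = j
    · rw [hwj] at he ⊢
      rw [cellInside_cons h0 h1 hj]
      exact hc _ ⟨p, hp, F_injective j he⟩
    · exact (hx0 ⟨_, (eq_of_F_eq hwj (cellMap_mem hp _) hx he).2.symm⟩).elim

theorem IsHarmonicIn.comp_of_lt {lam : ℝ} (h0 : 0 ≤ lam) (h : lam < 1 / 2) {u : ℝ × ℝ → ℝ}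
    (hu : IsHarmonicIn lam u) {j : Fin 3} (hj : j ≠ 0) : IsHarmonicOnGasket (u ∘ F j) := by
  intro m x hxV hx0
  have hx := V_subset_SG m hxV
  rw [← graphLaplacian_F hx j (fun k _ hk => hx0 ⟨k, hk.symm⟩)]
  refine hu (m + 1) _ ⟨mem_V_succ.2 ⟨j, x, hxV, rfl⟩, ⟨F_mem hx j, fun h => hx0 ⟨j, ?_⟩⟩,
    (F_mem_openPart h hj hx).2⟩ ?_
  · exact (F_mem_V_zero hx h).symm
  · intro w hw
    rw [List.ofFn_succ] at hw ⊢
    rw [cellMap_image_cons] at hw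
    obtain ⟨_, ⟨p, hp, rfl⟩, he⟩ := hw
    by_cases hwj : w 0 = j
    · rw [hwj]
      exact cellInside_cons_of_lt h0 h hj _
    · exact (hx0 ⟨_, (eq_of_F_eq hwj (cellMap_mem hp _) hx he).2.symm⟩).elim

theorem IsHarmonicIn.normalQuotient_eq {lam : ℝ} (h0 : 0 ≤ lam) (h1 : lam < 1)
    {u : ℝ × ℝ → ℝ} (hu : IsHarmonicIn lam u) {i : Fin 3} (hi : i ≠ 0) {k m : ℕ}
    (hk : (1 / 2 : ℝ) ^ k < 1 - lam) (hkm : k ≤ m) : normalQuotient u i m = normalQuotient u i k := by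
  induction k generalizing lam u m with
  | zero => norm_num at hk; linarith
  | succ k ih =>
    obtain ⟨m, rfl⟩ := Nat.exists_eq_add_of_le' (Nat.one_le_of_lt hkm)
    rw [normalQuotient_succ, normalQuotient_succ]
    rcases lt_or_ge lam (1 / 2) with h | h
    · have hg := hu.comp_of_lt h0 h hi
      rw [hg.normalQuotient_eq i m, hg.normalQuotient_eq i k]
    · rw [ih (shift_nonneg h0 h1) (shift_lt_one h0 h1) (hu.comp h0 h1 ((isLetter_of_ge h1 h).2 hi))
        ?_ (by omega)]
      rw [shift_of_ge h1 h]
      rw [pow_succ] at hk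
      linarith

theorem IsHarmonicIn.hasNormalDeriv_normalQuotient {lam : ℝ} (h0 : 0 ≤ lam) (h1 : lam < 1)
    {u : ℝ × ℝ → ℝ} (hu : IsHarmonicIn lam u) {i : Fin 3} (hi : i ≠ 0) {k : ℕ}
    (hk : (1 / 2 : ℝ) ^ k < 1 - lam) : HasNormalDeriv u i (normalQuotient u i k) :=
  tendsto_atTop_of_eventually_const fun m (hm : m ≥ k) => hu.normalQuotient_eq h0 h1 hi hk hm

theorem exists_pow_half_lt {lam : ℝ} (h1 : lam < 1) : ∃ k : ℕ, (1 / 2 : ℝ) ^ k < 1 - lam :=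
  exists_pow_lt_of_lt_one (by linarith) (by norm_num)

theorem IsHarmonicIn.hasNormalDeriv {lam : ℝ} (h0 : 0 ≤ lam) (h1 : lam < 1)
    {u : ℝ × ℝ → ℝ} (hu : IsHarmonicIn lam u) {i : Fin 3} (hi : i ≠ 0) :
    HasNormalDeriv u i (normalDeriv u i) := by
  obtain ⟨k, hk⟩ := exists_pow_half_lt h1
  have := hu.hasNormalDeriv_normalQuotient h0 h1 hi hk
  rwa [this.normalDeriv_eq]

/-- At the point where two cells of level one meet, the normal derivatives cancel. -/
theorem IsHarmonicIn.eventually_matching {lam : ℝ} (h0 : 0 ≤ lam) (h1 : lam < 1)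
    {u : ℝ × ℝ → ℝ} (hu : IsHarmonicIn lam u) {j k : Fin 3} (hjk : j ≠ k)
    (hy : (F j (q k)).2 < 1 - lam) :
    ∀ᶠ m in atTop, normalQuotient (u ∘ F j) k m + normalQuotient (u ∘ F k) j m = 0 := by
  obtain ⟨M, hM⟩ := exists_pow_lt_of_lt_one (sub_pos.2 hy) (show (1 / 2 : ℝ) < 1 by norm_num)
  filter_upwards [eventually_ge_atTop M] with m hm
  rw [← graphLaplacian_F_q_eq_zero_iff hjk]
  refine hu _ _ ⟨mem_V_succ.2 ⟨j, q k, monotone_nat_of_le_succ V_subset_succ (Nat.zero_le m)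
    ⟨k, rfl⟩, rfl⟩, ⟨F_mem (q_mem k) j, F_q_not_mem hjk⟩, hy⟩ ?_
  rintro w ⟨p, hp, he⟩
  -- the top of a cell through the vertex lies at most one cell size higher
  rw [cellInside_iff h0 h1]
  have h := cellMap_snd (List.ofFn w) p
  rw [he, List.length_ofFn] at h
  have h2 : (1 / 2 : ℝ) ^ (m + 1) ≤ (1 / 2 : ℝ) ^ M :=
    pow_le_pow_of_le_one (by norm_num) (by norm_num) (by omega)
  have h3 : (0 : ℝ) < (1 / 2) ^ (m + 1) := by positivity
  have := snd_nonneg hp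
  nlinarith

theorem IsHarmonicIn.matching_of_ge {lam : ℝ} (h0 : 0 ≤ lam) (h1 : lam < 1) (h : 1 / 2 ≤ lam)
    {u : ℝ × ℝ → ℝ} (hu : IsHarmonicIn lam u) :
    normalDeriv (u ∘ F 1) 2 + normalDeriv (u ∘ F 2) 1 = 0 := by
  have hc : ∀ i ≠ 0, IsHarmonicIn (shift lam) (u ∘ F i) := fun i hi =>
    hu.comp h0 h1 ((isLetter_of_ge h1 h).2 hi)
  have hd := Tendsto.add
    ((hc 1 (by decide)).hasNormalDeriv (shift_nonneg h0 h1) (shift_lt_one h0 h1) (i := 2) (by decide))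
    ((hc 2 (by decide)).hasNormalDeriv (shift_nonneg h0 h1) (shift_lt_one h0 h1) (i := 1) (by decide))
  refine tendsto_nhds_unique hd (tendsto_const_nhds.congr' ?_)
  filter_upwards [hu.eventually_matching h0 h1 (j := 1) (k := 2) (by decide) (by
    rw [F_snd, q_snd]; simpa using h1)] with m hm
  exact hm.symm

theorem IsHarmonicIn.matching_of_lt {lam : ℝ} (h0 : 0 ≤ lam) (h : lam < 1 / 2)
    {u : ℝ × ℝ → ℝ} (hu : IsHarmonicIn lam u) {i : Fin 3} (hi : i ≠ 0) :
    normalDeriv (u ∘ F 0) i + normalQuotient (u ∘ F i) 0 0 = 0 := by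
  have h1 : lam < 1 := by linarith
  have hd := (hu.comp h0 h1 ((isLetter_of_lt h).2 rfl)).hasNormalDeriv
    (shift_nonneg h0 h1) (shift_lt_one h0 h1) hi
  have hd' := Tendsto.add_const (normalQuotient (u ∘ F i) 0 0) hd
  refine tendsto_nhds_unique hd' (tendsto_const_nhds.congr' ?_)
  filter_upwards [hu.eventually_matching h0 h1 (j := 0) (k := i) hi.symm (by
    rw [F_snd, q_snd, if_neg hi]; norm_num; linarith)] with m hm
  rw [(hu.comp_of_lt h0 h hi).normalQuotient_eq 0 m] at hm
  exact hm.symm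

theorem IsHarmonicIn.matching_bottom_of_lt {lam : ℝ} (h0 : 0 ≤ lam) (h : lam < 1 / 2)
    {u : ℝ × ℝ → ℝ} (hu : IsHarmonicIn lam u) :
    normalQuotient (u ∘ F 1) 2 0 + normalQuotient (u ∘ F 2) 1 0 = 0 := by
  have h1 : lam < 1 := by linarith
  obtain ⟨m, hm⟩ := (hu.eventually_matching h0 h1 (j := 1) (k := 2) (by decide) (by
    rw [F_snd, q_snd]; simpa using h1)).exists
  rwa [(hu.comp_of_lt h0 h (by decide)).normalQuotient_eq 2 m,
    (hu.comp_of_lt h0 h (by decide)).normalQuotient_eq 1 m] at hm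

theorem pow_half_lt_of_cellInside {lam : ℝ} (h0 : 0 ≤ lam) (h1 : lam < 1) {k : Fin 3} (hk : k ≠ 0)
    {m : ℕ} (h : CellInside lam (List.replicate m k)) : (1 / 2 : ℝ) ^ m < 1 - lam := by
  have hrep : cellMap (List.replicate m k) (q k) = q k := by
    clear h
    induction m with
    | zero => rfl
    | succ n ihn => rw [List.replicate_succ, cellMap_cons, ihn, F_q_self]
  rw [cellInside_iff h0 h1] at h
  have := cellMap_snd (List.replicate m k) (q k)
  rw [hrep, q_snd, if_neg hk, List.length_replicate] at this
  linarith

/-- A function is harmonic if its pieces on the cells of level one are and the normal derivatives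
match. The matching is required only at those levels at which the domain is wide enough. -/
theorem isHarmonicIn_of_pieces {lam : ℝ} (h0 : 0 ≤ lam) (h1 : lam < 1) {u : ℝ × ℝ → ℝ}
    (hcut : ∀ j, IsLetter lam j → IsHarmonicIn (shift lam) (u ∘ F j))
    (hfull : lam < 1 / 2 → ∀ j ≠ 0, IsHarmonicOnGasket (u ∘ F j))
    (hmatch : ∀ m, ∀ j k : Fin 3, j ≠ k → CellInside lam (j :: List.replicate m k) →
      CellInside lam (k :: List.replicate m j) →
      normalQuotient (u ∘ F j) k m + normalQuotient (u ∘ F k) j m = 0) :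
    IsHarmonicIn lam u := by
  rintro m x ⟨hxV, ⟨hx, hx0⟩, hy⟩ hc
  cases m with
  | zero => exact (hx0 hxV).elim
  | succ m =>
    obtain ⟨j, y, hyV, rfl⟩ := mem_V_succ.1 hxV
    have hyS := V_subset_SG m hyV
    have hrep : ∀ k, cellMap (List.replicate m k) (q k) = q k := fun k => by
      clear hyV hc hxV
      induction m with
      | zero => rfl
      | succ n ihn => rw [List.replicate_succ, cellMap_cons, ihn, F_q_self]
    have hcons : ∀ i, ∀ v : Fin m → Fin 3, List.ofFn (Fin.cons i v : Fin (m + 1) → Fin 3)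
        = i :: List.ofFn v := fun i v => by simp
    have hc' : ∀ i, ∀ v : Fin m → Fin 3, F j y ∈ F i '' (cellMap (List.ofFn v) '' SG) →
        CellInside lam (i :: List.ofFn v) := fun i v hv => by
      rw [← hcons]
      refine hc _ ?_
      rwa [hcons, cellMap_image_cons]
    by_cases hyq : ∃ k ≠ j, y = q k
    · obtain ⟨k, hkj, rfl⟩ := hyq
      rw [graphLaplacian_F_q_eq_zero_iff hkj.symm]
      refine hmatch m j k hkj.symm ?_ ?_
      · rw [← List.ofFn_const]
        refine hc' _ _ ⟨q k, ⟨q k, q_mem k, ?_⟩, rfl⟩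
        rw [List.ofFn_const, hrep]
      · rw [← List.ofFn_const]
        refine hc' _ _ ⟨q j, ⟨q j, q_mem j, ?_⟩, F_q_comm _ _⟩
        rw [List.ofFn_const, hrep]
    · push Not at hyq
      rw [graphLaplacian_F hyS j hyq]
      have hy0 : y ∉ V 0 := by
        rintro ⟨k, rfl⟩
        by_cases hkj : k = j
        · subst hkj
          exact hx0 ⟨k, (F_q_self k).symm⟩
        · exact hyq k hkj rfl
      by_cases hj : IsLetter lam j
      · refine hcut j hj m y ⟨hyV, ⟨hyS, hy0⟩, (F_snd_lt_iff h0 h1 hj y).1 hy⟩ fun v hv => ?_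
        rw [← cellInside_cons h0 h1 hj]
        exact hc' j v ⟨y, hv, rfl⟩
      · rcases lt_or_ge lam (1 / 2) with h | h
        · rw [isLetter_of_lt h] at hj
          exact hfull h j hj m y hyV hy0
        · rw [isLetter_of_ge h1 h, not_not] at hj
          subst hj
          rw [F_snd, if_pos rfl] at hy
          have := snd_nonneg hyS
          linarith

/-! ### The maximum principle -/

theorem exists_ofFn_eq {α : Type*} {m : ℕ} {w : List α} (hw : w.length = m) :
    ∃ v : Fin m → α, List.ofFn v = w := by
  subst hw
  exact ⟨w.get, List.ofFn_get w⟩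

/-- Mean value argument: if the largest value of `u` at the vertices of the `m`-cells inside the
domain is taken at `x`, and `x` is a highest such point, then `x` is a bottom vertex or lies in a cell
that is not inside the domain. -/
theorem IsHarmonicIn.exists_not_inside {lam : ℝ} {u : ℝ × ℝ → ℝ}
    (hu : IsHarmonicIn lam u) {m : ℕ} {x : ℝ × ℝ} (hxV : x ∈ V m) (hx : x ∈ lowerDomain lam)
    (hmax : ∀ v : Fin m → Fin 3, CellInside lam (List.ofFn v) → ∀ i,
      u (cellMap (List.ofFn v) (q i)) ≤ u x)
    (htop : ∀ v : Fin m → Fin 3, CellInside lam (List.ofFn v) → ∀ i,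
      u (cellMap (List.ofFn v) (q i)) = u x → (cellMap (List.ofFn v) (q i)).2 ≤ x.2) :
    ∃ v : Fin m → Fin 3, x ∈ cellMap (List.ofFn v) '' SG ∧ ¬ CellInside lam (List.ofFn v) := by
  by_contra! hin
  have hsum := hu m x ⟨hxV, hx⟩ hin
  obtain ⟨w, hw, i, rfl⟩ := mem_V_iff.1 hxV
  have hne : cellMap w (q i) ≠ q 0 := fun he => hx.1.2 (he ▸ ⟨0, rfl⟩)
  obtain ⟨w', hw', j, hj, he⟩ := exists_lower_vertex hne
  obtain ⟨v, rfl⟩ := exists_ofFn_eq (hw'.trans hw)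
  set x := cellMap w (q i) with hxdef
  have hpos : ∀ (v : Fin m → Fin 3) (i : Fin 3), cellMap (List.ofFn v) (q i) = x →
      ∀ k, 0 ≤ u x - u (cellMap (List.ofFn v) (q k)) := fun v i hvi k =>
    sub_nonneg.2 (hmax v (hin v ⟨q i, q_mem i, hvi⟩) k)
  have hpos' : ∀ (v : Fin m → Fin 3) (i : Fin 3), 0 ≤ if cellMap (List.ofFn v) (q i) = x then
      ∑ k : Fin 3, (u x - u (cellMap (List.ofFn v) (q k))) else 0 := fun v i => by
    split_ifs with hvi
    · exact Finset.sum_nonneg fun k _ => hpos v i hvi k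
    · exact le_rfl
  rw [graphLaplacian, Finset.sum_eq_zero_iff_of_nonneg fun v _ => Finset.sum_nonneg fun i _ => by
    convert hpos' v i] at hsum
  have h2 := hsum v (Finset.mem_univ _)
  rw [Finset.sum_eq_zero_iff_of_nonneg fun i _ => by convert hpos' v i] at h2
  have h3 := h2 j (Finset.mem_univ _)
  rw [if_pos he, Finset.sum_eq_zero_iff_of_nonneg fun k _ => hpos v j he k] at h3
  have h4 := h3 0 (Finset.mem_univ _)
  have h5 := htop v (hin v ⟨q j, q_mem j, he⟩) 0 (by linarith)
  have h6 := cellMap_snd (List.ofFn v) (q j)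
  rw [he, q_snd, if_neg hj] at h6
  have : (0 : ℝ) < (1 / 2) ^ (List.ofFn v).length := by positivity
  linarith

theorem IsHarmonicIn.le_of_boundary_le {lam : ℝ} (h0 : 0 ≤ lam) (h1 : lam < 1) {u : ℝ × ℝ → ℝ}
    (hc : ContinuousOn u (closedDomain lam)) (hu : IsHarmonicIn lam u) {C : ℝ}
    (hX : ∀ p ∈ cutSet lam, u p ≤ C) (hq1 : u (q 1) ≤ C) (hq2 : u (q 2) ≤ C) :
    ∀ p ∈ closedDomain lam, u p ≤ C := by
  classical
  intro p hp
  refine le_of_forall_pos_le_add fun ε hε => ?_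
  have hunif := (isCompact_closedDomain h0 h1).uniformContinuousOn_of_continuous hc
  rw [Metric.uniformContinuousOn_iff] at hunif
  obtain ⟨δ, hδ, hunif⟩ := hunif (ε / 2) (by linarith)
  rw [closedDomain_eq h0 h1] at hp
  rcases hp with hp | hp
  swap
  · linarith [hX p hp]
  obtain ⟨M, hM⟩ := exists_dist_cellMap_lt hδ
  obtain ⟨M', hM'⟩ := exists_pow_lt_of_lt_one (sub_pos.2 hp.2) (show (1 / 2 : ℝ) < 1 by norm_num)
  set m := max M M' with hm
  have hclose : ∀ v : Fin m → Fin 3, ∀ a ∈ SG, ∀ b ∈ SG, cellMap (List.ofFn v) a ∈ closedDomain lam →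
      cellMap (List.ofFn v) b ∈ closedDomain lam →
      u (cellMap (List.ofFn v) a) ≤ u (cellMap (List.ofFn v) b) + ε / 2 := by
    intro v a ha b hb hac hbc
    have := hunif _ hac _ hbc (hM _ (by rw [List.length_ofFn]; exact le_max_left _ _) a ha b hb)
    rw [Real.dist_eq, abs_lt] at this
    linarith
  have hinside : ∀ v : Fin m → Fin 3, CellInside lam (List.ofFn v) → ∀ a ∈ SG,
      cellMap (List.ofFn v) a ∈ openPart lam := fun v hv a ha => by
    rw [← lowerDomain_union h0 h1]
    exact hv ⟨a, ha, rfl⟩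
  -- the cell of `p` is inside the domain
  obtain ⟨w, hw, p', hp', hpe⟩ := exists_cellMap_eq m hp.1
  obtain ⟨v₀, rfl⟩ := exists_ofFn_eq hw
  have hv₀ : CellInside lam (List.ofFn v₀) := by
    rw [cellInside_iff h0 h1]
    have h := cellMap_snd (List.ofFn v₀) p'
    rw [hpe, hw] at h
    have h2 : (1 / 2 : ℝ) ^ m ≤ (1 / 2 : ℝ) ^ M' :=
      pow_le_pow_of_le_one (by norm_num) (by norm_num) (le_max_right _ _)
    have h3 : (0 : ℝ) < (1 / 2) ^ m := by positivity
    have := snd_nonneg hp'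
    nlinarith
  -- the highest among the vertices with the largest value
  let s : Finset ((Fin m → Fin 3) × Fin 3) := Finset.univ.filter fun a => CellInside lam (List.ofFn a.1)
  let vert : (Fin m → Fin 3) × Fin 3 → ℝ × ℝ := fun a => cellMap (List.ofFn a.1) (q a.2)
  obtain ⟨⟨v, i⟩, hvs, hmax⟩ := s.exists_max_image (fun a => toLex (u (vert a), (vert a).2))
    ⟨(v₀, 0), by simp [s, hv₀]⟩
  have hv : CellInside lam (List.ofFn v) := by simpa [s] using hvs
  have hmax' : ∀ v' : Fin m → Fin 3, CellInside lam (List.ofFn v') → ∀ j,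
      u (vert (v', j)) < u (vert (v, i)) ∨
        u (vert (v', j)) = u (vert (v, i)) ∧ (vert (v', j)).2 ≤ (vert (v, i)).2 := fun v' hv' j => by
    have := hmax (v', j) (by simp [s, hv'])
    rwa [Prod.Lex.toLex_le_toLex] at this
  have hxo : vert (v, i) ∈ openPart lam := hinside v hv _ (q_mem i)
  have hbound : u (vert (v, i)) ≤ C + ε / 2 := by
    have hxo' := hxo
    rw [← lowerDomain_union h0 h1] at hxo'
    rcases hxo' with hx | hx | hx
    · obtain ⟨v', ⟨a, ha, hae⟩, hv'⟩ := hu.exists_not_inside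
        (mem_V_iff.2 ⟨_, List.length_ofFn, i, rfl⟩) hx
        (fun v' hv' j => (hmax' v' hv' j).elim le_of_lt fun h => h.1.le)
        (fun v' hv' j he => (hmax' v' hv' j).elim (fun h => absurd he h.ne) fun h => h.2)
      obtain ⟨b, hb, hbX⟩ := exists_mem_cutSet_of_not_inside h0 h1 hv' ha (hae ▸ hxo.2)
      have := hclose v' a ha b hb (hae ▸ openPart_subset h0 h1 hxo)
        (cutSet_subset_closedDomain h0 h1 hbX)
      rw [hae] at this
      linarith [hX _ hbX]
    · rw [hx]; linarith
    · rw [show vert (v, i) = q 2 from hx]; linarith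
  have hlast := hclose v₀ p' hp' (q 0) (q_mem 0) (hpe ▸ openPart_subset h0 h1 hp)
    (openPart_subset h0 h1 (hinside v₀ hv₀ _ (q_mem 0)))
  rw [hpe] at hlast
  have : u (vert (v₀, 0)) ≤ u (vert (v, i)) := (hmax' v₀ hv₀ 0).elim le_of_lt fun h => h.1.le
  linarith

theorem IsHarmonicIn.ge_of_boundary_ge {lam : ℝ} (h0 : 0 ≤ lam) (h1 : lam < 1) {u : ℝ × ℝ → ℝ}
    (hc : ContinuousOn u (closedDomain lam)) (hu : IsHarmonicIn lam u) {C : ℝ}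
    (hX : ∀ p ∈ cutSet lam, C ≤ u p) (hq1 : C ≤ u (q 1)) (hq2 : C ≤ u (q 2)) :
    ∀ p ∈ closedDomain lam, C ≤ u p := fun p hp => by
  have := (hu.const_smul (-1)).le_of_boundary_le h0 h1 (C := -C) (hc.const_smul (-1))
    (fun p hp => by simpa using hX p hp) (by simpa using hq1) (by simpa using hq2) p hp
  simpa using this

/-- The solution of the Dirichlet problem is unique. -/
theorem IsHarmonicIn.eqOn_of_boundary_eq {lam : ℝ} (h0 : 0 ≤ lam) (h1 : lam < 1)
    {u v : ℝ × ℝ → ℝ} (huc : ContinuousOn u (closedDomain lam)) (hu : IsHarmonicIn lam u)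
    (hvc : ContinuousOn v (closedDomain lam)) (hv : IsHarmonicIn lam v)
    (hX : ∀ p ∈ cutSet lam, u p = v p) (hq1 : u (q 1) = v (q 1)) (hq2 : u (q 2) = v (q 2)) :
    EqOn u v (closedDomain lam) := fun p hp => by
  have hd := hu.add (hv.const_smul (-1))
  have hdc : ContinuousOn (u + (-1 : ℝ) • v) (closedDomain lam) := huc.add (hvc.const_smul (-1 : ℝ))
  have hle := hd.le_of_boundary_le h0 h1 (C := 0) hdc (fun p hp => by simp [hX p hp])
    (by simp [hq1]) (by simp [hq2]) p hp
  have hge := hd.ge_of_boundary_ge h0 h1 (C := 0) hdc (fun p hp => by simp [hX p hp])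
    (by simp [hq1]) (by simp [hq2]) p hp
  simp only [Pi.add_apply, Pi.smul_apply, smul_eq_mul] at hle hge
  linarith

theorem iterate_F_snd {i : Fin 3} (hi : i ≠ 0) (m : ℕ) (p : ℝ × ℝ) :
    ((F i)^[m] p).2 = (1 / 2) ^ m * p.2 := by
  induction m with
  | zero => simp
  | succ m ih =>
    rw [Function.iterate_succ_apply', F_snd, if_neg hi, ih, pow_succ]
    ring

theorem iterate_F_mem {p : ℝ × ℝ} (hp : p ∈ SG) (i : Fin 3) (m : ℕ) : (F i)^[m] p ∈ SG := by
  induction m with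
  | zero => exact hp
  | succ m ih => rw [Function.iterate_succ_apply']; exact F_mem ih i

theorem iterate_F_q_mem_openPart {lam : ℝ} {i : Fin 3} (hi : i ≠ 0) (j : Fin 3) {m : ℕ}
    (hm : (1 / 2 : ℝ) ^ m < 1 - lam) : (F i)^[m] (q j) ∈ openPart lam := by
  refine ⟨iterate_F_mem (q_mem j) i m, ?_⟩
  rw [iterate_F_snd hi]
  have h2 : (0 : ℝ) < (1 / 2) ^ m := by positivity
  have := snd_le_one (q_mem j)
  nlinarith

theorem eventually_iterate_F_q_mem {lam : ℝ} (h1 : lam < 1) {i : Fin 3} (hi : i ≠ 0) (j : Fin 3) :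
    ∀ᶠ m in atTop, (F i)^[m] (q j) ∈ openPart lam := by
  have := (tendsto_pow_atTop_nhds_zero_of_lt_one (r := (1 / 2 : ℝ)) (by norm_num)
    (by norm_num)).eventually (gt_mem_nhds (sub_pos.2 h1))
  filter_upwards [this] with m hm using iterate_F_q_mem_openPart hi j hm

theorem q_mem_openPart {lam : ℝ} (h1 : lam < 1) {i : Fin 3} (hi : i ≠ 0) : q i ∈ openPart lam :=
  ⟨q_mem i, by rw [q_snd, if_neg hi]; linarith⟩

theorem HasNormalDeriv.congr {lam : ℝ} (h1 : lam < 1) {u v : ℝ × ℝ → ℝ} {i : Fin 3} (hi : i ≠ 0)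
    (h : EqOn u v (openPart lam)) {d : ℝ} (hu : HasNormalDeriv u i d) : HasNormalDeriv v i d := by
  refine Tendsto.congr' ?_ hu
  filter_upwards [eventually_iterate_F_q_mem h1 hi (i + 1),
    eventually_iterate_F_q_mem h1 hi (i - 1)] with m hm hm'
  rw [normalQuotient, normalQuotient, h hm, h hm', h (q_mem_openPart h1 hi)]

theorem HasNormalDeriv.nonpos {lam : ℝ} (h1 : lam < 1) {u : ℝ × ℝ → ℝ} {i : Fin 3} (hi : i ≠ 0)
    (h : ∀ p ∈ openPart lam, 0 ≤ u p) (hq : u (q i) = 0) {d : ℝ} (hu : HasNormalDeriv u i d) :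
    d ≤ 0 := by
  refine le_of_tendsto hu ?_
  filter_upwards [eventually_iterate_F_q_mem h1 hi (i + 1),
    eventually_iterate_F_q_mem h1 hi (i - 1)] with m hm hm'
  rw [normalQuotient, hq]
  refine mul_nonpos_of_nonneg_of_nonpos (by positivity) ?_
  linarith [h _ hm, h _ hm']

/-! ### Gluing functions along the cells of level one -/

open Classical in
/-- The function that equals `g j ∘ F_j⁻¹` on the cell `F_j SG`, where `F_j⁻¹ p = 2 p - q_j`. -/
noncomputable def glue (g : Fin 3 → ℝ × ℝ → ℝ) (p : ℝ × ℝ) : ℝ :=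
  if p ∈ F 0 '' SG then g 0 ((2 : ℝ) • p - q 0)
  else if p ∈ F 1 '' SG then g 1 ((2 : ℝ) • p - q 1)
  else g 2 ((2 : ℝ) • p - q 2)

theorem two_smul_F_sub (j : Fin 3) (p : ℝ × ℝ) : (2 : ℝ) • F j p - q j = p := by
  simp [F, smul_smul]

theorem glue_F {g : Fin 3 → ℝ × ℝ → ℝ} (hg : ∀ j k, g j (q k) = g k (q j)) (j : Fin 3)
    {p : ℝ × ℝ} (hp : p ∈ SG) : glue g (F j p) = g j p := by
  have key : ∀ i, F j p ∈ F i '' SG → g i ((2 : ℝ) • F j p - q i) = g j p := by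
    rintro i ⟨p', hp', he⟩
    by_cases hij : i = j
    · subst hij
      rw [two_smul_F_sub]
    · rw [← he, two_smul_F_sub]
      obtain ⟨rfl, rfl⟩ := eq_of_F_eq hij hp' hp he
      exact hg i j
  unfold glue
  split_ifs with h0 h1
  · exact key 0 h0
  · exact key 1 h1
  · refine key 2 ?_
    fin_cases j
    · exact (h0 ⟨p, hp, rfl⟩).elim
    · exact (h1 ⟨p, hp, rfl⟩).elim
    · exact ⟨p, hp, rfl⟩

theorem continuousOn_glue {g : Fin 3 → ℝ × ℝ → ℝ} (hg : ∀ j k, g j (q k) = g k (q j))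
    (hc : ∀ j, ContinuousOn (g j) SG) : ContinuousOn (glue g) SG := by
  rw [SG_isAttractor.2.2]
  refine (locallyFinite_of_finite _).continuousOn_iUnion
    (fun j => (isCompact_SG.image (continuous_F j)).isClosed) fun j => ?_
  have h : ContinuousOn (fun p : ℝ × ℝ => g j ((2 : ℝ) • p - q j)) (F j '' SG) := by
    refine (hc j).comp (by fun_prop) ?_
    rintro _ ⟨p, hp, rfl⟩
    simpa only [two_smul_F_sub] using hp
  refine h.congr ?_
  rintro _ ⟨p, hp, rfl⟩
  simp only [two_smul_F_sub]
  exact glue_F hg j hp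

theorem normalQuotient_congr {u v : ℝ × ℝ → ℝ} (h : EqOn u v SG) (i : Fin 3) (m : ℕ) :
    normalQuotient u i m = normalQuotient v i m := by
  simp only [normalQuotient, h (q_mem i), h (iterate_F_mem (q_mem _) i m)]

theorem graphLaplacian_congr {u v : ℝ × ℝ → ℝ} (h : EqOn u v SG) (m : ℕ) {x : ℝ × ℝ}
    (hx : x ∈ SG) : graphLaplacian m u x = graphLaplacian m v x := by
  simp only [graphLaplacian, h hx, h (cellMap_mem (q_mem _) _)]

theorem IsHarmonicIn.congr {lam : ℝ} {u v : ℝ × ℝ → ℝ} (hu : IsHarmonicIn lam u)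
    (h : EqOn u v SG) : IsHarmonicIn lam v := fun m x hx hc => by
  rw [← graphLaplacian_congr h m (V_subset_SG m hx.1), hu m x hx hc]

theorem IsHarmonicOnGasket.congr {u v : ℝ × ℝ → ℝ} (hu : IsHarmonicOnGasket u)
    (h : EqOn u v SG) : IsHarmonicOnGasket v := fun m x hx hx0 => by
  rw [← graphLaplacian_congr h m (V_subset_SG m hx), hu m x hx hx0]

/-- Harmonic pieces with matching values and matching normal derivatives can be glued. -/
theorem exists_harmonic_of_pieces {lam : ℝ} (h0 : 0 ≤ lam) (h1 : lam < 1)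
    {g : Fin 3 → ℝ × ℝ → ℝ} (hg : ∀ j k, g j (q k) = g k (q j))
    (hc : ∀ j, ContinuousOn (g j) SG)
    (hcut : ∀ j, IsLetter lam j → IsHarmonicIn (shift lam) (g j))
    (hfull : lam < 1 / 2 → ∀ j ≠ 0, IsHarmonicOnGasket (g j))
    (hmatch : ∀ m, ∀ j k : Fin 3, j < k → CellInside lam (j :: List.replicate m k) →
      CellInside lam (k :: List.replicate m j) →
      normalQuotient (g j) k m + normalQuotient (g k) j m = 0) :
    ∃ h, ContinuousOn h SG ∧ IsHarmonicIn lam h ∧ ∀ j, EqOn (g j) (h ∘ F j) SG := by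
  have he : ∀ j, EqOn (g j) (glue g ∘ F j) SG := fun j p hp => (glue_F hg j hp).symm
  refine ⟨glue g, continuousOn_glue hg hc, isHarmonicIn_of_pieces h0 h1
    (fun j hj => (hcut j hj).congr (he j)) (fun h j hj => (hfull h j hj).congr (he j))
    fun m j k hjk hj hk => ?_, he⟩
  rw [← normalQuotient_congr (he j), ← normalQuotient_congr (he k)]
  rcases lt_or_gt_of_ne hjk with h | h
  · exact hmatch m j k h hj hk
  · rw [add_comm]
    exact hmatch m k j h hk hj

/-! ### Existence of harmonic functions on the whole gasket -/

theorem continuousOn_limUnder {f : ℕ → ℝ × ℝ → ℝ} (hf : ∀ n, ContinuousOn (f n) SG) {C : ℝ}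
    (hd : ∀ n, ∀ p ∈ SG, dist (f n p) (f (n + 1) p) ≤ C * (3 / 5) ^ n) :
    ContinuousOn (fun p => limUnder atTop fun n => f n p) SG ∧
      ∀ p ∈ SG, Tendsto (fun n => f n p) atTop (𝓝 (limUnder atTop fun n => f n p)) := by
  have ht : ∀ p ∈ SG, Tendsto (fun n => f n p) atTop (𝓝 (limUnder atTop fun n => f n p)) :=
    fun p hp => (cauchySeq_of_le_geometric (3 / 5) C (by norm_num) fun n => hd n p hp).tendsto_limUnder
  refine ⟨?_, ht⟩
  have hlim : Tendsto (fun n : ℕ => C * (3 / 5) ^ n / (1 - 3 / 5)) atTop (𝓝 0) := by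
    have := ((tendsto_pow_atTop_nhds_zero_of_lt_one (r := (3 / 5 : ℝ)) (by norm_num)
      (by norm_num)).const_mul C).div_const (1 - 3 / 5)
    simpa using this
  have hu : TendstoUniformlyOn f (fun p => limUnder atTop fun n => f n p) atTop SG := by
    rw [Metric.tendstoUniformlyOn_iff]
    intro ε hε
    filter_upwards [hlim.eventually (gt_mem_nhds hε)] with n hn p hp
    rw [dist_comm]
    exact (dist_le_of_le_geometric_of_tendsto (3 / 5) C (by norm_num)
      (fun n => hd n p hp) (ht p hp) n).trans_lt hn
  exact hu.continuousOn (Frequently.of_forall hf)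

/-- The values at the vertices of the cell `F_j SG` of the harmonic function with values `c` at
`q₀, q₁, q₂`, according to the `1/5`-`2/5` rule. -/
noncomputable def cellValues (j : Fin 3) (c : Fin 3 → ℝ) (k : Fin 3) : ℝ :=
  if k = j then c j else (c j + c k + (c 0 + c 1 + c 2)) / 5

/-- Approximation of level `n` to the harmonic function with values `c` at `q₀, q₁, q₂`: it has the
values of this function at the vertices of level `n` and is affine on the `n`-cells. -/
noncomputable def gasketApprox : ℕ → (Fin 3 → ℝ) → ℝ × ℝ → ℝ
  | 0, c => fun p => ∑ i, c i * bary i p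
  | n + 1, c => glue fun j => gasketApprox n (cellValues j c)

/-- The harmonic function on the gasket with values `c` at `q₀, q₁, q₂`. -/
noncomputable def gasketHarmonic (c : Fin 3 → ℝ) (p : ℝ × ℝ) : ℝ :=
  limUnder atTop fun n => gasketApprox n c p

theorem cellValues_comm (c : Fin 3 → ℝ) (j k : Fin 3) : cellValues j c k = cellValues k c j := by
  unfold cellValues
  by_cases h : k = j
  · subst h; rfl
  · rw [if_neg h, if_neg (Ne.symm h), add_comm (c j)]

theorem gasketApprox_q (n : ℕ) (c : Fin 3 → ℝ) (i : Fin 3) : gasketApprox n c (q i) = c i := by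
  induction n generalizing c i with
  | zero => simp [gasketApprox, bary_q]
  | succ n ih =>
    have h := glue_F (g := fun j => gasketApprox n (cellValues j c))
      (fun j k => by rw [ih, ih, cellValues_comm]) i (q_mem i)
    rw [F_q_self] at h
    simp only [gasketApprox, h, ih]
    simp [cellValues]

theorem gasketApprox_succ_F (n : ℕ) (c : Fin 3 → ℝ) (j : Fin 3) {p : ℝ × ℝ} (hp : p ∈ SG) :
    gasketApprox (n + 1) c (F j p) = gasketApprox n (cellValues j c) p :=
  glue_F (fun j k => by rw [gasketApprox_q, gasketApprox_q, cellValues_comm]) j hp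

theorem continuousOn_gasketApprox (n : ℕ) (c : Fin 3 → ℝ) :
    ContinuousOn (gasketApprox n c) SG := by
  induction n generalizing c with
  | zero =>
    exact (continuous_finsetSum _ fun i _ => (continuous_bary i).const_mul (c i)).continuousOn
  | succ n ih =>
    exact continuousOn_glue (fun j k => by rw [gasketApprox_q, gasketApprox_q, cellValues_comm])
      fun j => ih _

/-- The oscillation on the cells of level one is at most `3/5` of the oscillation. -/
theorem cellValues_mem {c : Fin 3 → ℝ} {lo hi : ℝ} (hc : ∀ i, c i ∈ Icc lo hi) (j k : Fin 3) :
    cellValues j c k ∈ Icc ((2 * c j + 3 * lo) / 5) ((2 * c j + 3 * hi) / 5) := by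
  have h0 := hc 0
  have h1 := hc 1
  have h2 := hc 2
  simp only [mem_Icc] at *
  unfold cellValues
  fin_cases j <;> fin_cases k <;> simp <;> constructor <;> linarith

theorem cellValues_mem' {c : Fin 3 → ℝ} {lo hi : ℝ} (hc : ∀ i, c i ∈ Icc lo hi) (j k : Fin 3) :
    cellValues j c k ∈ Icc lo hi := by
  have h := cellValues_mem hc j k
  have hj := hc j
  simp only [mem_Icc] at *
  constructor <;> linarith

theorem gasketApprox_mem {c : Fin 3 → ℝ} {lo hi : ℝ} (hc : ∀ i, c i ∈ Icc lo hi) (n : ℕ)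
    {p : ℝ × ℝ} (hp : p ∈ SG) : gasketApprox n c p ∈ Icc lo hi := by
  induction n generalizing c p with
  | zero =>
    have h0 := bary_nonneg 0 hp
    have h1 := bary_nonneg 1 hp
    have h2 := bary_nonneg 2 hp
    have hs := bary_sum p
    have hc0 := hc 0
    have hc1 := hc 1
    have hc2 := hc 2
    simp only [gasketApprox, Fin.sum_univ_three, mem_Icc] at *
    have hlo : lo * (bary 0 p + bary 1 p + bary 2 p) = lo := by rw [hs, mul_one]
    have hhi : hi * (bary 0 p + bary 1 p + bary 2 p) = hi := by rw [hs, mul_one]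
    constructor
    · linarith [mul_nonneg h0 (sub_nonneg.2 hc0.1), mul_nonneg h1 (sub_nonneg.2 hc1.1),
        mul_nonneg h2 (sub_nonneg.2 hc2.1)]
    · linarith [mul_nonneg h0 (sub_nonneg.2 hc0.2), mul_nonneg h1 (sub_nonneg.2 hc1.2),
        mul_nonneg h2 (sub_nonneg.2 hc2.2)]
  | succ n ih =>
    obtain ⟨j, p', hp', rfl⟩ := exists_F_eq hp
    rw [gasketApprox_succ_F n c j hp']
    exact ih (cellValues_mem' hc j) hp'

theorem dist_gasketApprox_succ {c : Fin 3 → ℝ} {lo hi : ℝ} (hc : ∀ i, c i ∈ Icc lo hi) (n : ℕ)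
    {p : ℝ × ℝ} (hp : p ∈ SG) :
    dist (gasketApprox n c p) (gasketApprox (n + 1) c p) ≤ (hi - lo) * (3 / 5) ^ n := by
  induction n generalizing c p lo hi with
  | zero =>
    rw [pow_zero, mul_one]
    exact Real.dist_le_of_mem_Icc (gasketApprox_mem hc 0 hp) (gasketApprox_mem hc 1 hp)
  | succ n ih =>
    obtain ⟨j, p', hp', rfl⟩ := exists_F_eq hp
    rw [gasketApprox_succ_F n c j hp', gasketApprox_succ_F (n + 1) c j hp']
    refine (ih (cellValues_mem hc j) hp').trans_eq ?_
    rw [pow_succ]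
    ring

theorem exists_mem_Icc (c : Fin 3 → ℝ) : ∃ lo hi, ∀ i, c i ∈ Icc lo hi := by
  refine ⟨-∑ i, |c i|, ∑ i, |c i|, fun i => ?_⟩
  have h := Finset.single_le_sum (f := fun i => |c i|) (fun i _ => abs_nonneg _) (Finset.mem_univ i)
  exact abs_le.1 h

theorem tendsto_gasketApprox (c : Fin 3 → ℝ) {p : ℝ × ℝ} (hp : p ∈ SG) :
    Tendsto (fun n => gasketApprox n c p) atTop (𝓝 (gasketHarmonic c p)) := by
  obtain ⟨lo, hi, hc⟩ := exists_mem_Icc c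
  exact (continuousOn_limUnder (continuousOn_gasketApprox · c)
    fun n p hp => dist_gasketApprox_succ hc n hp).2 p hp

theorem continuousOn_gasketHarmonic (c : Fin 3 → ℝ) : ContinuousOn (gasketHarmonic c) SG := by
  obtain ⟨lo, hi, hc⟩ := exists_mem_Icc c
  exact (continuousOn_limUnder (continuousOn_gasketApprox · c)
    fun n p hp => dist_gasketApprox_succ hc n hp).1

theorem gasketHarmonic_mem {c : Fin 3 → ℝ} {lo hi : ℝ} (hc : ∀ i, c i ∈ Icc lo hi)
    {p : ℝ × ℝ} (hp : p ∈ SG) : gasketHarmonic c p ∈ Icc lo hi :=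
  isClosed_Icc.mem_of_tendsto (tendsto_gasketApprox c hp)
    (Eventually.of_forall fun n => gasketApprox_mem hc n hp)

theorem gasketHarmonic_q (c : Fin 3 → ℝ) (i : Fin 3) : gasketHarmonic c (q i) = c i := by
  refine tendsto_nhds_unique (tendsto_gasketApprox c (q_mem i)) ?_
  simp only [gasketApprox_q]
  exact tendsto_const_nhds

theorem gasketHarmonic_F (c : Fin 3 → ℝ) (j : Fin 3) :
    EqOn (gasketHarmonic c ∘ F j) (gasketHarmonic (cellValues j c)) SG := fun p hp => by
  refine tendsto_nhds_unique ((tendsto_add_atTop_iff_nat 1).2 (tendsto_gasketApprox c (F_mem hp j)))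
    ?_
  simp only [gasketApprox_succ_F _ c j hp]
  exact tendsto_gasketApprox _ hp

theorem normalQuotient_gasketHarmonic (c : Fin 3 → ℝ) (i : Fin 3) (m : ℕ) :
    normalQuotient (gasketHarmonic c) i m = 3 * c i - (c 0 + c 1 + c 2) := by
  induction m generalizing c with
  | zero => simp only [normalQuotient_zero, gasketHarmonic_q]
  | succ m ih =>
    rw [normalQuotient_succ, normalQuotient_congr (gasketHarmonic_F c i), ih]
    fin_cases i <;> simp [cellValues] <;> ring

theorem isHarmonicOnGasket_gasketHarmonic (c : Fin 3 → ℝ) :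
    IsHarmonicOnGasket (gasketHarmonic c) := by
  intro m
  induction m generalizing c with
  | zero => exact fun x hx hx0 => (hx0 hx).elim
  | succ m ih =>
    intro x hx hx0
    obtain ⟨j, y, hy, rfl⟩ := mem_V_succ.1 hx
    have hyS := V_subset_SG m hy
    by_cases hyq : ∃ k ≠ j, y = q k
    · obtain ⟨k, hkj, rfl⟩ := hyq
      rw [graphLaplacian_F_q_eq_zero_iff hkj.symm, normalQuotient_congr (gasketHarmonic_F c j),
        normalQuotient_congr (gasketHarmonic_F c k), normalQuotient_gasketHarmonic,
        normalQuotient_gasketHarmonic]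
      fin_cases j <;> fin_cases k <;> simp [cellValues] at hkj ⊢ <;> ring
    · push Not at hyq
      rw [graphLaplacian_F hyS j hyq, graphLaplacian_congr (gasketHarmonic_F c j) m hyS]
      refine ih _ y hy ?_
      rintro ⟨k, rfl⟩
      by_cases hkj : k = j
      · subst hkj
        exact hx0 ⟨k, (F_q_self k).symm⟩
      · exact hyq k hkj rfl

/-! ### Harmonic functions that vanish on the cut: dyadic case -/

/-- `h` is harmonic in the lower domain with values `s, t` at `q₁, q₂`, and is continued by zero
to the points of the gasket above the cut. -/
structure IsNullHarmonic (lam s t : ℝ) (h : ℝ × ℝ → ℝ) : Prop where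
  cont : ContinuousOn h SG
  harm : IsHarmonicIn lam h
  apply_q1 : h (q 1) = s
  apply_q2 : h (q 2) = t
  zero : ∀ p ∈ SG, 1 - lam ≤ p.2 → h p = 0

/-- The inequalities satisfied by `a = η₁(λ)` and `b = η₂(λ)`. They are preserved under the recursion
from `Sλ` to `λ`, and for `λ = 0`, where `a = 2` and `b = 1`, the last two are equalities. -/
structure IsCutCoeff (a b : ℝ) : Prop where
  nonneg : 0 ≤ b
  one_le : 1 ≤ a - b
  ratio : a + b ≤ 3 * (a - b)

/-- The Dirichlet problem with data vanishing on the cut is solvable, with normal derivatives at the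
bottom vertices given by the matrix with rows `(a, -b)` and `(-b, a)`. -/
def HasNullSolutions (lam a b : ℝ) : Prop :=
  ∀ s t, ∃ h, IsNullHarmonic lam s t h ∧ HasNormalDeriv h 1 (a * s - b * t) ∧
    HasNormalDeriv h 2 (a * t - b * s)

/-- As `HasNullSolutions`, together with a bound for the solutions near the cut. The factor
`(a - b) (s + t)` is the total flux through the cut. -/
def HasSmallNullSolutions (n : ℕ) (lam a b : ℝ) : Prop :=
  ∀ s t, ∃ h, IsNullHarmonic lam s t h ∧ HasNormalDeriv h 1 (a * s - b * t) ∧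
    HasNormalDeriv h 2 (a * t - b * s) ∧ (0 ≤ s → 0 ≤ t → ∀ p ∈ SG, 1 - lam - (1 / 2) ^ n ≤ p.2 →
      |h p| ≤ (3 / 5) ^ n * ((a - b) * (s + t)))

theorem hasSmallNullSolutions_zero : HasSmallNullSolutions 0 0 2 1 := by
  intro s t
  have hq := gasketHarmonic_q ![0, s, t]
  have hn := normalQuotient_gasketHarmonic ![0, s, t]
  refine ⟨gasketHarmonic ![0, s, t], ⟨continuousOn_gasketHarmonic _,
    (isHarmonicOnGasket_gasketHarmonic _).isHarmonicIn 0, hq 1, hq 2, fun p hp hy => ?_⟩, ?_, ?_,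
    fun hs ht p hp _ => ?_⟩
  · rw [eq_q_of_bary_eq_one (i := 0) hp (by simpa using hy), hq]
    rfl
  · refine tendsto_const_nhds.congr fun m => ?_
    rw [hn 1 m]
    simp
    ring
  · refine tendsto_const_nhds.congr fun m => ?_
    rw [hn 2 m]
    simp
    ring
  · have hc : ∀ i, ![0, s, t] i ∈ Icc 0 (s + t) := fun i => by
      fin_cases i <;> (simp [hs, ht]; try linarith)
    have := gasketHarmonic_mem hc hp
    rw [abs_of_nonneg this.1]
    linarith [this.2]

theorem IsCutCoeff.pos {a b : ℝ} (h : IsCutCoeff a b) : 0 < a := by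
  linarith [h.nonneg, h.one_le]

theorem IsCutCoeff.step_ge {a b : ℝ} (h : IsCutCoeff a b) :
    IsCutCoeff (5 / 3 * (a - b * b / (2 * a))) (5 / 3 * (b * b / (2 * a))) := by
  obtain ⟨hb, h1, hr⟩ := h
  have ha : 0 < a := by linarith
  have hq : b * b / (2 * a) * 2 ≤ a / 4 := by
    rw [div_mul_eq_mul_div, div_le_iff₀ (by positivity)]
    nlinarith
  have hq' : b * b / (2 * a) * 2 ≤ b / 2 := by
    rw [div_mul_eq_mul_div, div_le_iff₀ (by positivity)]
    nlinarith
  exact ⟨by positivity, by linarith, by linarith⟩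

theorem HasSmallNullSolutions.step_ge {lam a b : ℝ} {n : ℕ} (h1 : lam < 1) (h : 1 / 2 ≤ lam)
    (hab : IsCutCoeff a b) (hs : HasSmallNullSolutions n (shift lam) a b) :
    HasSmallNullSolutions (n + 1) lam (5 / 3 * (a - b * b / (2 * a)))
      (5 / 3 * (b * b / (2 * a))) := by
  intro s t
  have h0 : 0 ≤ lam := by linarith
  have hS := shift_of_ge h1 h
  have hS0 := shift_nonneg h0 h1
  have hS1 := shift_lt_one h0 h1
  have ha := hab.pos
  -- the value at the midpoint of the bottom edge, from the matching of normal derivatives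
  set x := b * (s + t) / (2 * a) with hx
  obtain ⟨g₁, hg₁, hd₁, hd₁', hb₁⟩ := hs s x
  obtain ⟨g₂, hg₂, hd₂, hd₂', hb₂⟩ := hs x t
  have hz : ∀ {s t g}, IsNullHarmonic (shift lam) s t g → g (q 0) = 0 := fun hg =>
    hg.zero _ (q_mem 0) (by rw [q_snd, if_pos rfl]; linarith)
  have hcomp : ∀ j k, (![fun _ => 0, g₁, g₂] : Fin 3 → ℝ × ℝ → ℝ) j (q k)
      = (![fun _ => 0, g₁, g₂] : Fin 3 → ℝ × ℝ → ℝ) k (q j) := fun j k => by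
    fin_cases j <;> fin_cases k <;> simp [hz hg₁, hz hg₂, hg₁.apply_q2, hg₂.apply_q1]
  obtain ⟨u, huc, hu, hF⟩ := exists_harmonic_of_pieces h0 h1 (g := ![fun _ => 0, g₁, g₂]) hcomp
    (fun j => by
      fin_cases j
      · exact continuousOn_const
      · exact hg₁.cont
      · exact hg₂.cont)
    (fun j hj => by
      rw [isLetter_of_ge h1 h] at hj
      fin_cases j
      · exact (hj rfl).elim
      · exact hg₁.harm
      · exact hg₂.harm)
    (fun h' => by linarith)
    (fun m j k hjk hj hk => by
      have hj0 : j ≠ 0 := by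
        rintro rfl
        exact not_cellInside_cons h1 h _ hj
      have hk0 : k ≠ 0 := by
        rintro rfl
        exact not_cellInside_cons h1 h _ hk
      obtain ⟨rfl, rfl⟩ : j = 1 ∧ k = 2 := by
        fin_cases j <;> fin_cases k <;> simp at hjk hj0 hk0 ⊢
      rw [cellInside_cons h0 h1 ((isLetter_of_ge h1 h).2 hj0)] at hj
      have hm := pow_half_lt_of_cellInside hS0 hS1 hk0 hj
      have e₁ := tendsto_nhds_unique hd₁'
        (hg₁.harm.hasNormalDeriv_normalQuotient hS0 hS1 (i := 2) (by decide) hm)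
      have e₂ := tendsto_nhds_unique hd₂
        (hg₂.harm.hasNormalDeriv_normalQuotient hS0 hS1 (i := 1) (by decide) hm)
      change normalQuotient g₁ 2 m + normalQuotient g₂ 1 m = 0
      rw [← e₁, ← e₂, hx]
      field_simp
      ring)
  have hF0 : ∀ p ∈ SG, u (F 0 p) = 0 := fun p hp => (hF 0 hp).symm
  have hF1 : ∀ p ∈ SG, u (F 1 p) = g₁ p := fun p hp => (hF 1 hp).symm
  have hF2 : ∀ p ∈ SG, u (F 2 p) = g₂ p := fun p hp => (hF 2 hp).symm
  refine ⟨u, ⟨huc, hu, ?_, ?_, fun p hp hy => ?_⟩, ?_, ?_, fun hs0 ht0 p hp hy => ?_⟩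
  · rw [← F_q_self 1, hF1 _ (q_mem 1), hg₁.apply_q1]
  · rw [← F_q_self 2, hF2 _ (q_mem 2), hg₂.apply_q2]
  · obtain ⟨j, p', hp', rfl⟩ := exists_F_eq hp
    rw [F_snd] at hy
    fin_cases j
    · exact hF0 p' hp'
    · exact (hF1 p' hp').trans (hg₁.zero p' hp' (by simp at hy; linarith))
    · exact (hF2 p' hp').trans (hg₂.zero p' hp' (by simp at hy; linarith))
  · have := HasNormalDeriv.of_comp (hd₁.congr (v := u ∘ F 1) hS1 (by decide) fun p hp => hF 1 hp.1)
    convert this using 1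
    rw [hx]
    field_simp
    ring
  · have := HasNormalDeriv.of_comp (hd₂'.congr (v := u ∘ F 2) hS1 (by decide) fun p hp => hF 2 hp.1)
    convert this using 1
    rw [hx]
    field_simp
    ring
  · have hx0 : 0 ≤ x := by
      have := hab.nonneg
      positivity
    have hδ : 0 ≤ a - b := by linarith [hab.one_le]
    have e : (3 / 5 : ℝ) ^ (n + 1) * ((5 / 3 * (a - b * b / (2 * a)) - 5 / 3 * (b * b / (2 * a)))
        * (s + t)) = (3 / 5) ^ n * ((a - b) * (s + x)) + (3 / 5) ^ n * ((a - b) * (x + t)) := by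
      rw [hx, pow_succ]
      field_simp
      ring
    have e₁ : 0 ≤ (3 / 5 : ℝ) ^ n * ((a - b) * (s + x)) := by positivity
    have e₂ : 0 ≤ (3 / 5 : ℝ) ^ n * ((a - b) * (x + t)) := by positivity
    rw [e]
    obtain ⟨j, p', hp', rfl⟩ := exists_F_eq hp
    rw [F_snd, pow_succ] at hy
    fin_cases j
    · change |u (F 0 p')| ≤ _
      rw [hF0 p' hp', abs_zero]
      linarith
    · change |u (F 1 p')| ≤ _
      rw [hF1 p' hp']
      have := hb₁ hs0 hx0 p' hp' (by simp at hy ⊢; linarith)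
      linarith
    · change |u (F 2 p')| ≤ _
      rw [hF2 p' hp']
      have := hb₂ hx0 ht0 p' hp' (by simp at hy ⊢; linarith)
      linarith

theorem IsCutCoeff.step_lt {a b δ σ : ℝ} (h : IsCutCoeff a b)
    (hδ : δ = 5 * (a - b) / (3 + 2 * (a - b)))
    (hσ : σ = 5 / 3 * (3 + 2 * (a + b)) / (2 + (a + b))) :
    IsCutCoeff ((σ + δ) / 2) ((σ - δ) / 2) := by
  obtain ⟨hb, h1, hr⟩ := h
  have h2 : δ ≤ 5 / 2 := by
    rw [hδ, div_le_iff₀ (by linarith)]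
    linarith
  have h3 : 5 / 2 ≤ σ := by
    rw [hσ, le_div_iff₀ (by linarith)]
    linarith
  have h4 : 1 ≤ δ := by
    rw [hδ, le_div_iff₀ (by linarith)]
    linarith
  have h5 : σ ≤ 3 * δ := by
    rw [hδ, hσ, ← mul_div_assoc, div_le_div_iff₀ (by linarith) (by linarith)]
    nlinarith [mul_nonneg (sub_nonneg.2 h1) (show 0 ≤ a + b by linarith)]
  exact ⟨by linarith, by linarith, by linarith⟩

theorem HasSmallNullSolutions.step_lt {lam a b δ σ : ℝ} {n : ℕ} (h0 : 0 ≤ lam) (h : lam < 1 / 2)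
    (hn : lam ≤ 1 / 2 - (1 / 2) ^ (n + 1))
    (hab : IsCutCoeff a b) (hs : HasSmallNullSolutions n (shift lam) a b)
    (hδ : δ = 5 * (a - b) / (3 + 2 * (a - b)))
    (hσ : σ = 5 / 3 * (3 + 2 * (a + b)) / (2 + (a + b))) :
    HasSmallNullSolutions (n + 1) lam ((σ + δ) / 2) ((σ - δ) / 2) := by
  intro s t
  have h1 : lam < 1 := by linarith
  have hS := shift_of_lt h0 h
  have hS0 := shift_nonneg h0 h1
  have hS1 := shift_lt_one h0 h1
  have hb := hab.nonneg
  have hab1 := hab.one_le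
  have hA : 3 + 2 * (a - b) ≠ 0 := by linarith
  have hB : 2 + (a + b) ≠ 0 := by linarith
  -- the values at the three midpoints, from the matching of normal derivatives
  obtain ⟨A, hA'⟩ : ∃ A, A * (3 + 2 * (a - b)) = 3 := ⟨_, div_mul_cancel₀ 3 hA⟩
  obtain ⟨B, hB'⟩ : ∃ B, B * (2 + (a + b)) = 1 := ⟨_, div_mul_cancel₀ 1 hB⟩
  have hδ' : 3 * δ = 5 * (a - b) * A := by
    rw [hδ, ← mul_div_assoc, div_eq_iff hA]
    linear_combination (-5 * (a - b)) * hA'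
  have hσ' : 3 * σ = 5 * (2 - B) := by
    rw [hσ, ← mul_div_assoc, div_eq_iff hB]
    linear_combination 5 * hB'
  obtain ⟨x₁, hx₁⟩ : ∃ x, x = (A * (s + t) + B * (s - t)) / 2 := ⟨_, rfl⟩
  obtain ⟨x₂, hx₂⟩ : ∃ x, x = (A * (s + t) - B * (s - t)) / 2 := ⟨_, rfl⟩
  obtain ⟨y, hy⟩ : ∃ y, y = (x₁ + x₂ + s + t) / 4 := ⟨_, rfl⟩
  obtain ⟨g₀, hg₀, hd₁, hd₂, hb₀⟩ := hs x₁ x₂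
  have hq₁ := gasketHarmonic_q ![x₁, s, y]
  have hq₂ := gasketHarmonic_q ![x₂, y, t]
  have hn₁ := normalQuotient_gasketHarmonic ![x₁, s, y]
  have hn₂ := normalQuotient_gasketHarmonic ![x₂, y, t]
  have hh₁ := isHarmonicOnGasket_gasketHarmonic ![x₁, s, y]
  have hh₂ := isHarmonicOnGasket_gasketHarmonic ![x₂, y, t]
  have hc₁ := continuousOn_gasketHarmonic ![x₁, s, y]
  have hc₂ := continuousOn_gasketHarmonic ![x₂, y, t]
  generalize gasketHarmonic ![x₁, s, y] = g₁ at *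
  generalize gasketHarmonic ![x₂, y, t] = g₂ at *
  have hcomp : ∀ j k, (![g₀, g₁, g₂] : Fin 3 → ℝ × ℝ → ℝ) j (q k)
      = (![g₀, g₁, g₂] : Fin 3 → ℝ × ℝ → ℝ) k (q j) := fun j k => by
    fin_cases j <;> fin_cases k <;> simp [hq₁, hq₂, hg₀.apply_q1, hg₀.apply_q2]
  obtain ⟨u, huc, hu, hF⟩ := exists_harmonic_of_pieces h0 h1 (g := ![g₀, g₁, g₂]) hcomp
    (fun j => by
      fin_cases j
      · exact hg₀.cont
      · exact hc₁
      · exact hc₂)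
    (fun j hj => by
      rw [isLetter_of_lt h] at hj
      subst hj
      exact hg₀.harm)
    (fun _ j hj => by
      fin_cases j
      · exact (hj rfl).elim
      · exact hh₁
      · exact hh₂)
    (fun m j k hjk hj _ => by
      have hm : j = 0 → (1 / 2 : ℝ) ^ m < 1 - shift lam := by
        rintro rfl
        rw [cellInside_cons h0 h1 ((isLetter_of_lt h).2 rfl)] at hj
        exact pow_half_lt_of_cellInside hS0 hS1 hjk.ne' hj
      fin_cases j <;> fin_cases k <;> simp at hjk
      · have e := tendsto_nhds_unique hd₁
          (hg₀.harm.hasNormalDeriv_normalQuotient hS0 hS1 (i := 1) (by decide) (hm rfl))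
        change normalQuotient g₀ 1 m + normalQuotient g₁ 0 m = 0
        rw [← e, hn₁]
        simp only [Matrix.cons_val]
        rw [hy, hx₁, hx₂]
        linear_combination (s + t) / 4 * hA' + (s - t) / 2 * hB'
      · have e := tendsto_nhds_unique hd₂
          (hg₀.harm.hasNormalDeriv_normalQuotient hS0 hS1 (i := 2) (by decide) (hm rfl))
        change normalQuotient g₀ 2 m + normalQuotient g₂ 0 m = 0
        rw [← e, hn₂]
        simp only [Matrix.cons_val]
        rw [hy, hx₁, hx₂]
        linear_combination (s + t) / 4 * hA' - (s - t) / 2 * hB'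
      · change normalQuotient g₁ 2 m + normalQuotient g₂ 1 m = 0
        rw [hn₁, hn₂]
        simp only [Matrix.cons_val]
        rw [hy]
        ring)
  have hF0 : ∀ p ∈ SG, u (F 0 p) = g₀ p := fun p hp => (hF 0 hp).symm
  have hF1 : ∀ p ∈ SG, u (F 1 p) = g₁ p := fun p hp => (hF 1 hp).symm
  have hF2 : ∀ p ∈ SG, u (F 2 p) = g₂ p := fun p hp => (hF 2 hp).symm
  have hd : ∀ (g : ℝ × ℝ → ℝ) (i : Fin 3) (d : ℝ), (∀ m, normalQuotient g i m = d) →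
      HasNormalDeriv g i d := fun g i d hg => tendsto_const_nhds.congr fun m => (hg m).symm
  -- near the cut only the top cell counts
  have htop : ∀ p ∈ SG, 1 - lam - (1 / 2) ^ (n + 1) ≤ p.2 → ∃ p' ∈ SG, F 0 p' = p := by
    intro p hp hy
    obtain ⟨j, p', hp', rfl⟩ := exists_F_eq hp
    by_cases hj : j = 0
    · exact ⟨p', hp', by rw [hj]⟩
    · rw [F_snd, if_neg hj] at hy
      rw [eq_q_of_bary_eq_one (i := 0) hp' (by rw [bary_zero]; linarith)]
      exact ⟨q j, q_mem j, F_q_comm _ _⟩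
  refine ⟨u, ⟨huc, hu, ?_, ?_, fun p hp hy => ?_⟩, ?_, ?_, fun hs0 ht0 p hp hy => ?_⟩
  · rw [← F_q_self 1, hF1 _ (q_mem 1), hq₁]
    rfl
  · rw [← F_q_self 2, hF2 _ (q_mem 2), hq₂]
    rfl
  · obtain ⟨p', hp', rfl⟩ := htop p hp (by
      have : (0 : ℝ) < (1 / 2) ^ (n + 1) := by positivity
      linarith)
    rw [F_snd, if_pos rfl] at hy
    rw [hF0 p' hp', hg₀.zero p' hp' (by linarith)]
  · have := HasNormalDeriv.of_comp ((hd g₁ 1 _ (hn₁ 1)).congr (v := u ∘ F 1) hS1 (by decide)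
      fun p hp => hF 1 hp.1)
    convert this using 1
    simp only [Matrix.cons_val]
    rw [hy, hx₁, hx₂]
    linear_combination (s + t) / 6 * hδ' + (s - t) / 6 * hσ' + 5 * (s + t) / 12 * hA'
  · have := HasNormalDeriv.of_comp ((hd g₂ 2 _ (hn₂ 2)).congr (v := u ∘ F 2) hS1 (by decide)
      fun p hp => hF 2 hp.1)
    convert this using 1
    simp only [Matrix.cons_val]
    rw [hy, hx₁, hx₂]
    linear_combination (s + t) / 6 * hδ' - (s - t) / 6 * hσ' + 5 * (s + t) / 12 * hA'
  · have hA0 : 0 < A := by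
      by_contra! hA0
      nlinarith
    have hB0 : 0 < B := by
      by_contra! hB0
      nlinarith
    have hAB : B ≤ A := by
      by_contra! hAB
      nlinarith
    have hx₁0 : 0 ≤ x₁ := by
      rw [hx₁]
      nlinarith
    have hx₂0 : 0 ≤ x₂ := by
      rw [hx₂]
      nlinarith
    obtain ⟨p', hp', rfl⟩ := htop p hp hy
    rw [F_snd, if_pos rfl, pow_succ] at hy
    rw [hF0 p' hp']
    refine (hb₀ hx₁0 hx₂0 p' hp' (by linarith)).trans_eq ?_
    rw [hx₁, hx₂, pow_succ]
    linear_combination (-(3 / 5 : ℝ) ^ n / 5 * (s + t)) * hδ'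

theorem exists_hasSmallNullSolutions (n : ℕ) {lam : ℝ} (h0 : 0 ≤ lam) (h1 : lam < 1)
    (hn : IsMultiple lam n) : ∃ a b, IsCutCoeff a b ∧ HasSmallNullSolutions n lam a b := by
  induction n generalizing lam with
  | zero =>
    rw [eq_zero_of_isMultiple_zero h0 h1 hn]
    exact ⟨2, 1, ⟨by norm_num, by norm_num, by norm_num⟩, hasSmallNullSolutions_zero⟩
  | succ n ih =>
    obtain ⟨a, b, hab, hs⟩ :=
      ih (shift_nonneg h0 h1) (shift_lt_one h0 h1) ((isMultiple_shift h0 h1 n).2 hn)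
    rcases lt_or_ge lam (1 / 2) with h | h
    · refine ⟨_, _, hab.step_lt rfl rfl, hs.step_lt h0 h ?_ hab rfl rfl⟩
      obtain ⟨k, rfl⟩ := hn
      have h2 : (0 : ℝ) < 2 ^ n := by positivity
      rw [pow_succ, div_lt_iff₀ (by positivity)] at h
      have hk : k < 2 ^ n := by
        have : (k : ℝ) < 2 ^ n := by linarith
        exact_mod_cast this
      have hk' : (k : ℝ) + 1 ≤ 2 ^ n := by exact_mod_cast hk
      rw [pow_succ, pow_succ, div_le_iff₀ (by positivity), one_div, inv_pow]
      have : ((2 : ℝ) ^ n)⁻¹ * 2 ^ n = 1 := inv_mul_cancel₀ h2.ne'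
      linear_combination hk' + this
    · exact ⟨_, _, hab.step_ge, hs.step_ge h1 h hab⟩

/-! ### Harmonic functions that vanish on the cut: general case -/

theorem IsHarmonicIn.mono {lam mu : ℝ} (h : lam ≤ mu) {u : ℝ × ℝ → ℝ} (hu : IsHarmonicIn lam u) :
    IsHarmonicIn mu u := by
  have hsub : lowerDomain mu ⊆ lowerDomain lam := fun p hp => ⟨hp.1, hp.2.trans_le (by linarith)⟩
  exact fun m x hx hc => hu m x ⟨hx.1, hsub hx.2⟩ fun w hw =>
    (hc w hw).trans (union_subset_union_left _ hsub)

theorem IsNullHarmonic.linear {lam s t s' t' : ℝ} {h h' : ℝ × ℝ → ℝ} (hh : IsNullHarmonic lam s t h)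
    (hh' : IsNullHarmonic lam s' t' h') (c c' : ℝ) :
    IsNullHarmonic lam (c * s + c' * s') (c * t + c' * t') (c • h + c' • h') where
  cont := (hh.cont.const_smul c).add (hh'.cont.const_smul c')
  harm := (hh.harm.const_smul c).add (hh'.harm.const_smul c')
  apply_q1 := by simp [hh.apply_q1, hh'.apply_q1]
  apply_q2 := by simp [hh.apply_q2, hh'.apply_q2]
  zero p hp hy := by simp [hh.zero p hp hy, hh'.zero p hp hy]

theorem IsNullHarmonic.eq_zero_of_mem_cutSet {lam s t : ℝ} {h : ℝ × ℝ → ℝ}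
    (hh : IsNullHarmonic lam s t h) {p : ℝ × ℝ} (hp : p ∈ cutSet lam) : h p = 0 := by
  have := mem_cutSet_iff.1 hp
  exact hh.zero p this.1 this.2.1.ge

theorem IsNullHarmonic.nonneg {lam s t : ℝ} (h0 : 0 ≤ lam) (h1 : lam < 1) {h : ℝ × ℝ → ℝ}
    (hh : IsNullHarmonic lam s t h) (hs : 0 ≤ s) (ht : 0 ≤ t) {p : ℝ × ℝ} (hp : p ∈ SG) :
    0 ≤ h p := by
  rcases lt_or_ge p.2 (1 - lam) with hy | hy
  · exact hh.harm.ge_of_boundary_ge h0 h1 (hh.cont.mono (closedDomain_subset_SG h0 h1))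
      (fun p hp => (hh.eq_zero_of_mem_cutSet hp).ge) (by rw [hh.apply_q1]; exact hs)
      (by rw [hh.apply_q2]; exact ht) p (openPart_subset h0 h1 ⟨hp, hy⟩)
  · exact (hh.zero p hp hy).ge

/-- Comparison of the solutions for two cuts: if that for the higher cut is small at and above the
lower cut, then both are close to each other everywhere. -/
theorem IsNullHarmonic.abs_sub_le {lam mu s t ε : ℝ} (h0 : 0 ≤ mu) (h1 : mu < 1) (h : lam ≤ mu)
    {u v : ℝ × ℝ → ℝ} (hu : IsNullHarmonic lam s t u) (hv : IsNullHarmonic mu s t v)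
    (hε : 0 ≤ ε) (hb : ∀ p ∈ SG, 1 - mu ≤ p.2 → |u p| ≤ ε) {p : ℝ × ℝ} (hp : p ∈ SG) :
    |u p - v p| ≤ ε := by
  rcases lt_or_ge p.2 (1 - mu) with hy | hy
  · have hd := (hu.harm.mono h).add (hv.harm.const_smul (-1))
    have hdc : ContinuousOn (u + (-1 : ℝ) • v) (closedDomain mu) :=
      (hu.cont.add (hv.cont.const_smul (-1 : ℝ))).mono (closedDomain_subset_SG h0 h1)
    have hX : ∀ p ∈ cutSet mu, |(u + (-1 : ℝ) • v) p| ≤ ε := fun p hp => by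
      have hp' := mem_cutSet_iff.1 hp
      simp only [Pi.add_apply, Pi.smul_apply, hv.eq_zero_of_mem_cutSet hp, smul_zero, add_zero]
      exact hb p hp'.1 hp'.2.1.ge
    have hq1 : (u + (-1 : ℝ) • v) (q 1) = 0 := by simp [hu.apply_q1, hv.apply_q1]
    have hq2 : (u + (-1 : ℝ) • v) (q 2) = 0 := by simp [hu.apply_q2, hv.apply_q2]
    have hpc := openPart_subset h0 h1 ⟨hp, hy⟩
    have hle := hd.le_of_boundary_le h0 h1 (C := ε) hdc (fun p hp => (abs_le.1 (hX p hp)).2)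
      (by rw [hq1]; exact hε) (by rw [hq2]; exact hε) p hpc
    have hge := hd.ge_of_boundary_ge h0 h1 (C := -ε) hdc (fun p hp => (abs_le.1 (hX p hp)).1)
      (by rw [hq1]; linarith) (by rw [hq2]; linarith) p hpc
    simp only [Pi.add_apply, Pi.smul_apply, smul_eq_mul] at hle hge
    exact abs_le.2 ⟨by linarith, by linarith⟩
  · rw [hv.zero p hp hy, sub_zero]
    exact hb p hp hy

/-- The binary expansion of `λ`, cut off after `n` digits. -/
noncomputable def truncation (lam : ℝ) (n : ℕ) : ℝ := ⌊2 ^ n * lam⌋ / 2 ^ n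

theorem isMultiple_truncation (lam : ℝ) (n : ℕ) : IsMultiple (truncation lam n) n := ⟨_, rfl⟩

theorem truncation_le (lam : ℝ) (n : ℕ) : truncation lam n ≤ lam := by
  rw [truncation, div_le_iff₀ (by positivity), mul_comm]
  exact Int.floor_le _

theorem le_truncation_add (lam : ℝ) (n : ℕ) : lam ≤ truncation lam n + (1 / 2) ^ n := by
  rw [truncation, one_div, inv_pow, ← one_div, ← add_div, le_div_iff₀ (by positivity), mul_comm]
  exact (Int.lt_floor_add_one _).le

theorem truncation_nonneg {lam : ℝ} (h0 : 0 ≤ lam) (n : ℕ) : 0 ≤ truncation lam n := by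
  have : (0 : ℤ) ≤ ⌊2 ^ n * lam⌋ := Int.floor_nonneg.2 (by positivity)
  rw [truncation]
  positivity

theorem truncation_le_succ (lam : ℝ) (n : ℕ) : truncation lam n ≤ truncation lam (n + 1) := by
  rw [truncation, truncation, div_le_div_iff₀ (by positivity) (by positivity), pow_succ]
  have h : 2 * ⌊2 ^ n * lam⌋ ≤ ⌊2 ^ n * 2 * lam⌋ := by
    rw [Int.le_floor]
    push_cast
    linarith [Int.floor_le (2 ^ n * lam)]
  have h' : (2 * ⌊2 ^ n * lam⌋ : ℝ) ≤ ⌊2 ^ n * 2 * lam⌋ := by exact_mod_cast h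
  have : (0 : ℝ) < 2 ^ n := by positivity
  nlinarith

theorem tendsto_normalQuotient {f : ℕ → ℝ × ℝ → ℝ} {g : ℝ × ℝ → ℝ}
    (hf : ∀ p ∈ SG, Tendsto (fun n => f n p) atTop (𝓝 (g p))) (i : Fin 3) (m : ℕ) :
    Tendsto (fun n => normalQuotient (f n) i m) atTop (𝓝 (normalQuotient g i m)) :=
  ((((hf _ (q_mem i)).const_mul 2).sub (hf _ (iterate_F_mem (q_mem _) i m))).sub
    (hf _ (iterate_F_mem (q_mem _) i m))).const_mul _

theorem tendsto_graphLaplacian {f : ℕ → ℝ × ℝ → ℝ} {g : ℝ × ℝ → ℝ}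
    (hf : ∀ p ∈ SG, Tendsto (fun n => f n p) atTop (𝓝 (g p))) (m : ℕ) {x : ℝ × ℝ} (hx : x ∈ SG) :
    Tendsto (fun n => graphLaplacian m (f n) x) atTop (𝓝 (graphLaplacian m g x)) := by
  refine tendsto_finsetSum _ fun w _ => tendsto_finsetSum _ fun i _ => ?_
  split_ifs
  · exact tendsto_finsetSum _ fun j _ => (hf x hx).sub (hf _ (cellMap_mem (q_mem j) _))
  · exact tendsto_const_nhds

/-- The Dirichlet problem with data vanishing on the cut is solvable: the solutions for the truncated
expansions of `λ` converge uniformly. -/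
theorem exists_hasNullSolutions {lam : ℝ} (h0 : 0 ≤ lam) (h1 : lam < 1) :
    ∃ a b, IsCutCoeff a b ∧ HasNullSolutions lam a b := by
  have hl0 := truncation_nonneg h0
  have hl1 : ∀ n, truncation lam n < 1 := fun n => (truncation_le lam n).trans_lt h1
  choose a b hab hsol using fun n =>
    exists_hasSmallNullSolutions n (hl0 n) (hl1 n) (isMultiple_truncation lam n)
  obtain ⟨k, hk⟩ := exists_pow_half_lt h1
  have hk' : ∀ n, (1 / 2 : ℝ) ^ k < 1 - truncation lam n := fun n => by
    linarith [truncation_le lam n]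
  have hnd : ∀ {n s t h}, IsNullHarmonic (truncation lam n) s t h → ∀ i ≠ 0, ∀ {d},
      HasNormalDeriv h i d → normalQuotient h i k = d := fun hh i hi d hd =>
    tendsto_nhds_unique (hh.harm.hasNormalDeriv_normalQuotient (hl0 _) (hl1 _) hi (hk' _)) hd
  -- the fluxes are bounded, since the normal derivative is a difference quotient of fixed level
  have ha : ∀ n, a n ≤ (5 / 3) ^ k * 2 := fun n => by
    obtain ⟨h, hh, hd, -, -⟩ := hsol n 1 0
    have he := hnd hh 1 (by decide) hd
    rw [mul_one, mul_zero, sub_zero] at he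
    rw [← he, normalQuotient, hh.apply_q1]
    have := hh.nonneg (hl0 n) (hl1 n) zero_le_one le_rfl (iterate_F_mem (q_mem (1 + 1)) 1 k)
    have := hh.nonneg (hl0 n) (hl1 n) zero_le_one le_rfl (iterate_F_mem (q_mem (1 - 1)) 1 k)
    gcongr
    linarith
  -- the limit for fixed nonnegative values at the bottom vertices
  have hlim : ∀ s t, 0 ≤ s → 0 ≤ t → ∃ h, IsNullHarmonic lam s t h ∧
      Tendsto (fun n => a n * s - b n * t) atTop (𝓝 (normalQuotient h 1 k)) ∧
      Tendsto (fun n => a n * t - b n * s) atTop (𝓝 (normalQuotient h 2 k)) := by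
    intro s t hs ht
    choose f hf hd1 hd2 hb using fun n => hsol n s t
    have hb' : ∀ n, ∀ p ∈ SG, 1 - lam ≤ p.2 → |f n p| ≤ (5 / 3) ^ k * 2 * (s + t) * (3 / 5) ^ n := by
      intro n p hp hy
      refine (hb n hs ht p hp (by linarith [le_truncation_add lam n])).trans ?_
      rw [mul_comm]
      have : a n - b n ≤ (5 / 3) ^ k * 2 := by linarith [ha n, (hab n).nonneg]
      gcongr
    have hb'' : ∀ n, ∀ p ∈ SG, 1 - truncation lam (n + 1) ≤ p.2 →
        |f n p| ≤ (5 / 3) ^ k * 2 * (s + t) * (3 / 5) ^ n := fun n p hp hy =>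
      hb' n p hp (by linarith [truncation_le lam (n + 1)])
    have hdist : ∀ n, ∀ p ∈ SG,
        dist (f n p) (f (n + 1) p) ≤ (5 / 3) ^ k * 2 * (s + t) * (3 / 5) ^ n := fun n p hp => by
      rw [Real.dist_eq]
      exact (hf n).abs_sub_le (hl0 _) (hl1 _) (truncation_le_succ lam n) (hf (n + 1)) (by positivity)
        (hb'' n) hp
    obtain ⟨hc, ht⟩ := continuousOn_limUnder (fun n => (hf n).cont) hdist
    set g : ℝ × ℝ → ℝ := fun p => limUnder atTop fun n => f n p
    refine ⟨g, ⟨hc, fun m x hx hin => ?_, ?_, ?_, fun p hp hy => ?_⟩, ?_, ?_⟩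
    · refine tendsto_nhds_unique (tendsto_graphLaplacian ht m (V_subset_SG m hx.1)) ?_
      exact tendsto_const_nhds.congr fun n =>
        ((hf n).harm.mono (truncation_le lam n) m x hx hin).symm
    · exact tendsto_nhds_unique (ht _ (q_mem 1)) (tendsto_const_nhds.congr fun n =>
        (hf n).apply_q1.symm)
    · exact tendsto_nhds_unique (ht _ (q_mem 2)) (tendsto_const_nhds.congr fun n =>
        (hf n).apply_q2.symm)
    · refine tendsto_nhds_unique (ht p hp) (squeeze_zero_norm (fun n => hb' n p hp hy) ?_)
      simpa using (tendsto_pow_atTop_nhds_zero_of_lt_one (r := (3 / 5 : ℝ)) (by norm_num)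
        (by norm_num)).const_mul ((5 / 3) ^ k * 2 * (s + t))
    · exact (tendsto_normalQuotient ht 1 k).congr fun n => hnd (hf n) 1 (by decide) (hd1 n)
    · exact (tendsto_normalQuotient ht 2 k).congr fun n => hnd (hf n) 2 (by decide) (hd2 n)
  obtain ⟨h, hh, ha1, ha2⟩ := hlim 1 0 zero_le_one le_rfl
  obtain ⟨h', hh', hb1, hb2⟩ := hlim 0 1 le_rfl zero_le_one
  simp only [mul_one, mul_zero, sub_zero, zero_sub] at ha1 ha2 hb1 hb2
  have hA : normalQuotient h' 2 k = normalQuotient h 1 k := tendsto_nhds_unique hb2 ha1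
  have hB : normalQuotient h' 1 k = normalQuotient h 2 k := tendsto_nhds_unique hb1 ha2
  have hbl : Tendsto b atTop (𝓝 (-normalQuotient h 2 k)) := by simpa using ha2.neg
  have hd : ∀ {s t h}, IsNullHarmonic lam s t h → ∀ i ≠ 0,
      HasNormalDeriv h i (normalQuotient h i k) := fun hh i hi =>
    hh.harm.hasNormalDeriv_normalQuotient h0 h1 hi hk
  refine ⟨normalQuotient h 1 k, -normalQuotient h 2 k, ⟨?_, ?_, ?_⟩, fun s t => ?_⟩
  · exact ge_of_tendsto' hbl fun n => (hab n).nonneg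
  · exact ge_of_tendsto' (ha1.sub hbl) fun n => (hab n).one_le
  · exact le_of_tendsto_of_tendsto' (ha1.add hbl) ((ha1.sub hbl).const_mul 3) fun n => (hab n).ratio
  · refine ⟨s • h + t • h', by simpa using hh.linear hh' s t, ?_, ?_⟩
    · convert ((hd hh 1 (by decide)).const_smul s).add ((hd hh' 1 (by decide)).const_smul t) using 1
      rw [hB]
      ring
    · convert ((hd hh 2 (by decide)).const_smul s).add ((hd hh' 2 (by decide)).const_smul t) using 1
      rw [hA]
      ring

/-! ### The coefficients `η₁, η₂` -/

/-- A continuous harmonic function on the closed lower domain that vanishes on the cut. -/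
structure IsNullSolution (lam : ℝ) (u : ℝ × ℝ → ℝ) : Prop where
  cont : ContinuousOn u (closedDomain lam)
  harm : IsHarmonicIn lam u
  zero : ∀ p ∈ cutSet lam, u p = 0

theorem IsNullHarmonic.isNullSolution {lam s t : ℝ} (h0 : 0 ≤ lam) (h1 : lam < 1) {h : ℝ × ℝ → ℝ}
    (hh : IsNullHarmonic lam s t h) : IsNullSolution lam h :=
  ⟨hh.cont.mono (closedDomain_subset_SG h0 h1), hh.harm, fun _ hp => hh.eq_zero_of_mem_cutSet hp⟩

theorem IsNullSolution.eqOn {lam : ℝ} (h0 : 0 ≤ lam) (h1 : lam < 1) {u v : ℝ × ℝ → ℝ}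
    (hu : IsNullSolution lam u) (hv : IsNullSolution lam v) (hq1 : u (q 1) = v (q 1))
    (hq2 : u (q 2) = v (q 2)) : EqOn u v (closedDomain lam) :=
  hu.harm.eqOn_of_boundary_eq h0 h1 hu.cont hv.cont hv.harm
    (fun p hp => by rw [hu.zero p hp, hv.zero p hp]) hq1 hq2

theorem vertexData_self (i : Fin 3) : vertexData i (q i) = 1 := if_pos rfl

theorem vertexData_of_ne {i j : Fin 3} (h : j ≠ i) : vertexData i (q j) = 0 :=
  if_neg fun he => h (q_injective he)

theorem vertexData_of_mem_cutSet {lam : ℝ} (h1 : lam < 1) {i : Fin 3} (hi : i ≠ 0) {p : ℝ × ℝ}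
    (hp : p ∈ cutSet lam) : vertexData i p = 0 := by
  refine if_neg ?_
  rintro rfl
  have := (mem_cutSet_iff.1 hp).2.1
  rw [q_snd, if_neg hi] at this
  linarith

theorem isDirichletSolution_vertexData_iff {lam : ℝ} (h1 : lam < 1) {i : Fin 3} (hi : i ≠ 0)
    {u : ℝ × ℝ → ℝ} : IsDirichletSolution lam (vertexData i) u ↔
      IsNullSolution lam u ∧ u (q 1) = vertexData i (q 1) ∧ u (q 2) = vertexData i (q 2) := by
  constructor
  · rintro ⟨hc, hh, he⟩
    refine ⟨⟨hc, hh, fun p hp => ?_⟩, he (by simp [domainBoundary]), he (by simp [domainBoundary])⟩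
    rw [he (Or.inl hp), vertexData_of_mem_cutSet h1 hi hp]
  · rintro ⟨⟨hc, hh, hz⟩, hq1, hq2⟩
    refine ⟨hc, hh, ?_⟩
    rintro p (hp | rfl | rfl)
    · rw [hz p hp, vertexData_of_mem_cutSet h1 hi hp]
    · exact hq1
    · exact hq2

theorem isDirichletSolution_basicHarmonic {lam : ℝ} (h0 : 0 ≤ lam) (h1 : lam < 1) {i : Fin 3}
    (hi : i ≠ 0) : IsDirichletSolution lam (vertexData i) (basicHarmonic lam i) := by
  obtain ⟨a, b, -, hs⟩ := exists_hasNullSolutions h0 h1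
  obtain ⟨h, hh, -, -⟩ := hs (vertexData i (q 1)) (vertexData i (q 2))
  exact Classical.epsilon_spec (p := fun h => IsDirichletSolution lam (vertexData i) h)
    ⟨h, (isDirichletSolution_vertexData_iff h1 hi).2
      ⟨hh.isNullSolution h0 h1, hh.apply_q1, hh.apply_q2⟩⟩

theorem isNullSolution_basicHarmonic {lam : ℝ} (h0 : 0 ≤ lam) (h1 : lam < 1) {i : Fin 3}
    (hi : i ≠ 0) : IsNullSolution lam (basicHarmonic lam i) :=
  ((isDirichletSolution_vertexData_iff h1 hi).1 (isDirichletSolution_basicHarmonic h0 h1 hi)).1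

theorem basicHarmonic_q {lam : ℝ} (h0 : 0 ≤ lam) (h1 : lam < 1) {i j : Fin 3} (hi : i ≠ 0)
    (hj : j ≠ 0) : basicHarmonic lam i (q j) = if j = i then 1 else 0 := by
  have h := ((isDirichletSolution_vertexData_iff h1 hi).1
    (isDirichletSolution_basicHarmonic h0 h1 hi)).2
  have hj' : basicHarmonic lam i (q j) = vertexData i (q j) := by
    fin_cases j
    · exact (hj rfl).elim
    · exact h.1
    · exact h.2
  rw [hj']
  split_ifs with hji
  · rw [hji, vertexData_self]
  · exact vertexData_of_ne hji

theorem IsNullSolution.hasNormalDeriv_of_hasNullSolutions {lam a b : ℝ} (h0 : 0 ≤ lam)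
    (h1 : lam < 1) (hs : HasNullSolutions lam a b) {u : ℝ × ℝ → ℝ} (hu : IsNullSolution lam u) :
    HasNormalDeriv u 1 (a * u (q 1) - b * u (q 2)) ∧
      HasNormalDeriv u 2 (a * u (q 2) - b * u (q 1)) := by
  obtain ⟨h, hh, hd1, hd2⟩ := hs (u (q 1)) (u (q 2))
  have he := ((hh.isNullSolution h0 h1).eqOn h0 h1 hu hh.apply_q1 hh.apply_q2).mono
    (openPart_subset h0 h1)
  exact ⟨hd1.congr h1 (by decide) he, hd2.congr h1 (by decide) he⟩

theorem eta_spec {lam : ℝ} (h0 : 0 ≤ lam) (h1 : lam < 1) :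
    IsCutCoeff (eta1 lam) (eta2 lam) ∧ HasNullSolutions lam (eta1 lam) (eta2 lam) := by
  obtain ⟨a, b, hab, hs⟩ := exists_hasNullSolutions h0 h1
  have hd := (isNullSolution_basicHarmonic h0 h1 (i := 1) (by decide)).hasNormalDeriv_of_hasNullSolutions
    h0 h1 hs
  rw [basicHarmonic_q h0 h1 (by decide) (by decide), basicHarmonic_q h0 h1 (by decide) (by decide)]
    at hd
  have ha : eta1 lam = a := by
    rw [eta1, hd.1.normalDeriv_eq]
    simp
  have hb : eta2 lam = b := by
    rw [eta2, hd.2.normalDeriv_eq]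
    simp
  rw [ha, hb]
  exact ⟨hab, hs⟩

theorem isCutCoeff_eta {lam : ℝ} (h0 : 0 ≤ lam) (h1 : lam < 1) :
    IsCutCoeff (eta1 lam) (eta2 lam) := (eta_spec h0 h1).1

theorem IsNullSolution.normalDeriv_one {lam : ℝ} (h0 : 0 ≤ lam) (h1 : lam < 1) {u : ℝ × ℝ → ℝ}
    (hu : IsNullSolution lam u) :
    normalDeriv u 1 = eta1 lam * u (q 1) - eta2 lam * u (q 2) :=
  (hu.hasNormalDeriv_of_hasNullSolutions h0 h1 (eta_spec h0 h1).2).1.normalDeriv_eq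

theorem IsNullSolution.normalDeriv_two {lam : ℝ} (h0 : 0 ≤ lam) (h1 : lam < 1) {u : ℝ × ℝ → ℝ}
    (hu : IsNullSolution lam u) :
    normalDeriv u 2 = eta1 lam * u (q 2) - eta2 lam * u (q 1) :=
  (hu.hasNormalDeriv_of_hasNullSolutions h0 h1 (eta_spec h0 h1).2).2.normalDeriv_eq

theorem IsHarmonicIn.normalDeriv_comp {lam : ℝ} (h0 : 0 ≤ lam) (h1 : lam < 1)
    {u : ℝ × ℝ → ℝ} (hu : IsHarmonicIn lam u) {i : Fin 3} (hi : i ≠ 0) :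
    normalDeriv u i = 5 / 3 * normalDeriv (u ∘ F i) i := by
  refine HasNormalDeriv.normalDeriv_eq (HasNormalDeriv.of_comp ?_)
  rcases lt_or_ge lam (1 / 2) with h | h
  · have hg := (hu.comp_of_lt h0 h hi).isHarmonicIn 0
    exact hg.hasNormalDeriv le_rfl zero_lt_one hi
  · exact (hu.comp h0 h1 ((isLetter_of_ge h1 h).2 hi)).hasNormalDeriv (shift_nonneg h0 h1)
      (shift_lt_one h0 h1) hi

theorem IsHarmonicOnGasket.normalDeriv_eq {v : ℝ × ℝ → ℝ} (hv : IsHarmonicOnGasket v) (i : Fin 3) :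
    normalDeriv v i = normalQuotient v i 0 :=
  HasNormalDeriv.normalDeriv_eq (tendsto_const_nhds.congr fun m => (hv.normalQuotient_eq i m).symm)

/-- Comparison of `u` with the function that is `-C` on the cut and has the same values as `u` at the
bottom vertices. -/
theorem IsHarmonicIn.normalDeriv_le {lam : ℝ} (h0 : 0 ≤ lam) (h1 : lam < 1) {u : ℝ × ℝ → ℝ}
    (hc : ContinuousOn u (closedDomain lam)) (hu : IsHarmonicIn lam u) {C : ℝ}
    (hC : ∀ p ∈ closedDomain lam, |u p| ≤ C) {i : Fin 3} (hi : i ≠ 0) :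
    normalDeriv u i ≤ 2 * eta1 lam * C := by
  obtain ⟨hη, hs⟩ := eta_spec h0 h1
  obtain ⟨h, hh, hd1, hd2⟩ := hs (u (q 1) + C) (u (q 2) + C)
  have hn := hh.isNullSolution h0 h1
  have hC1 := abs_le.1 (hC _ (openPart_subset h0 h1 (q_mem_openPart h1 (i := 1) (by decide))))
  have hC2 := abs_le.1 (hC _ (openPart_subset h0 h1 (q_mem_openPart h1 (i := 2) (by decide))))
  have hv := (hu.add (isHarmonicIn_const lam C)).add (hh.harm.const_smul (-1))
  have hvc : ContinuousOn (u + (fun _ => C) + (-1 : ℝ) • h) (closedDomain lam) :=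
    (hc.add continuousOn_const).add (hn.cont.const_smul (-1 : ℝ))
  have hpos := hv.ge_of_boundary_ge h0 h1 (C := 0) hvc
    (fun p hp => by
      have := abs_le.1 (hC p (cutSet_subset_closedDomain h0 h1 hp))
      simp only [Pi.add_apply, Pi.smul_apply, hn.zero p hp, smul_zero, add_zero]
      linarith) (by simp [hh.apply_q1]) (by simp [hh.apply_q2])
  have hd0 : HasNormalDeriv (fun _ => C) i 0 := by
    refine tendsto_const_nhds.congr fun m => ?_
    simp only [normalQuotient]
    ring
  have key : ∀ d, HasNormalDeriv h i d → normalDeriv u i ≤ d := fun d hd => by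
    have := (((hu.hasNormalDeriv h0 h1 hi).add hd0).add (hd.const_smul (-1))).nonpos h1 hi
      (fun p hp => hpos p (openPart_subset h0 h1 hp)) (by
        fin_cases i
        · exact (hi rfl).elim
        · simp [hh.apply_q1]
        · simp [hh.apply_q2])
    linarith
  have hb := hη.nonneg
  have ha := hη.pos
  fin_cases i
  · exact (hi rfl).elim
  · refine (key _ hd1).trans ?_
    nlinarith
  · refine (key _ hd2).trans ?_
    nlinarith

/-- The normal derivatives of a harmonic function are bounded by its deviation from a constant. -/
theorem IsHarmonicIn.abs_normalDeriv_le {lam : ℝ} (h0 : 0 ≤ lam) (h1 : lam < 1) {u : ℝ × ℝ → ℝ}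
    (hc : ContinuousOn u (closedDomain lam)) (hu : IsHarmonicIn lam u) {c C : ℝ}
    (hC : ∀ p ∈ closedDomain lam, |u p - c| ≤ C) {i : Fin 3} (hi : i ≠ 0) :
    |normalDeriv u i| ≤ 2 * eta1 lam * C := by
  have hd0 : HasNormalDeriv (fun _ => -c) i 0 := by
    refine tendsto_const_nhds.congr fun m => ?_
    simp only [normalQuotient]
    ring
  have hv := hu.add (isHarmonicIn_const lam (-c))
  have hvc : ContinuousOn (u + fun _ => -c) (closedDomain lam) := hc.add continuousOn_const
  have hd := (hu.hasNormalDeriv h0 h1 hi).add hd0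
  have hvC : ∀ p ∈ closedDomain lam, |(u + fun _ => -c : ℝ × ℝ → ℝ) p| ≤ C := fun p hp => by
    simpa [sub_eq_add_neg] using hC p hp
  have hle := hv.normalDeriv_le h0 h1 hvc hvC hi
  have hge := (hv.const_smul (-1)).normalDeriv_le h0 h1 (C := C) (hvc.const_smul (-1 : ℝ))
    (fun p hp => by simpa only [Pi.smul_apply, neg_smul, one_smul, abs_neg] using hvC p hp) hi
  rw [hd.normalDeriv_eq] at hle
  rw [(hd.const_smul (-1)).normalDeriv_eq] at hge
  exact abs_le.2 ⟨by linarith, by linarith⟩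

/-! ### Green's formula -/

open Classical in
/-- The sum of `G` over the words of length `m` that describe the cells meeting the cut. -/
noncomputable def cutSum (lam : ℝ) (m : ℕ) (G : List (Fin 3) → ℝ) : ℝ :=
  ∑ w : Fin m → Fin 3, if IsCutWord lam w then G (List.ofFn w) else 0

theorem cutSum_zero (lam : ℝ) (G : List (Fin 3) → ℝ) : cutSum lam 0 G = G [] := by
  have h : ∀ w : Fin 0 → Fin 3, IsCutWord lam w := fun w k => k.elim0
  simp [cutSum, h]

theorem isCutWord_cons {lam : ℝ} (h0 : 0 ≤ lam) (h1 : lam < 1) {m : ℕ} (j : Fin 3)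
    (w : Fin m → Fin 3) : IsCutWord lam (Fin.cons j w : Fin (m + 1) → Fin 3) ↔
      IsLetter lam j ∧ IsCutWord (shift lam) w := by
  simp only [IsCutWord, Fin.forall_fin_succ, Fin.cons_zero, Fin.cons_succ, Fin.val_zero,
    Fin.val_succ, ← binDigit_shift h0 h1]
  rfl

open Classical in
theorem cutSum_succ {lam : ℝ} (h0 : 0 ≤ lam) (h1 : lam < 1) (m : ℕ) (G : List (Fin 3) → ℝ) :
    cutSum lam (m + 1) G =
      ∑ j, if IsLetter lam j then cutSum (shift lam) m fun w => G (j :: w) else 0 := by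
  unfold cutSum
  rw [sum_cons]
  refine Finset.sum_congr rfl fun j _ => ?_
  split_ifs with hj
  · simp [isCutWord_cons h0 h1, hj]
  · simp [isCutWord_cons h0 h1, hj]

theorem cutSum_succ_of_lt {lam : ℝ} (h0 : 0 ≤ lam) (h : lam < 1 / 2) (m : ℕ)
    (G : List (Fin 3) → ℝ) :
    cutSum lam (m + 1) G = cutSum (shift lam) m fun w => G (0 :: w) := by
  simp [cutSum_succ h0 (by linarith), isLetter_of_lt h]

theorem cutSum_succ_of_ge {lam : ℝ} (h1 : lam < 1) (h : 1 / 2 ≤ lam) (m : ℕ)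
    (G : List (Fin 3) → ℝ) :
    cutSum lam (m + 1) G = (cutSum (shift lam) m fun w => G (1 :: w)) +
      cutSum (shift lam) m fun w => G (2 :: w) := by
  simp [cutSum_succ (by linarith : 0 ≤ lam) h1, isLetter_of_ge h1 h, Fin.sum_univ_three]

/-- The energy form of level `m` of the whole gasket. -/
noncomputable def gasketEnergy (m : ℕ) (u v : ℝ × ℝ → ℝ) : ℝ :=
  (5 / 3 : ℝ) ^ m * ∑ w : Fin m → Fin 3, ∑ i : Fin 3, ∑ j : Fin 3, if i < j then
    (u (cellMap (List.ofFn w) (q i)) - u (cellMap (List.ofFn w) (q j))) *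
      (v (cellMap (List.ofFn w) (q i)) - v (cellMap (List.ofFn w) (q j))) else 0

theorem gasketEnergy_succ (m : ℕ) (u v : ℝ × ℝ → ℝ) :
    gasketEnergy (m + 1) u v = 5 / 3 * ∑ j, gasketEnergy m (u ∘ F j) (v ∘ F j) := by
  have h := sum_words_succ m fun w => ∑ i : Fin 3, ∑ j : Fin 3, if i < j then
    (u (cellMap w (q i)) - u (cellMap w (q j))) * (v (cellMap w (q i)) - v (cellMap w (q j))) else 0
  rw [gasketEnergy, h]
  simp only [gasketEnergy, ← Finset.mul_sum, cellMap_cons, Function.comp]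
  rw [pow_succ]
  ring

theorem gasketEnergy_eq {u : ℝ × ℝ → ℝ} (hu : IsHarmonicOnGasket u) (m : ℕ) (v : ℝ × ℝ → ℝ) :
    gasketEnergy m v u = ∑ i, v (q i) * normalQuotient u i 0 := by
  induction m generalizing u v with
  | zero =>
    simp [gasketEnergy, Fin.sum_univ_three, normalQuotient_zero]
    ring
  | succ m ih =>
    rw [gasketEnergy_succ]
    simp only [fun j => ih (hu.comp j) (v ∘ F j)]
    have h01 := hu.matching (j := 0) (k := 1) (by decide)
    have h02 := hu.matching (j := 0) (k := 2) (by decide)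
    have h12 := hu.matching (j := 1) (k := 2) (by decide)
    have hq := fun i => (normalQuotient_succ u i 0).symm.trans (hu.normalQuotient_eq i 1)
    simp only [Fin.sum_univ_three, ← hq, Function.comp_apply, F_q_self, F_q_comm 1 0, F_q_comm 2 0,
      F_q_comm 2 1]
    linear_combination (5 / 3 * v (F 0 (q 1))) * h01 + (5 / 3 * v (F 0 (q 2))) * h02
      + (5 / 3 * v (F 1 (q 2))) * h12

open Classical in
theorem domainEnergy_succ (lam : ℝ) (m : ℕ) (u v : ℝ × ℝ → ℝ) :
    domainEnergy lam (m + 1) u v = 5 / 3 * ∑ k : Fin 3, (5 / 3 : ℝ) ^ m * ∑ w : Fin m → Fin 3,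
      if CellInside lam (k :: List.ofFn w) then ∑ i : Fin 3, ∑ j : Fin 3, if i < j then
        ((u ∘ F k) (cellMap (List.ofFn w) (q i)) - (u ∘ F k) (cellMap (List.ofFn w) (q j))) *
          ((v ∘ F k) (cellMap (List.ofFn w) (q i)) - (v ∘ F k) (cellMap (List.ofFn w) (q j)))
      else 0 else 0 := by
  have h := sum_words_succ m fun w => if CellInside lam w then
    ∑ i : Fin 3, ∑ j : Fin 3, if i < j then
    (u (cellMap w (q i)) - u (cellMap w (q j))) * (v (cellMap w (q i)) - v (cellMap w (q j))) else 0
    else 0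
  rw [domainEnergy, h]
  simp only [← Finset.mul_sum, cellMap_cons, Function.comp]
  rw [pow_succ]
  ring

open Classical in
theorem domainEnergy_succ_of_lt {lam : ℝ} (h0 : 0 ≤ lam) (h : lam < 1 / 2) (m : ℕ)
    (u v : ℝ × ℝ → ℝ) :
    domainEnergy lam (m + 1) u v = 5 / 3 * (domainEnergy (shift lam) m (u ∘ F 0) (v ∘ F 0) +
      gasketEnergy m (u ∘ F 1) (v ∘ F 1) + gasketEnergy m (u ∘ F 2) (v ∘ F 2)) := by
  rw [domainEnergy_succ, Fin.sum_univ_three]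
  have e := fun w : List (Fin 3) => propext
    (cellInside_cons h0 (by linarith : lam < 1) ((isLetter_of_lt h).2 rfl) w)
  simp only [e, cellInside_cons_of_lt h0 h (j := 1) (by decide), cellInside_cons_of_lt h0 h (j := 2) (by decide),
    if_true]
  rfl

open Classical in
theorem domainEnergy_succ_of_ge {lam : ℝ} (h1 : lam < 1) (h : 1 / 2 ≤ lam) (m : ℕ)
    (u v : ℝ × ℝ → ℝ) :
    domainEnergy lam (m + 1) u v = 5 / 3 * (domainEnergy (shift lam) m (u ∘ F 1) (v ∘ F 1) +
      domainEnergy (shift lam) m (u ∘ F 2) (v ∘ F 2)) := by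
  have h0 : 0 ≤ lam := by linarith
  rw [domainEnergy_succ, Fin.sum_univ_three]
  have e₁ := fun w : List (Fin 3) => propext
    (cellInside_cons h0 h1 ((isLetter_of_ge h1 h).2 (show (1 : Fin 3) ≠ 0 by decide)) w)
  have e₂ := fun w : List (Fin 3) => propext
    (cellInside_cons h0 h1 ((isLetter_of_ge h1 h).2 (show (2 : Fin 3) ≠ 0 by decide)) w)
  simp only [e₁, e₂, not_cellInside_cons h1 h, if_false, Finset.sum_const_zero, mul_zero, zero_add]
  rfl

theorem domainEnergy_comm (lam : ℝ) (m : ℕ) (u v : ℝ × ℝ → ℝ) :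
    domainEnergy lam m u v = domainEnergy lam m v u := by
  simp only [domainEnergy, mul_comm]

/-- The boundary term of Green's formula at the bottom vertices. -/
noncomputable def bottomPairing (v u : ℝ × ℝ → ℝ) : ℝ :=
  v (q 1) * normalDeriv u 1 + v (q 2) * normalDeriv u 2

/-- Green's formula on the union of the `m`-cells inside the domain. The boundary terms at the lower
vertices of the cells meeting the cut are written as normal derivatives on the parts of these cells
below the cut. -/
theorem IsHarmonicIn.domainEnergy_eq {lam : ℝ} (h0 : 0 ≤ lam) (h1 : lam < 1) {u : ℝ × ℝ → ℝ}
    (hu : IsHarmonicIn lam u) (m : ℕ) (v : ℝ × ℝ → ℝ) :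
    domainEnergy lam m v u = bottomPairing v u -
      (5 / 3) ^ m * cutSum lam m fun w => bottomPairing (v ∘ cellMap w) (u ∘ cellMap w) := by
  induction m generalizing lam u v with
  | zero =>
    have hnot : ∀ w : Fin 0 → Fin 3, ¬ CellInside lam (List.ofFn w) := fun w => by
      rw [cellInside_iff h0 h1, List.ofFn_zero, cellMap_nil, q_snd, if_pos rfl]
      linarith
    rw [cutSum_zero, domainEnergy]
    simp only [hnot, if_false, Finset.sum_const_zero, mul_zero, pow_zero, one_mul]
    exact (sub_self _).symm
  | succ m ih =>
    have hS0 := shift_nonneg h0 h1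
    have hS1 := shift_lt_one h0 h1
    have hd1 := hu.normalDeriv_comp h0 h1 (i := 1) (by decide)
    have hd2 := hu.normalDeriv_comp h0 h1 (i := 2) (by decide)
    have hcons : ∀ (j : Fin 3) (g : ℝ × ℝ → ℝ), (fun w => g ∘ cellMap (j :: w))
        = fun w => (g ∘ F j) ∘ cellMap w := fun _ _ => rfl
    rcases lt_or_ge lam (1 / 2) with h | h
    · have hc0 := hu.comp h0 h1 ((isLetter_of_lt h).2 rfl)
      have hc1 := hu.comp_of_lt h0 h (j := 1) (by decide)
      have hc2 := hu.comp_of_lt h0 h (j := 2) (by decide)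
      rw [domainEnergy_succ_of_lt h0 h, cutSum_succ_of_lt h0 h, ih hS0 hS1 hc0,
        gasketEnergy_eq hc1, gasketEnergy_eq hc2]
      have hm1 := hu.matching_of_lt h0 h (i := 1) (by decide)
      have hm2 := hu.matching_of_lt h0 h (i := 2) (by decide)
      have hm := hu.matching_bottom_of_lt h0 h
      rw [hc1.normalDeriv_eq] at hd1
      rw [hc2.normalDeriv_eq] at hd2
      change _ = _ - _ * cutSum (shift lam) m fun w =>
        bottomPairing ((v ∘ F 0) ∘ cellMap w) ((u ∘ F 0) ∘ cellMap w)
      simp only [bottomPairing, hd1, hd2, Fin.sum_univ_three, Function.comp_apply (f := v), F_q_self,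
        F_q_comm 1 0, F_q_comm 2 0, F_q_comm 2 1, pow_succ]
      linear_combination (5 / 3 * v (F 0 (q 1))) * hm1 + (5 / 3 * v (F 0 (q 2))) * hm2
        + (5 / 3 * v (F 1 (q 2))) * hm
    · have hc1 := hu.comp h0 h1 ((isLetter_of_ge h1 h).2 (show (1 : Fin 3) ≠ 0 by decide))
      have hc2 := hu.comp h0 h1 ((isLetter_of_ge h1 h).2 (show (2 : Fin 3) ≠ 0 by decide))
      rw [domainEnergy_succ_of_ge h1 h, cutSum_succ_of_ge h1 h, ih hS0 hS1 hc1, ih hS0 hS1 hc2]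
      have hm := hu.matching_of_ge h0 h1 h
      change _ = _ - _ * ((cutSum (shift lam) m fun w =>
        bottomPairing ((v ∘ F 1) ∘ cellMap w) ((u ∘ F 1) ∘ cellMap w)) +
        cutSum (shift lam) m fun w =>
          bottomPairing ((v ∘ F 2) ∘ cellMap w) ((u ∘ F 2) ∘ cellMap w))
      simp only [bottomPairing, hd1, hd2, Function.comp_apply (f := v), F_q_self, F_q_comm 2 1,
        pow_succ]
      linear_combination (5 / 3 * v (F 1 (q 2))) * hm

/-! ### Cells meeting the cut -/

/-- Words describing the cells that meet the cut, as a predicate on lists. In the following, the cells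
that meet the cut are those described by such words; a cell that touches a dyadic cut from above at
its lower corners is not counted. -/
def CutWord : ℝ → List (Fin 3) → Prop
  | _, [] => True
  | lam, j :: w => IsLetter lam j ∧ CutWord (shift lam) w

theorem isCutWord_iff {lam : ℝ} (h0 : 0 ≤ lam) (h1 : lam < 1) {m : ℕ} (w : Fin m → Fin 3) :
    IsCutWord lam w ↔ CutWord lam (List.ofFn w) := by
  induction m generalizing lam with
  | zero =>
    rw [List.ofFn_zero]
    exact iff_of_true (fun k => k.elim0) trivial
  | succ m ih =>
    rw [← Fin.cons_self_tail w, isCutWord_cons h0 h1, ih (shift_nonneg h0 h1) (shift_lt_one h0 h1),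
      List.ofFn_succ]
    simp only [Fin.cons_zero, Fin.cons_succ]
    rfl

/-- `S^{|w|} λ`. -/
noncomputable def shiftBy (lam : ℝ) (w : List (Fin 3)) : ℝ := shift^[w.length] lam

theorem shiftBy_cons (lam : ℝ) (j : Fin 3) (w : List (Fin 3)) :
    shiftBy lam (j :: w) = shiftBy (shift lam) w := rfl

theorem shiftBy_nonneg_lt_one {lam : ℝ} (h0 : 0 ≤ lam) (h1 : lam < 1) (w : List (Fin 3)) :
    0 ≤ shiftBy lam w ∧ shiftBy lam w < 1 := by
  induction w generalizing lam with
  | nil => exact ⟨h0, h1⟩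
  | cons j w ih => exact ih (shift_nonneg h0 h1) (shift_lt_one h0 h1)

theorem CutWord.cellMap_mem_closedDomain {lam : ℝ} (h0 : 0 ≤ lam) (h1 : lam < 1)
    {w : List (Fin 3)} (hw : CutWord lam w) {p : ℝ × ℝ} (hp : p ∈ closedDomain (shiftBy lam w)) :
    cellMap w p ∈ closedDomain lam := by
  induction w generalizing lam with
  | nil => exact hp
  | cons j w ih =>
    exact F_mem_closedDomain h0 h1 hw.1 (ih (shift_nonneg h0 h1) (shift_lt_one h0 h1) hw.2 hp)

theorem CutWord.cellMap_mem_cutSet_iff {lam : ℝ} (h0 : 0 ≤ lam) (h1 : lam < 1)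
    {w : List (Fin 3)} (hw : CutWord lam w) {p : ℝ × ℝ} (hp : p ∈ SG) :
    cellMap w p ∈ cutSet lam ↔ p ∈ cutSet (shiftBy lam w) := by
  induction w generalizing lam with
  | nil => exact Iff.rfl
  | cons j w ih =>
    rw [cellMap_cons, F_mem_cutSet_iff h0 h1 hw.1 (cellMap_mem hp w),
      ih (shift_nonneg h0 h1) (shift_lt_one h0 h1) hw.2, shiftBy_cons]

theorem CutWord.isHarmonicIn {lam : ℝ} (h0 : 0 ≤ lam) (h1 : lam < 1)
    {w : List (Fin 3)} (hw : CutWord lam w) {u : ℝ × ℝ → ℝ} (hu : IsHarmonicIn lam u) :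
    IsHarmonicIn (shiftBy lam w) (u ∘ cellMap w) := by
  induction w generalizing lam u with
  | nil => exact hu
  | cons j w ih =>
    rw [shiftBy_cons]
    exact ih (shift_nonneg h0 h1) (shift_lt_one h0 h1) hw.2 (u := u ∘ F j) (hu.comp h0 h1 hw.1)

theorem CutWord.continuousOn {lam : ℝ} (h0 : 0 ≤ lam) (h1 : lam < 1)
    {w : List (Fin 3)} (hw : CutWord lam w) {u : ℝ × ℝ → ℝ}
    (hu : ContinuousOn u (closedDomain lam)) :
    ContinuousOn (u ∘ cellMap w) (closedDomain (shiftBy lam w)) :=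
  hu.comp (continuous_cellMap w).continuousOn fun _ hp => hw.cellMap_mem_closedDomain h0 h1 hp

theorem CutWord.isNullSolution {lam : ℝ} (h0 : 0 ≤ lam) (h1 : lam < 1)
    {w : List (Fin 3)} (hw : CutWord lam w) {u : ℝ × ℝ → ℝ} (hu : IsNullSolution lam u) :
    IsNullSolution (shiftBy lam w) (u ∘ cellMap w) :=
  ⟨hw.continuousOn h0 h1 hu.cont, hw.isHarmonicIn h0 h1 hu.harm, fun _ hp =>
    hu.zero _ ((hw.cellMap_mem_cutSet_iff h0 h1 (cutSet_subset_SG _ hp)).2 hp)⟩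

theorem CutWord.of_append {lam : ℝ} {v t : List (Fin 3)} (h : CutWord lam (v ++ t)) :
    CutWord lam v := by
  induction v generalizing lam with
  | nil => trivial
  | cons j v ih => exact ⟨h.1, ih h.2⟩

theorem cellMap_append (v t : List (Fin 3)) (p : ℝ × ℝ) :
    cellMap (v ++ t) p = cellMap v (cellMap t p) := by
  induction v with
  | nil => rfl
  | cons j v ih => rw [List.cons_append, cellMap_cons, ih, cellMap_cons]

/-- The pieces of the cut in different cells of the same level are disjoint: two neighbouring cells
that meet the cut have only a point below it in common. -/
theorem CutWord.eq_of_mem {lam : ℝ} (h0 : 0 ≤ lam) (h1 : lam < 1) {w w' : List (Fin 3)}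
    (hw : CutWord lam w) (hw' : CutWord lam w') (hl : w.length = w'.length) {p : ℝ × ℝ}
    (hp : p ∈ cutPiece lam w) (hp' : p ∈ cutPiece lam w') : w = w' := by
  induction w generalizing lam w' p with
  | nil => exact (List.length_eq_zero_iff.1 hl.symm).symm
  | cons j w ih =>
    cases w' with
    | nil => simp at hl
    | cons j' w' =>
      obtain ⟨⟨a, ha, hpa⟩, hX⟩ := hp
      obtain ⟨⟨b, hb, hpb⟩, -⟩ := hp'
      rw [cellMap_cons] at hpa hpb
      have hX' : cellMap w a ∈ cutSet (shift lam) := by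
        rwa [← F_mem_cutSet_iff h0 h1 hw.1 (cellMap_mem ha w), hpa]
      by_cases hj : j = j'
      · subst hj
        have he : cellMap w a = cellMap w' b := F_injective j (hpa.trans hpb.symm)
        rw [ih (shift_nonneg h0 h1) (shift_lt_one h0 h1) hw.2 hw'.2 (by simpa using hl)
          ⟨⟨a, ha, rfl⟩, hX'⟩ ⟨⟨b, hb, he.symm⟩, hX'⟩]
      · exfalso
        have he := (eq_of_F_eq hj (cellMap_mem ha w) (cellMap_mem hb w') (hpa.trans hpb.symm)).1
        have hj0 : j' ≠ 0 := by
          rcases lt_or_ge lam (1 / 2) with h | h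
          · rw [(isLetter_of_lt h).1 hw.1, (isLetter_of_lt h).1 hw'.1] at hj
            exact absurd rfl hj
          · exact (isLetter_of_ge h1 h).1 hw'.1
        have hy := (mem_cutSet_iff.1 hX').2.1
        rw [he, q_snd, if_neg hj0] at hy
        linarith [shift_lt_one h0 h1]

theorem exists_cutWord {lam : ℝ} (h0 : 0 ≤ lam) (h1 : lam < 1) (m : ℕ) {p : ℝ × ℝ}
    (hp : p ∈ cutSet lam) : ∃ w, w.length = m ∧ CutWord lam w ∧ p ∈ cutPiece lam w := by
  induction m generalizing lam p with
  | zero => exact ⟨[], rfl, trivial, ⟨p, cutSet_subset_SG _ hp, rfl⟩, hp⟩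
  | succ m ih =>
    obtain ⟨j, hj, p', hp', rfl⟩ := exists_of_mem_cutSet h0 h1 hp
    obtain ⟨w, hw, hwc, ⟨a, ha, rfl⟩, -⟩ := ih (shift_nonneg h0 h1) (shift_lt_one h0 h1) hp'
    exact ⟨j :: w, by simp [hw], ⟨hj, hwc⟩, ⟨a, ha, rfl⟩, hp⟩

theorem CutWord.cutPiece_nonempty {lam : ℝ} (h0 : 0 ≤ lam) (h1 : lam < 1) {w : List (Fin 3)}
    (hw : CutWord lam w) : (cutPiece lam w).Nonempty := by
  obtain ⟨hS0, hS1⟩ := shiftBy_nonneg_lt_one h0 h1 w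
  obtain ⟨p, hp⟩ := cutSet_nonempty hS0 hS1
  have hpS := cutSet_subset_SG _ hp
  exact ⟨cellMap w p, ⟨p, hpS, rfl⟩, (hw.cellMap_mem_cutSet_iff h0 h1 hpS).2 hp⟩

theorem isClosed_cell (w : List (Fin 3)) : IsClosed (cellMap w '' SG) :=
  (isCompact_SG.image (continuous_cellMap w)).isClosed

theorem isClosed_cutPiece {lam : ℝ} (h0 : 0 ≤ lam) (h1 : lam < 1) (w : List (Fin 3)) :
    IsClosed (cutPiece lam w) := (isClosed_cell w).inter (isCompact_cutSet h0 h1).isClosed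

/-! ### The flux through the pieces of the cut -/

/-- The total normal derivative at the bottom vertices. By Green's formula, this is the flux through
the cut. -/
noncomputable def flux (u : ℝ × ℝ → ℝ) : ℝ := normalDeriv u 1 + normalDeriv u 2

/-- Conservation of flux: Green's formula for the constant function `1`. -/
theorem IsHarmonicIn.cutSum_flux {lam : ℝ} (h0 : 0 ≤ lam) (h1 : lam < 1) {u : ℝ × ℝ → ℝ}
    (hu : IsHarmonicIn lam u) (m : ℕ) :
    (5 / 3) ^ m * cutSum lam m (fun w => flux (u ∘ cellMap w)) = flux u := by
  have h := hu.domainEnergy_eq h0 h1 m fun _ => 1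
  have hz : domainEnergy lam m (fun _ => 1) u = 0 := by
    simp [domainEnergy]
  have hb : ∀ u : ℝ × ℝ → ℝ, bottomPairing (fun _ => 1) u = flux u := fun u => by
    simp [bottomPairing, flux]
  rw [hz, hb] at h
  change 0 = flux u - _ * cutSum lam m fun w => bottomPairing (fun _ => 1) (u ∘ cellMap w) at h
  simp only [hb] at h
  linarith

theorem IsNullSolution.flux_eq {lam : ℝ} (h0 : 0 ≤ lam) (h1 : lam < 1) {h : ℝ × ℝ → ℝ}
    (hh : IsNullSolution lam h) : flux h = (eta1 lam - eta2 lam) * (h (q 1) + h (q 2)) := by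
  rw [flux, hh.normalDeriv_one h0 h1, hh.normalDeriv_two h0 h1]
  ring

/-- A null solution with nonnegative values. -/
structure IsNonnegNullSolution (lam : ℝ) (h : ℝ × ℝ → ℝ) : Prop extends IsNullSolution lam h where
  q1_nonneg : 0 ≤ h (q 1)
  q2_nonneg : 0 ≤ h (q 2)

theorem IsNonnegNullSolution.nonneg {lam : ℝ} (h0 : 0 ≤ lam) (h1 : lam < 1) {h : ℝ × ℝ → ℝ}
    (hh : IsNonnegNullSolution lam h) {p : ℝ × ℝ} (hp : p ∈ closedDomain lam) : 0 ≤ h p :=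
  hh.harm.ge_of_boundary_ge h0 h1 hh.cont (fun p hp => (hh.zero p hp).ge) hh.q1_nonneg hh.q2_nonneg
    p hp

theorem CutWord.isNonnegNullSolution {lam : ℝ} (h0 : 0 ≤ lam) (h1 : lam < 1)
    {w : List (Fin 3)} (hw : CutWord lam w) {h : ℝ × ℝ → ℝ} (hh : IsNonnegNullSolution lam h) :
    IsNonnegNullSolution (shiftBy lam w) (h ∘ cellMap w) := by
  obtain ⟨hS0, hS1⟩ := shiftBy_nonneg_lt_one h0 h1 w
  have hq : ∀ i ≠ 0, 0 ≤ (h ∘ cellMap w) (q i) := fun i hi => hh.nonneg h0 h1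
    (hw.cellMap_mem_closedDomain h0 h1 (openPart_subset hS0 hS1 (q_mem_openPart hS1 hi)))
  exact ⟨hw.isNullSolution h0 h1 hh.toIsNullSolution, hq 1 (by decide), hq 2 (by decide)⟩

theorem IsNonnegNullSolution.flux_nonneg {lam : ℝ} (h0 : 0 ≤ lam) (h1 : lam < 1) {h : ℝ × ℝ → ℝ}
    (hh : IsNonnegNullSolution lam h) : 0 ≤ flux h := by
  rw [hh.flux_eq h0 h1]
  have := (isCutCoeff_eta h0 h1).one_le
  have := hh.q1_nonneg
  have := hh.q2_nonneg
  exact mul_nonneg (by linarith) (by linarith)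

theorem IsNonnegNullSolution.abs_normalDeriv_add_le {lam : ℝ} (h0 : 0 ≤ lam) (h1 : lam < 1)
    {h : ℝ × ℝ → ℝ} (hh : IsNonnegNullSolution lam h) :
    |normalDeriv h 1| + |normalDeriv h 2| ≤ 3 * flux h := by
  have hη := isCutCoeff_eta h0 h1
  have hb := hη.nonneg
  have ha := hη.pos
  have hs := hh.q1_nonneg
  have ht := hh.q2_nonneg
  rw [hh.flux_eq h0 h1, hh.normalDeriv_one h0 h1, hh.normalDeriv_two h0 h1]
  have e1 := abs_sub (eta1 lam * h (q 1)) (eta2 lam * h (q 2))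
  have e2 := abs_sub (eta1 lam * h (q 2)) (eta2 lam * h (q 1))
  rw [abs_of_nonneg (mul_nonneg ha.le hs), abs_of_nonneg (mul_nonneg hb ht)] at e1
  rw [abs_of_nonneg (mul_nonneg ha.le ht), abs_of_nonneg (mul_nonneg hb hs)] at e2
  have := mul_le_mul_of_nonneg_right hη.ratio (add_nonneg hs ht)
  linarith

/-- The letter matrices describe how the normal derivatives of a null solution pass to its pieces in
the cells of level one. -/
theorem IsNullSolution.letterMatrix_mulVec {lam : ℝ} (h0 : 0 ≤ lam) (h1 : lam < 1)
    {h : ℝ × ℝ → ℝ} (hh : IsNullSolution lam h) {j : Fin 3} (hj : IsLetter lam j) :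
    (letterMatrix lam j).mulVec ![normalDeriv h 1, normalDeriv h 2] =
      (5 / 3 : ℝ) • ![normalDeriv (h ∘ F j) 1, normalDeriv (h ∘ F j) 2] := by
  have hS0 := shift_nonneg h0 h1
  have hS1 := shift_lt_one h0 h1
  have hη := isCutCoeff_eta hS0 hS1
  have ha := hη.pos
  have hb := hη.nonneg
  have hd1 := hh.harm.normalDeriv_comp h0 h1 (i := 1) (by decide)
  have hd2 := hh.harm.normalDeriv_comp h0 h1 (i := 2) (by decide)
  have hpiece : ∀ j, IsLetter lam j → IsNullSolution (shift lam) (h ∘ F j) := fun j hj =>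
    CutWord.isNullSolution h0 h1 (w := [j]) ⟨hj, trivial⟩ hh
  rcases lt_or_ge lam (1 / 2) with hl | hl
  · rw [isLetter_of_lt hl] at hj
    subst hj
    have hn := hpiece 0 ((isLetter_of_lt hl).2 rfl)
    have hc1 := hh.harm.comp_of_lt h0 hl (j := 1) (by decide)
    have hc2 := hh.harm.comp_of_lt h0 hl (j := 2) (by decide)
    have hm1 := hh.harm.matching_of_lt h0 hl (i := 1) (by decide)
    have hm2 := hh.harm.matching_of_lt h0 hl (i := 2) (by decide)
    have hm := hh.harm.matching_bottom_of_lt h0 hl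
    rw [hc1.normalDeriv_eq] at hd1
    rw [hc2.normalDeriv_eq] at hd2
    rw [hn.normalDeriv_one hS0 hS1] at hm1
    rw [hn.normalDeriv_two hS0 hS1] at hm2
    rw [hd1, hd2, hn.normalDeriv_one hS0 hS1, hn.normalDeriv_two hS0 hS1]
    simp only [normalQuotient_zero, Function.comp_apply, F_q_self, F_q_comm 1 0, F_q_comm 2 0,
      F_q_comm 2 1] at hm1 hm2 hm ⊢
    have hD : 6 + 4 * eta1 (shift lam) + 4 * eta2 (shift lam) ≠ 0 := by positivity
    ext k
    fin_cases k
    · simp [letterMatrix, Matrix.mulVec, dotProduct, Fin.sum_univ_two]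
      field_simp
      linear_combination
        (-(3 + 2 * (eta1 (shift lam) + eta2 (shift lam)))) * (hm + hm1 + hm2)
          - 2 * (eta1 (shift lam) + eta2 (shift lam)) * (hm1 - hm2)
    · simp [letterMatrix, Matrix.mulVec, dotProduct, Fin.sum_univ_two]
      field_simp
      linear_combination
        (-(3 + 2 * (eta1 (shift lam) + eta2 (shift lam)))) * (hm + hm1 + hm2)
          + 2 * (eta1 (shift lam) + eta2 (shift lam)) * (hm1 - hm2)
  · have hn1 := hpiece 1 ((isLetter_of_ge h1 hl).2 (by decide))
    have hn2 := hpiece 2 ((isLetter_of_ge h1 hl).2 (by decide))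
    have hm := hh.harm.matching_of_ge h0 h1 hl
    rw [hn1.normalDeriv_two hS0 hS1, hn2.normalDeriv_one hS0 hS1] at hm
    rw [hn1.normalDeriv_one hS0 hS1] at hd1
    rw [hn2.normalDeriv_two hS0 hS1] at hd2
    rw [isLetter_of_ge h1 hl] at hj
    simp only [Function.comp_apply, F_q_self, F_q_comm 2 1] at hm hd1 hd2
    rw [hd1, hd2]
    fin_cases j
    · exact (hj rfl).elim
    · rw [show F ((fun i => i) ⟨1, by decide⟩) = F 1 from rfl, hn1.normalDeriv_one hS0 hS1,
        hn1.normalDeriv_two hS0 hS1]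
      ext k
      fin_cases k
      · simp [letterMatrix, Matrix.mulVec, dotProduct, Fin.sum_univ_two, F_q_self]
      · simp [letterMatrix, Matrix.mulVec, dotProduct, Fin.sum_univ_two, F_q_self]
        field_simp
        linear_combination (-eta1 (shift lam)) * hm
    · rw [show F ((fun i => i) ⟨2, by decide⟩) = F 2 from rfl, hn2.normalDeriv_one hS0 hS1,
        hn2.normalDeriv_two hS0 hS1]
      ext k
      fin_cases k
      · simp [letterMatrix, Matrix.mulVec, dotProduct, Fin.sum_univ_two, F_q_self, F_q_comm 2 1]
        field_simp
        linear_combination (-eta1 (shift lam)) * hm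
      · simp [letterMatrix, Matrix.mulVec, dotProduct, Fin.sum_univ_two, F_q_self, F_q_comm 2 1]

theorem CutWord.wordMatrix_mulVec {lam : ℝ} (h0 : 0 ≤ lam) (h1 : lam < 1) {w : List (Fin 3)}
    (hw : CutWord lam w) {h : ℝ × ℝ → ℝ} (hh : IsNullSolution lam h) :
    (wordMatrix lam w).mulVec ![normalDeriv h 1, normalDeriv h 2] =
      (5 / 3 : ℝ) ^ w.length • ![normalDeriv (h ∘ cellMap w) 1, normalDeriv (h ∘ cellMap w) 2] := by
  induction w generalizing lam h with
  | nil => simp [wordMatrix]; exact ⟨rfl, rfl⟩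
  | cons j w ih =>
    rw [wordMatrix, ← Matrix.mulVec_mulVec, hh.letterMatrix_mulVec h0 h1 hw.1, Matrix.mulVec_smul,
      ih (shift_nonneg h0 h1) (shift_lt_one h0 h1) hw.2 (h := h ∘ F j)
        (CutWord.isNullSolution h0 h1 (w := [j]) ⟨hw.1, trivial⟩ hh), smul_smul, List.length_cons,
      pow_succ']
    rfl

/-! ### Sums over the cells meeting the cut -/

theorem cutSum_congr {lam : ℝ} (h0 : 0 ≤ lam) (h1 : lam < 1) {m : ℕ} {G H : List (Fin 3) → ℝ}
    (hGH : ∀ w, w.length = m → CutWord lam w → G w = H w) : cutSum lam m G = cutSum lam m H := by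
  refine Finset.sum_congr rfl fun w _ => ?_
  split_ifs with hw
  · exact hGH _ (List.length_ofFn) ((isCutWord_iff h0 h1 w).1 hw)
  · rfl

open Classical in
/-- The words of length `m` that describe the cells meeting the cut. -/
noncomputable def cutWords (lam : ℝ) (m : ℕ) : Finset (Fin m → Fin 3) :=
  Finset.univ.filter (IsCutWord lam)

theorem mem_cutWords {lam : ℝ} (h0 : 0 ≤ lam) (h1 : lam < 1) {m : ℕ} {w : Fin m → Fin 3} :
    w ∈ cutWords lam m ↔ CutWord lam (List.ofFn w) := by
  simp [cutWords, isCutWord_iff h0 h1]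

theorem cutSum_eq_sum (lam : ℝ) (m : ℕ) (G : List (Fin 3) → ℝ) :
    cutSum lam m G = ∑ w ∈ cutWords lam m, G (List.ofFn w) := by
  simp [cutSum, cutWords, Finset.sum_filter]

theorem IsNonnegNullSolution.abs_cutSum_sub_le {lam : ℝ} (h0 : 0 ≤ lam) (h1 : lam < 1)
    {h : ℝ × ℝ → ℝ} (hh : IsNonnegNullSolution lam h) {m : ℕ} {G H : List (Fin 3) → ℝ} {ε : ℝ}
    (hGH : ∀ w, w.length = m → CutWord lam w → |G w - H w| ≤ ε * flux (h ∘ cellMap w)) :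
    |(5 / 3) ^ m * cutSum lam m G - (5 / 3) ^ m * cutSum lam m H| ≤ ε * flux h := by
  rw [← hh.harm.cutSum_flux h0 h1 m, ← mul_sub, abs_mul, abs_of_pos (by positivity),
    mul_left_comm ε]
  refine mul_le_mul_of_nonneg_left ?_ (by positivity)
  simp only [cutSum_eq_sum, ← Finset.sum_sub_distrib, Finset.mul_sum]
  refine (Finset.abs_sum_le_sum_abs _ _).trans (Finset.sum_le_sum fun w hw => ?_)
  exact hGH _ List.length_ofFn ((mem_cutWords h0 h1).1 hw)

/-- Two families of terms that differ by a small multiple of the flux have sums with the same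
limit. -/
theorem IsNonnegNullSolution.tendsto_cutSum {lam : ℝ} (h0 : 0 ≤ lam) (h1 : lam < 1)
    {h : ℝ × ℝ → ℝ} (hh : IsNonnegNullSolution lam h) {G H : List (Fin 3) → ℝ} {L : ℝ}
    (hGH : ∀ ε > 0, ∃ M : ℕ, ∀ w, M ≤ w.length → CutWord lam w →
      |G w - H w| ≤ ε * flux (h ∘ cellMap w))
    (hH : Tendsto (fun m => (5 / 3) ^ m * cutSum lam m H) atTop (𝓝 L)) :
    Tendsto (fun m => (5 / 3) ^ m * cutSum lam m G) atTop (𝓝 L) := by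
  have hd : Tendsto (fun m => (5 / 3) ^ m * cutSum lam m G - (5 / 3) ^ m * cutSum lam m H)
      atTop (𝓝 0) := by
    refine Metric.tendsto_atTop.2 fun ε hε => ?_
    have hf := hh.flux_nonneg h0 h1
    obtain ⟨M, hM⟩ := hGH (ε / (flux h + 1)) (by positivity)
    refine ⟨M, fun m hm => ?_⟩
    rw [Real.dist_eq, sub_zero]
    refine (hh.abs_cutSum_sub_le h0 h1 fun w hw hc => hM w (by omega) hc).trans_lt ?_
    rw [div_mul_eq_mul_div, div_lt_iff₀ (by positivity)]
    nlinarith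
  simpa using hd.add hH

open Classical in
/-- The flux through the part of the cut in the cell of `v` is the sum of the fluxes through its
parts in smaller cells. -/
theorem IsHarmonicIn.cutSum_prefix {lam : ℝ} (h0 : 0 ≤ lam) (h1 : lam < 1) {u : ℝ × ℝ → ℝ}
    (hu : IsHarmonicIn lam u) {v : List (Fin 3)} (hv : CutWord lam v) {m : ℕ} (hm : v.length ≤ m) :
    (5 / 3) ^ m * cutSum lam m (fun w => if v <+: w then flux (u ∘ cellMap w) else 0) =
      (5 / 3) ^ v.length * flux (u ∘ cellMap v) := by
  induction v generalizing lam u m with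
  | nil =>
    simp only [List.nil_prefix, if_true, hu.cutSum_flux h0 h1, List.length_nil, pow_zero, one_mul]
    rfl
  | cons j v ih =>
    obtain ⟨m, rfl⟩ : ∃ n, m = n + 1 := ⟨m - 1, by simp at hm; omega⟩
    rw [cutSum_succ h0 h1, Finset.sum_eq_single j]
    · rw [if_pos hv.1]
      have := ih (shift_nonneg h0 h1) (shift_lt_one h0 h1) (hu.comp h0 h1 hv.1) hv.2
        (m := m) (by simpa using hm)
      simp only [List.cons_prefix_cons, true_and]
      rw [pow_succ', mul_assoc, List.length_cons, pow_succ', mul_assoc]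
      exact congrArg _ this
    · intro k _ hk
      have : ∀ w, ¬ (j :: v <+: k :: w) := fun w hw => hk (List.cons_prefix_cons.1 hw).1.symm
      simp [this, cutSum]
    · simp

/-! ### The measures on the cut -/

/-- A probability measure on the cut for which the mass of the part of the cut in a cell is
proportional to the flux of `h` through it. -/
structure IsFluxMeasure (lam : ℝ) (h : ℝ × ℝ → ℝ) (μ : Measure (ℝ × ℝ)) : Prop where
  prob : IsProbabilityMeasure μ
  compl : μ (cutSet lam)ᶜ = 0
  piece : ∀ w, CutWord lam w →
    μ.real (cutPiece lam w) * flux h = (5 / 3) ^ w.length * flux (h ∘ cellMap w)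

theorem isCutMeasure_iff {lam : ℝ} (h0 : 0 ≤ lam) (h1 : lam < 1) {h : ℝ × ℝ → ℝ}
    (hh : IsNullSolution lam h) (hf : flux h = eta1 lam - eta2 lam) (μ : Measure (ℝ × ℝ)) :
    IsCutMeasure lam ![normalDeriv h 1, normalDeriv h 2] μ ↔ IsFluxMeasure lam h μ := by
  have hpos : eta1 lam - eta2 lam ≠ 0 := by
    have := (isCutCoeff_eta h0 h1).one_le
    linarith
  have key : ∀ w, CutWord lam w → 1 / (eta1 lam - eta2 lam) *
      (![1, 1] ⬝ᵥ (wordMatrix lam w).mulVec ![normalDeriv h 1, normalDeriv h 2]) =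
      (5 / 3) ^ w.length * flux (h ∘ cellMap w) / flux h := fun w hw => by
    rw [hw.wordMatrix_mulVec h0 h1 hh, hf]
    simp [dotProduct, Fin.sum_univ_two, flux]
    ring
  constructor
  · rintro ⟨hp, hc, hw⟩
    refine ⟨hp, hc, fun w hcw => ?_⟩
    obtain ⟨m, hm⟩ : ∃ m, w.length = m := ⟨_, rfl⟩
    obtain ⟨v, rfl⟩ := exists_ofFn_eq hm
    rw [hw _ v ((isCutWord_iff h0 h1 v).2 hcw), key _ hcw, hf, div_mul_cancel₀ _ hpos]
  · rintro ⟨hp, hc, hw⟩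
    refine ⟨hp, hc, fun m v hv => ?_⟩
    have hcw := (isCutWord_iff h0 h1 v).1 hv
    rw [key _ hcw, eq_div_iff (hf ▸ hpos), hw _ hcw]

theorem exists_cutPoint {lam : ℝ} (h0 : 0 ≤ lam) (h1 : lam < 1) : ∃ x : List (Fin 3) → cutSet lam,
    ∀ w, CutWord lam w → (x w : ℝ × ℝ) ∈ cutPiece lam w := by
  have hx : ∀ w, ∃ p : cutSet lam, CutWord lam w → (p : ℝ × ℝ) ∈ cutPiece lam w := fun w => by
    by_cases hw : CutWord lam w
    · obtain ⟨p, hp⟩ := hw.cutPiece_nonempty h0 h1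
      exact ⟨⟨p, hp.2⟩, fun _ => hp⟩
    · exact ⟨⟨_, (cutSet_nonempty h0 h1).some_mem⟩, fun h => absurd h hw⟩
  choose x hx using hx
  exact ⟨x, hx⟩

theorem setIntegral_cutSet_eq_sum {lam : ℝ} (h0 : 0 ≤ lam) (h1 : lam < 1) {μ : Measure (ℝ × ℝ)}
    [IsFiniteMeasure μ] {f : ℝ × ℝ → ℝ} (hf : ContinuousOn f (cutSet lam)) (m : ℕ) :
    ∫ x in cutSet lam, f x ∂μ = cutSum lam m fun w => ∫ x in cutPiece lam w, f x ∂μ := by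
  have hU : cutSet lam = ⋃ w ∈ cutWords lam m, cutPiece lam (List.ofFn w) := by
    refine Subset.antisymm (fun p hp => ?_) (iUnion₂_subset fun w _ => inter_subset_right)
    obtain ⟨w, hw, hc, hpw⟩ := exists_cutWord h0 h1 m hp
    obtain ⟨v, rfl⟩ := exists_ofFn_eq hw
    exact mem_iUnion₂.2 ⟨v, (mem_cutWords h0 h1).2 hc, hpw⟩
  have hi : IntegrableOn f (cutSet lam) μ := hf.integrableOn_compact (isCompact_cutSet h0 h1)
  rw [cutSum_eq_sum, hU]
  refine integral_biUnion_finset _ (fun w _ => (isClosed_cutPiece h0 h1 _).measurableSet) ?_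
    fun w _ => hi.mono_set inter_subset_right
  intro w hw w' hw' hne
  refine disjoint_left.2 fun p hp hp' => hne ?_
  exact List.ofFn_injective (((mem_cutWords h0 h1).1 hw).eq_of_mem h0 h1
    ((mem_cutWords h0 h1).1 hw') (by simp) hp hp')

/-- Integrals with respect to a flux measure are limits of Riemann sums. -/
theorem IsFluxMeasure.tendsto_cutSum {lam : ℝ} (h0 : 0 ≤ lam) (h1 : lam < 1) {h : ℝ × ℝ → ℝ}
    (hh : IsNonnegNullSolution lam h) {μ : Measure (ℝ × ℝ)} (hμ : IsFluxMeasure lam h μ)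
    {f : ℝ × ℝ → ℝ} (hf : ContinuousOn f (cutSet lam)) {x : List (Fin 3) → ℝ × ℝ}
    (hx : ∀ w, CutWord lam w → x w ∈ cutPiece lam w) :
    Tendsto (fun m => (5 / 3) ^ m * cutSum lam m fun w => f (x w) * flux (h ∘ cellMap w)) atTop
      (𝓝 (flux h * ∫ x in cutSet lam, f x ∂μ)) := by
  have := hμ.prob
  refine hh.tendsto_cutSum h0 h1
    (H := fun w => (3 / 5) ^ w.length * flux h * ∫ x in cutPiece lam w, f x ∂μ) ?_ ?_
  · intro ε hε
    obtain ⟨δ, hδ, hfδ⟩ := Metric.uniformContinuousOn_iff.1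
      ((isCompact_cutSet h0 h1).uniformContinuousOn_of_continuous hf) ε hε
    obtain ⟨M, hM⟩ := exists_dist_cellMap_lt hδ
    refine ⟨M, fun w hw hc => ?_⟩
    have hi : IntegrableOn f (cutPiece lam w) μ :=
      (hf.integrableOn_compact (isCompact_cutSet h0 h1)).mono_set inter_subset_right
    have hp : flux (h ∘ cellMap w) = (3 / 5) ^ w.length * flux h * μ.real (cutPiece lam w) := by
      have e := hμ.piece w hc
      have e' : ((3 : ℝ) / 5) ^ w.length * (5 / 3) ^ w.length = 1 := by
        rw [← mul_pow]; norm_num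
      linear_combination (-(3 / 5 : ℝ) ^ w.length) * e - flux (h ∘ cellMap w) * e'
    have hb : |f (x w) * μ.real (cutPiece lam w) - ∫ y in cutPiece lam w, f y ∂μ| ≤
        ε * μ.real (cutPiece lam w) := by
      have hc' : ∫ _ in cutPiece lam w, f (x w) ∂μ = f (x w) * μ.real (cutPiece lam w) := by
        rw [setIntegral_const, smul_eq_mul, mul_comm]
      rw [← hc', ← integral_sub (integrable_const (μ := μ.restrict (cutPiece lam w)) _) hi]
      rw [← Real.norm_eq_abs]
      refine norm_setIntegral_le_of_norm_le_const (measure_lt_top μ _) fun y hy => ?_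
      obtain ⟨⟨a, ha, hxa⟩, hxX⟩ := hx w hc
      obtain ⟨⟨b, hb, hyb⟩, hyX⟩ := hy
      have := hfδ _ hxX _ hyX (by rw [← hxa, ← hyb]; exact hM w hw a ha b hb)
      exact this.le
    have hfl : 0 ≤ (3 / 5) ^ w.length * flux h := mul_nonneg (by positivity) (hh.flux_nonneg h0 h1)
    have := mul_le_mul_of_nonneg_left hb hfl
    rw [hp, show f (x w) * ((3 / 5) ^ w.length * flux h * μ.real (cutPiece lam w)) -
      (3 / 5) ^ w.length * flux h * ∫ x in cutPiece lam w, f x ∂μ = (3 / 5) ^ w.length * flux h *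
      (f (x w) * μ.real (cutPiece lam w) - ∫ y in cutPiece lam w, f y ∂μ) by ring, abs_mul,
      abs_of_nonneg hfl]
    linarith
  · refine tendsto_const_nhds.congr fun m => ?_
    rw [setIntegral_cutSet_eq_sum h0 h1 hf m, cutSum_eq_sum, cutSum_eq_sum, Finset.mul_sum,
      Finset.mul_sum]
    refine Finset.sum_congr rfl fun w _ => ?_
    have e' : ((3 : ℝ) / 5) ^ m * (5 / 3) ^ m = 1 := by
      rw [← mul_pow]; norm_num
    rw [List.length_ofFn]
    linear_combination (-flux h * ∫ x in cutPiece lam (List.ofFn w), f x ∂μ) * e'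

open BoundedContinuousFunction in
theorem IsFluxMeasure.unique {lam : ℝ} (h0 : 0 ≤ lam) (h1 : lam < 1) {h : ℝ × ℝ → ℝ}
    (hh : IsNonnegNullSolution lam h) (hpos : 0 < flux h) {μ ν : Measure (ℝ × ℝ)}
    (hμ : IsFluxMeasure lam h μ) (hν : IsFluxMeasure lam h ν) : μ = ν := by
  have := hμ.prob
  have := hν.prob
  refine ext_of_forall_integral_eq_of_IsFiniteMeasure fun f : (ℝ × ℝ) →ᵇ ℝ => ?_
  obtain ⟨x, hx⟩ := exists_cutPoint h0 h1
  have e := tendsto_nhds_unique (hμ.tendsto_cutSum h0 h1 hh f.continuous.continuousOn (x := fun w => x w) hx)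
    (hν.tendsto_cutSum h0 h1 hh f.continuous.continuousOn (x := fun w => x w) hx)
  have hr : ∀ ρ : Measure (ℝ × ℝ), IsFluxMeasure lam h ρ →
      ∫ y, f y ∂ρ = ∫ y in cutSet lam, f y ∂ρ := fun ρ hρ => by
    rw [Measure.restrict_eq_self_of_ae_mem]
    exact (measure_eq_zero_iff_ae_notMem.1 hρ.compl).mono fun y hy => not_not.1 hy
  rw [hr μ hμ, hr ν hν]
  exact mul_left_cancel₀ hpos.ne' e

theorem cutPoint_mem_cell_iff {lam : ℝ} (h0 : 0 ≤ lam) (h1 : lam < 1) {v w : List (Fin 3)}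
    (hv : CutWord lam v) (hw : CutWord lam w) (hl : v.length ≤ w.length) {p : ℝ × ℝ}
    (hp : p ∈ cutPiece lam w) : p ∈ cellMap v '' SG ↔ v <+: w := by
  obtain ⟨⟨a, ha, hpa⟩, hX⟩ := hp
  constructor
  · intro hpv
    rw [← List.take_append_drop v.length w] at hw hpa
    have hpw : p ∈ cutPiece lam (w.take v.length) := by
      rw [cellMap_append] at hpa
      exact ⟨⟨_, cellMap_mem ha _, hpa⟩, hX⟩
    rw [hv.eq_of_mem h0 h1 hw.of_append (by simpa using hl) ⟨hpv, hX⟩ hpw]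
    exact List.take_prefix _ _
  · rintro ⟨t, rfl⟩
    rw [cellMap_append] at hpa
    exact ⟨_, cellMap_mem ha t, hpa⟩

/-- The pieces of the cut are clopen, since the other pieces of the same level are closed. -/
theorem isClopen_piece {lam : ℝ} (h0 : 0 ≤ lam) (h1 : lam < 1) {v : List (Fin 3)}
    (hv : CutWord lam v) : IsClopen {e : cutSet lam | (e : ℝ × ℝ) ∈ cellMap v '' SG} := by
  classical
  refine ⟨(isClosed_cell v).preimage continuous_subtype_val, isClosed_compl_iff.1 ?_⟩
  have he : {e : cutSet lam | (e : ℝ × ℝ) ∈ cellMap v '' SG}ᶜ =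
      ⋃ w ∈ (cutWords lam v.length).filter (fun w => List.ofFn w ≠ v),
        {e : cutSet lam | (e : ℝ × ℝ) ∈ cellMap (List.ofFn w) '' SG} := by
    ext ⟨p, hp⟩
    simp only [mem_compl_iff, mem_ofPred_eq, mem_iUnion, Finset.mem_filter, mem_cutWords h0 h1]
    constructor
    · intro hn
      obtain ⟨w, hw, hc, hpw⟩ := exists_cutWord h0 h1 v.length hp
      obtain ⟨w, rfl⟩ := exists_ofFn_eq hw
      exact ⟨w, ⟨hc, fun h => hn (h ▸ hpw.1)⟩, hpw.1⟩
    · rintro ⟨w, ⟨hc, hne⟩, hpw⟩ hpv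
      exact hne (hc.eq_of_mem h0 h1 hv (by simp) ⟨hpw, hp⟩ ⟨hpv, hp⟩)
  rw [he]
  exact isClosed_biUnion_finset fun w _ => (isClosed_cell _).preimage continuous_subtype_val

/-- The approximating measures: point masses in the pieces of the cut of level `m`, proportional to
the flux of `h`. -/
noncomputable def pointMasses (lam : ℝ) (h : ℝ × ℝ → ℝ) (x : List (Fin 3) → cutSet lam) (m : ℕ) :
    Measure (cutSet lam) :=
  ∑ w ∈ cutWords lam m, ENNReal.ofReal ((5 / 3) ^ m * flux (h ∘ cellMap (List.ofFn w)) / flux h) •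
    Measure.dirac (x (List.ofFn w))

open Classical in
theorem IsNonnegNullSolution.pointMasses_apply {lam : ℝ} (h0 : 0 ≤ lam) (h1 : lam < 1)
    {h : ℝ × ℝ → ℝ} (hh : IsNonnegNullSolution lam h) (x : List (Fin 3) → cutSet lam) (m : ℕ)
    {A : Set (cutSet lam)} (hA : MeasurableSet A) :
    pointMasses lam h x m A = ENNReal.ofReal
      ((5 / 3) ^ m * cutSum lam m (fun w => if x w ∈ A then flux (h ∘ cellMap w) else 0) /
        flux h) := by
  have hf := hh.flux_nonneg h0 h1
  have hn : ∀ w ∈ cutWords lam m, 0 ≤ flux (h ∘ cellMap (List.ofFn w)) := fun w hw => by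
    obtain ⟨hS0, hS1⟩ := shiftBy_nonneg_lt_one h0 h1 (List.ofFn w)
    exact (((mem_cutWords h0 h1).1 hw).isNonnegNullSolution h0 h1 hh).flux_nonneg hS0 hS1
  rw [cutSum_eq_sum, Finset.mul_sum, Finset.sum_div, ENNReal.ofReal_sum_of_nonneg]
  · rw [pointMasses, Measure.finsetSum_apply]
    refine Finset.sum_congr rfl fun w _ => ?_
    rw [Measure.smul_apply, Measure.dirac_apply' _ hA, smul_eq_mul, indicator_apply]
    split_ifs <;> simp
  · intro w hw
    have := hn w hw
    split_ifs
    · positivity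
    · simp

/-- A flux measure is a weak limit of point masses. The pieces of the cut are clopen, so that their
masses pass to the limit. -/
theorem IsNonnegNullSolution.exists_isFluxMeasure {lam : ℝ} (h0 : 0 ≤ lam) (h1 : lam < 1)
    {h : ℝ × ℝ → ℝ} (hh : IsNonnegNullSolution lam h) (hpos : 0 < flux h) :
    ∃ μ, IsFluxMeasure lam h μ := by
  classical
  obtain ⟨x, hx⟩ := exists_cutPoint h0 h1
  have hcpt : CompactSpace (cutSet lam) := isCompact_iff_compactSpace.1 (isCompact_cutSet h0 h1)
  have hP : ∀ m, IsProbabilityMeasure (pointMasses lam h x m) := fun m => ⟨by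
    rw [hh.pointMasses_apply h0 h1 x m MeasurableSet.univ]
    simp [hh.harm.cutSum_flux h0 h1, hpos.ne']⟩
  have hmass : ∀ v, CutWord lam v → ∀ m, v.length ≤ m →
      pointMasses lam h x m {e | (e : ℝ × ℝ) ∈ cellMap v '' SG} =
        ENNReal.ofReal ((5 / 3) ^ v.length * flux (h ∘ cellMap v) / flux h) := fun v hv m hm => by
    rw [hh.pointMasses_apply h0 h1 x m (isClopen_piece h0 h1 hv).isOpen.measurableSet,
      ← hh.harm.cutSum_prefix h0 h1 hv hm]
    congr 3
    refine cutSum_congr h0 h1 fun w hw hc => ?_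
    rw [mem_ofPred_eq, cutPoint_mem_cell_iff h0 h1 hv hc (hw ▸ hm) (hx w hc)]
    by_cases h : v <+: w <;> simp [h]
  let ρ : ℕ → ProbabilityMeasure (cutSet lam) := fun m => ⟨pointMasses lam h x m, hP m⟩
  obtain ⟨μ, hμ⟩ : ∃ μ, Tendsto ρ (hyperfilter ℕ) (𝓝 μ) :=
    ⟨_, ((hyperfilter ℕ).map ρ).le_nhds_lim⟩
  have hlim : ∀ v, CutWord lam v → (μ : Measure (cutSet lam))
      {e | (e : ℝ × ℝ) ∈ cellMap v '' SG} =
        ENNReal.ofReal ((5 / 3) ^ v.length * flux (h ∘ cellMap v) / flux h) := fun v hv => by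
    have hcl := isClopen_piece h0 h1 hv
    have ht := ProbabilityMeasure.tendsto_measure_of_null_frontier_of_tendsto' hμ
      (E := {e | (e : ℝ × ℝ) ∈ cellMap v '' SG}) (by rw [hcl.frontier_eq, measure_empty])
    refine tendsto_nhds_unique ht (tendsto_const_nhds.congr' ?_)
    have hle : (hyperfilter ℕ : Filter ℕ) ≤ atTop := by
      rw [← Nat.cofinite_eq_atTop]; exact hyperfilter_le_cofinite
    filter_upwards [hle (eventually_ge_atTop v.length)] with m hm
    exact (hmass v hv m hm).symm
  have hme : MeasurableEmbedding (Subtype.val : cutSet lam → ℝ × ℝ) :=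
    MeasurableEmbedding.subtype_coe (isCompact_cutSet h0 h1).isClosed.measurableSet
  refine ⟨(μ : Measure (cutSet lam)).map Subtype.val,
    Measure.isProbabilityMeasure_map hme.measurable.aemeasurable, ?_, fun w hw => ?_⟩
  · rw [hme.map_apply]
    simp
  · obtain ⟨hS0, hS1⟩ := shiftBy_nonneg_lt_one h0 h1 w
    have hn := (hw.isNonnegNullSolution h0 h1 hh).flux_nonneg hS0 hS1
    have he : Subtype.val ⁻¹' cutPiece lam w = {e : cutSet lam | (e : ℝ × ℝ) ∈ cellMap w '' SG} := by
      ext e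
      exact and_iff_left e.2
    rw [Measure.real, hme.map_apply, he, hlim w hw, ENNReal.toReal_ofReal (by positivity),
      div_mul_cancel₀ _ hpos.ne']

/-! ### The boundary terms of Green's formula along the cut -/

/-- The constant is absolute, since `η₁ ≤ 2 (η₁ - η₂)`. -/
theorem IsNonnegNullSolution.abs_bottomPairing_le {lam : ℝ} (h0 : 0 ≤ lam) (h1 : lam < 1)
    {g v : ℝ × ℝ → ℝ} (hg : IsNonnegNullSolution lam g) (hc : ContinuousOn v (closedDomain lam))
    (hv : IsHarmonicIn lam v) {c ε : ℝ} (hε : ∀ p ∈ closedDomain lam, |v p - c| ≤ ε) :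
    |bottomPairing g v| ≤ 4 * ε * flux g := by
  have hη := isCutCoeff_eta h0 h1
  have hε0 : 0 ≤ ε := (abs_nonneg _).trans (hε (q 1) (by simp [closedDomain, domainBoundary]))
  have hd1 := hv.abs_normalDeriv_le h0 h1 hc hε (i := 1) (by decide)
  have hd2 := hv.abs_normalDeriv_le h0 h1 hc hε (i := 2) (by decide)
  have hs := hg.q1_nonneg
  have ht := hg.q2_nonneg
  have hr : eta1 lam ≤ 2 * (eta1 lam - eta2 lam) := by linarith [hη.ratio]
  rw [hg.flux_eq h0 h1]
  calc |bottomPairing g v| ≤ g (q 1) * |normalDeriv v 1| + g (q 2) * |normalDeriv v 2| := by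
        refine (abs_add_le _ _).trans_eq ?_
        rw [abs_mul, abs_mul, abs_of_nonneg hs, abs_of_nonneg ht]
    _ ≤ g (q 1) * (2 * eta1 lam * ε) + g (q 2) * (2 * eta1 lam * ε) := by gcongr
    _ = eta1 lam * (2 * ε * (g (q 1) + g (q 2))) := by ring
    _ ≤ 2 * (eta1 lam - eta2 lam) * (2 * ε * (g (q 1) + g (q 2))) := by gcongr
    _ = _ := by ring

theorem IsNonnegNullSolution.abs_bottomPairing_sub_le {lam : ℝ} (h0 : 0 ≤ lam) (h1 : lam < 1)
    {g v : ℝ × ℝ → ℝ} (hg : IsNonnegNullSolution lam g) {c ε : ℝ}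
    (hε : ∀ p ∈ closedDomain lam, |v p - c| ≤ ε) :
    |bottomPairing v g - c * flux g| ≤ 3 * ε * flux g := by
  have e1 := hε (q 1) (by simp [closedDomain, domainBoundary])
  have e2 := hε (q 2) (by simp [closedDomain, domainBoundary])
  have hε0 : 0 ≤ ε := (abs_nonneg _).trans e1
  calc |bottomPairing v g - c * flux g|
      = |(v (q 1) - c) * normalDeriv g 1 + (v (q 2) - c) * normalDeriv g 2| := by
        rw [bottomPairing, flux]
        ring_nf
    _ ≤ |v (q 1) - c| * |normalDeriv g 1| + |v (q 2) - c| * |normalDeriv g 2| := by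
        refine (abs_add_le _ _).trans_eq ?_
        rw [abs_mul, abs_mul]
    _ ≤ ε * |normalDeriv g 1| + ε * |normalDeriv g 2| := by gcongr
    _ = ε * (|normalDeriv g 1| + |normalDeriv g 2|) := by ring
    _ ≤ ε * (3 * flux g) := by gcongr; exact hg.abs_normalDeriv_add_le h0 h1
    _ = _ := by ring

/-- A continuous function is almost constant on the part of the domain in a small cell. -/
theorem exists_oscillation_le {lam : ℝ} (h0 : 0 ≤ lam) (h1 : lam < 1) {u : ℝ × ℝ → ℝ}
    (hu : ContinuousOn u (closedDomain lam)) {x : List (Fin 3) → ℝ × ℝ}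
    (hx : ∀ w, CutWord lam w → x w ∈ cutPiece lam w) {ε : ℝ} (hε : 0 < ε) :
    ∃ M : ℕ, ∀ w, M ≤ w.length → CutWord lam w → ∀ p ∈ closedDomain (shiftBy lam w),
      |(u ∘ cellMap w) p - u (x w)| ≤ ε := by
  obtain ⟨δ, hδ, huδ⟩ := Metric.uniformContinuousOn_iff.1
    ((isCompact_closedDomain h0 h1).uniformContinuousOn_of_continuous hu) ε hε
  obtain ⟨M, hM⟩ := exists_dist_cellMap_lt hδ
  refine ⟨M, fun w hw hc p hp => ?_⟩
  obtain ⟨hS0, hS1⟩ := shiftBy_nonneg_lt_one h0 h1 w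
  obtain ⟨⟨a, ha, hxa⟩, hxX⟩ := hx w hc
  refine (huδ _ (hc.cellMap_mem_closedDomain h0 h1 hp) _ (cutSet_subset_closedDomain h0 h1 hxX) ?_).le
  rw [← hxa]
  exact hM w hw _ (closedDomain_subset_SG hS0 hS1 hp) a ha

/-- The boundary terms along the cut in which the null solution is not differentiated vanish in the
limit. -/
theorem IsNonnegNullSolution.tendsto_cutSum_bottomPairing {lam : ℝ} (h0 : 0 ≤ lam) (h1 : lam < 1)
    {h u : ℝ × ℝ → ℝ} (hh : IsNonnegNullSolution lam h) (hc : ContinuousOn u (closedDomain lam))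
    (hu : IsHarmonicIn lam u) :
    Tendsto (fun m => (5 / 3) ^ m * cutSum lam m fun w =>
      bottomPairing (h ∘ cellMap w) (u ∘ cellMap w)) atTop (𝓝 0) := by
  obtain ⟨x, hx⟩ := exists_cutPoint h0 h1
  refine hh.tendsto_cutSum h0 h1 (H := fun _ => 0) (fun ε hε => ?_) (by simp [cutSum])
  obtain ⟨M, hM⟩ := exists_oscillation_le h0 h1 hc (x := fun w => x w) hx
    (show 0 < ε / 4 by positivity)
  refine ⟨M, fun w hw hcw => ?_⟩
  obtain ⟨hS0, hS1⟩ := shiftBy_nonneg_lt_one h0 h1 w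
  rw [sub_zero]
  refine ((hcw.isNonnegNullSolution h0 h1 hh).abs_bottomPairing_le hS0 hS1
    (hcw.continuousOn h0 h1 hc) (hcw.isHarmonicIn h0 h1 hu) (hM w hw hcw)).trans_eq ?_
  ring

/-- The boundary terms along the cut in which the null solution is differentiated converge to an
integral over the cut. -/
theorem IsFluxMeasure.tendsto_cutSum_bottomPairing {lam : ℝ} (h0 : 0 ≤ lam) (h1 : lam < 1)
    {h u : ℝ × ℝ → ℝ} (hh : IsNonnegNullSolution lam h) {μ : Measure (ℝ × ℝ)}
    (hμ : IsFluxMeasure lam h μ) (hc : ContinuousOn u (closedDomain lam)) :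
    Tendsto (fun m => (5 / 3) ^ m * cutSum lam m fun w =>
      bottomPairing (u ∘ cellMap w) (h ∘ cellMap w)) atTop
      (𝓝 (flux h * ∫ x in cutSet lam, u x ∂μ)) := by
  obtain ⟨x, hx⟩ := exists_cutPoint h0 h1
  refine hh.tendsto_cutSum h0 h1 (fun ε hε => ?_) (hμ.tendsto_cutSum h0 h1 hh
    (hc.mono (cutSet_subset_closedDomain h0 h1)) (x := fun w => x w) hx)
  obtain ⟨M, hM⟩ := exists_oscillation_le h0 h1 hc (x := fun w => x w) hx
    (show 0 < ε / 3 by positivity)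
  refine ⟨M, fun w hw hcw => ?_⟩
  obtain ⟨hS0, hS1⟩ := shiftBy_nonneg_lt_one h0 h1 w
  refine ((hcw.isNonnegNullSolution h0 h1 hh).abs_bottomPairing_sub_le hS0 hS1
    (hM w hw hcw)).trans_eq ?_
  ring

/-- The energy of a null solution and a harmonic function is given by the boundary terms at the
bottom vertices. -/
theorem IsNonnegNullSolution.hasEnergy {lam : ℝ} (h0 : 0 ≤ lam) (h1 : lam < 1)
    {h u : ℝ × ℝ → ℝ} (hh : IsNonnegNullSolution lam h) (hc : ContinuousOn u (closedDomain lam))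
    (hu : IsHarmonicIn lam u) : HasEnergy lam h u (bottomPairing h u) := by
  have := (hh.tendsto_cutSum_bottomPairing h0 h1 hc hu).const_sub (bottomPairing h u)
  rw [sub_zero] at this
  exact this.congr fun m => (hu.domainEnergy_eq h0 h1 m h).symm

/-- Green's second identity for a null solution and a harmonic function. -/
theorem IsFluxMeasure.bottomPairing_eq {lam : ℝ} (h0 : 0 ≤ lam) (h1 : lam < 1)
    {h u : ℝ × ℝ → ℝ} (hh : IsNonnegNullSolution lam h) {μ : Measure (ℝ × ℝ)}
    (hμ : IsFluxMeasure lam h μ) (hc : ContinuousOn u (closedDomain lam))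
    (hu : IsHarmonicIn lam u) :
    bottomPairing h u = bottomPairing u h - flux h * ∫ x in cutSet lam, u x ∂μ := by
  refine tendsto_nhds_unique (hh.hasEnergy h0 h1 hc hu) ?_
  refine ((hμ.tendsto_cutSum_bottomPairing h0 h1 hh hc).const_sub (bottomPairing u h)).congr
    fun m => ?_
  rw [domainEnergy_comm, hh.harm.domainEnergy_eq h0 h1 m u]

/-! ### The basic harmonic functions and their measures -/

theorem isNonnegNullSolution_basicHarmonic {lam : ℝ} (h0 : 0 ≤ lam) (h1 : lam < 1) {i : Fin 3}
    (hi : i ≠ 0) : IsNonnegNullSolution lam (basicHarmonic lam i) := by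
  have hq : ∀ j ≠ 0, 0 ≤ basicHarmonic lam i (q j) := fun j hj => by
    rw [basicHarmonic_q h0 h1 hi hj]
    split_ifs <;> norm_num
  exact ⟨isNullSolution_basicHarmonic h0 h1 hi, hq 1 (by decide), hq 2 (by decide)⟩

theorem normalDeriv_basicHarmonic {lam : ℝ} (h0 : 0 ≤ lam) (h1 : lam < 1) :
    normalDeriv (basicHarmonic lam 1) 1 = eta1 lam ∧
    normalDeriv (basicHarmonic lam 1) 2 = -eta2 lam ∧
    normalDeriv (basicHarmonic lam 2) 1 = -eta2 lam ∧
    normalDeriv (basicHarmonic lam 2) 2 = eta1 lam := by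
  have n := isNullSolution_basicHarmonic h0 h1 (i := 2) (by decide)
  refine ⟨rfl, (neg_neg _).symm, ?_, ?_⟩
  · rw [n.normalDeriv_one h0 h1]
    simp [basicHarmonic_q h0 h1]
  · rw [n.normalDeriv_two h0 h1]
    simp [basicHarmonic_q h0 h1]

theorem flux_basicHarmonic {lam : ℝ} (h0 : 0 ≤ lam) (h1 : lam < 1) {i : Fin 3}
    (hi : i = 1 ∨ i = 2) : flux (basicHarmonic lam i) = eta1 lam - eta2 lam := by
  obtain ⟨e1, e2, e3, e4⟩ := normalDeriv_basicHarmonic h0 h1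
  rcases hi with rfl | rfl
  · rw [flux, e1, e2, sub_eq_add_neg]
  · rw [flux, e3, e4, neg_add_eq_sub]

theorem existsUnique_isCutMeasure {lam : ℝ} (h0 : 0 ≤ lam) (h1 : lam < 1) {i : Fin 3}
    (hi : i = 1 ∨ i = 2) : ∃! μ, IsCutMeasure lam
      ![normalDeriv (basicHarmonic lam i) 1, normalDeriv (basicHarmonic lam i) 2] μ := by
  have hi0 : i ≠ 0 := by rcases hi with rfl | rfl <;> decide
  have hh := isNonnegNullSolution_basicHarmonic h0 h1 hi0
  have hf := flux_basicHarmonic h0 h1 hi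
  have hpos : 0 < flux (basicHarmonic lam i) := by
    rw [hf]
    linarith [(isCutCoeff_eta h0 h1).one_le]
  simp only [isCutMeasure_iff h0 h1 hh.toIsNullSolution hf]
  obtain ⟨μ, hμ⟩ := hh.exists_isFluxMeasure h0 h1 hpos
  exact ⟨μ, hμ, fun ν hν => hν.unique h0 h1 hh hpos hμ⟩

end LowerSG

/-- The normal derivatives at `q₁`, `q₂` of the solution of a Dirichlet problem on the lower domain
`Ω_λ⁻`, and their identification with energies. The first four clauses say that the objects
`h₁, h₂, μ₁, μ₂` are what they are meant to be, and unique. -/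
theorem theorem4p5 (lam : ℝ) (hlam0 : 0 ≤ lam) (hlam1 : lam < 1) :
    (∀ i : Fin 3, i = 1 ∨ i = 2 →
      IsDirichletSolution lam (vertexData i) (basicHarmonic lam i) ∧
      ∀ h : ℝ × ℝ → ℝ, IsDirichletSolution lam (vertexData i) h →
        EqOn h (basicHarmonic lam i) (closedDomain lam)) ∧
    (HasNormalDeriv (basicHarmonic lam 1) 1 (eta1 lam) ∧
      HasNormalDeriv (basicHarmonic lam 1) 2 (-eta2 lam)) ∧
    (IsCutMeasure lam ![eta1 lam, -eta2 lam] (mu1 lam) ∧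
      ∀ μ : Measure (ℝ × ℝ), IsCutMeasure lam ![eta1 lam, -eta2 lam] μ → μ = mu1 lam) ∧
    (IsCutMeasure lam ![-eta2 lam, eta1 lam] (mu2 lam) ∧
      ∀ μ : Measure (ℝ × ℝ), IsCutMeasure lam ![-eta2 lam, eta1 lam] μ → μ = mu2 lam) ∧
    ∀ f u : ℝ × ℝ → ℝ, ContinuousOn f (domainBoundary lam) → IsDirichletSolution lam f u →
      HasNormalDeriv u 1 (eta1 lam * f (q 1) - eta2 lam * f (q 2)
        - (eta1 lam - eta2 lam) * ∫ x in cutSet lam, f x ∂(mu1 lam)) ∧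
      HasNormalDeriv u 2 (eta1 lam * f (q 2) - eta2 lam * f (q 1)
        - (eta1 lam - eta2 lam) * ∫ x in cutSet lam, f x ∂(mu2 lam)) ∧
      (HasFiniteEnergy lam u →
        HasEnergy lam (basicHarmonic lam 1) u (normalDeriv u 1) ∧
        HasEnergy lam (basicHarmonic lam 2) u (normalDeriv u 2)) := by
  obtain ⟨e1, e2, e3, e4⟩ := normalDeriv_basicHarmonic hlam0 hlam1
  have hn1 := isNonnegNullSolution_basicHarmonic hlam0 hlam1 (i := 1) (by decide)
  have hn2 := isNonnegNullSolution_basicHarmonic hlam0 hlam1 (i := 2) (by decide)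
  have hf1 := flux_basicHarmonic hlam0 hlam1 (i := 1) (Or.inl rfl)
  have hf2 := flux_basicHarmonic hlam0 hlam1 (i := 2) (Or.inr rfl)
  have hM1 := existsUnique_isCutMeasure hlam0 hlam1 (i := 1) (Or.inl rfl)
  have hM2 := existsUnique_isCutMeasure hlam0 hlam1 (i := 2) (Or.inr rfl)
  rw [e1, e2] at hM1
  rw [e3, e4] at hM2
  have hμ1 : IsCutMeasure lam ![eta1 lam, -eta2 lam] (mu1 lam) := Classical.epsilon_spec hM1.exists
  have hμ2 : IsCutMeasure lam ![-eta2 lam, eta1 lam] (mu2 lam) := Classical.epsilon_spec hM2.exists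
  refine ⟨fun i hi => ?_, ⟨?_, ?_⟩, ⟨hμ1, fun μ hμ => hM1.unique hμ hμ1⟩,
    ⟨hμ2, fun μ hμ => hM2.unique hμ hμ2⟩, fun f u _ hu => ?_⟩
  · have hi0 : i ≠ 0 := by rcases hi with rfl | rfl <;> decide
    have hd := isDirichletSolution_basicHarmonic hlam0 hlam1 hi0
    refine ⟨hd, fun h hh => ?_⟩
    have he : EqOn h (basicHarmonic lam i) (domainBoundary lam) := hh.2.2.trans hd.2.2.symm
    exact IsHarmonicIn.eqOn_of_boundary_eq hlam0 hlam1 hh.1 hh.2.1 hd.1 hd.2.1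
      (fun p hp => he (Or.inl hp)) (he (Or.inr (by simp))) (he (Or.inr (by simp)))
  · exact hn1.harm.hasNormalDeriv hlam0 hlam1 (by decide)
  · rw [← e2]
    exact hn1.harm.hasNormalDeriv hlam0 hlam1 (by decide)
  · obtain ⟨hc, hharm, heq⟩ := hu
    have hq1 : u (q 1) = f (q 1) := heq (Or.inr (by simp))
    have hq2 : u (q 2) = f (q 2) := heq (Or.inr (by simp))
    have hb1 : bottomPairing (basicHarmonic lam 1) u = normalDeriv u 1 := by
      simp [bottomPairing, basicHarmonic_q hlam0 hlam1]
    have hb2 : bottomPairing (basicHarmonic lam 2) u = normalDeriv u 2 := by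
      simp [bottomPairing, basicHarmonic_q hlam0 hlam1]
    have hint : ∀ μ : Measure (ℝ × ℝ), ∫ x in cutSet lam, u x ∂μ = ∫ x in cutSet lam, f x ∂μ :=
      fun μ => setIntegral_congr_fun (isCompact_cutSet hlam0 hlam1).isClosed.measurableSet
        fun p hp => heq (Or.inl hp)
    have hg1 := IsFluxMeasure.bottomPairing_eq hlam0 hlam1 hn1
      ((isCutMeasure_iff hlam0 hlam1 hn1.toIsNullSolution hf1 (mu1 lam)).1 (by rwa [e1, e2]))
      hc hharm
    have hg2 := IsFluxMeasure.bottomPairing_eq hlam0 hlam1 hn2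
      ((isCutMeasure_iff hlam0 hlam1 hn2.toIsNullSolution hf2 (mu2 lam)).1 (by rwa [e3, e4]))
      hc hharm
    rw [hb1, hf1, hint, bottomPairing, e1, e2, hq1, hq2] at hg1
    rw [hb2, hf2, hint, bottomPairing, e3, e4, hq1, hq2] at hg2
    refine ⟨?_, ?_, fun _ => ⟨hb1 ▸ hn1.hasEnergy hlam0 hlam1 hc hharm,
      hb2 ▸ hn2.hasEnergy hlam0 hlam1 hc hharm⟩⟩
    · convert hharm.hasNormalDeriv hlam0 hlam1 (i := 1) (by decide) using 1
      rw [hg1]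
      ring
    · convert hharm.hasNormalDeriv hlam0 hlam1 (i := 2) (by decide) using 1
      rw [hg2]
      ring
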